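/- **Conventions.** For C*-algebras $A,D$, $A\otimes D$ is the spatial (minimal) tensor product, $\mathrm{M}(D)$ is the multiplier algebra, and $\mathrm{Mor}(A,D)$ is the set of $*$-homomorphisms $\varphi:A\to\mathrm{M}(D)$ that are nondegenerate, i.e. for which the linear span of $\varphi(A)D$ is dense in $D$; such $\varphi$ (and tensor products of such maps) are extended to multiplier algebras in the unique way. $\mathbb{C}\otimes A$ and $A\otimes\mathbb{C}$ are identified with $A$, and $(A\otimes B)\otimes D$ with $A\otimes(B\otimes D)$. A *bisimplifiable Hopf C*-algebra* is a pair $\mathbb{G}=(A,\Delta)$ of a C*-algebra $A$ and $\Delta\in\mathrm{Mor}(A,A\otimes A)$ with $(\Delta\otimes\mathrm{id})\circ\Delta=(\mathrm{id}\otimes\Delta)\circ\Delta$ such that the closed linear spans of $\{\Delta(a)(1\otimes a'):a,a'\in A\}$ and of $\{(a\otimes 1)\Delta(a'):a,a'\in A\}$ are both equal to $A\otimes A$. A *continuous counit* is an $\epsilon\in\mathrm{Mor}(A,\mathbb{C})$ with $(\epsilon\otimes\mathrm{id})\circ\Delta=\mathrm{id}=(\mathrm{id}\otimes\epsilon)\circ\Delta$.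 A *compact quantum group* is a bisimplifiable Hopf C*-algebra $(C,\Delta_C)$ with $C$ unital. **Theorem.** Let $\mathbb{G}=(A,\Delta)$ be a bisimplifiable Hopf C*-algebra with a continuous counit $\epsilon$, let $\mathbb{K}=(C,\Delta_C)$ be a compact quantum group, and let $\pi:A\to C$ be a surjective $*$-homomorphism with $(\pi\otimes\pi)\circ\Delta=\Delta_C\circ\pi$. Let $$B=\{x\in A:(\mathrm{id}\otimes\pi)\Delta(x)=x\otimes 1\}.$$ Then: 1. $B$ is a nondegenerate C*-subalgebra of $A$, i.e. $B$ is a norm-closed $*$-subalgebra and the linear span of $BA$ is dense in $A$ (so that $\mathrm{M}(A\otimes B)\subset\mathrm{M}(A\otimes A)$); 2. $\boldsymbol{\alpha}=\Delta|_B$ has values in $\mathrm{M}(A\otimes B)$ and belongs to $\mathrm{Mor}(B,A\otimes B)$; 3. $(\epsilon\otimes\mathrm{id})\circ\boldsymbol{\alpha}=\mathrm{id}$; 4. $(a\otimes 1)\boldsymbol{\alpha}(b)\in A\otimes B$ for all $a\in A$ and $b\in B$. Moreover $(\Delta\otimes\mathrm{id})\circ\boldsymbol{\alpha}=(\mathrm{id}\otimes\boldsymbol{\alpha})\circ\boldsymbol{\alpha}$,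 so $\boldsymbol{\alpha}$ is a continuous action of $\mathbb{G}$ on $B$ (the quotient $\mathbb{G}/\mathbb{K}$). -/

import Mathlib

open scoped ENNReal TensorProduct MultiplierAlgebra ComplexOrder

universe u v w

namespace PodlesQuotient

noncomputable section

/-! ### The spatial (minimal) tensor product of C*-algebras -/

section HilbertTensor

variable (H K : Type*) [NormedAddCommGroup H] [InnerProductSpace ℂ H]
  [NormedAddCommGroup K] [InnerProductSpace ℂ K]

/-- The Hilbert space tensor product of `H` and `K`. -/
abbrev HilbertTensor : Type _ := UniformSpace.Completion (H ⊗[ℂ] K)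

variable {H K}

/-- The bounded operator `S ⊗ T` on the Hilbert space tensor product,
determined by `(S ⊗ T)(ξ ⊗ η) = Sξ ⊗ Tη`. -/
def opTensor (S : H →L[ℂ] H) (T : K →L[ℂ] K) : HilbertTensor H K →L[ℂ] HilbertTensor H K :=
  (TensorProduct.mapL S T).completion

theorem norm_opTensor_le (S : H →L[ℂ] H) (T : K →L[ℂ] K) : ‖opTensor S T‖ ≤ ‖S‖ * ‖T‖ := by
  refine ContinuousLinearMap.opNorm_le_bound _ (by positivity) fun x => ?_
  induction x using UniformSpace.Completion.induction_on with
  | hp => exact isClosed_le (by fun_prop) (by fun_prop)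
  | ih x =>
    have h1 : opTensor S T (x : HilbertTensor H K) =
        ((TensorProduct.mapL S T x : H ⊗[ℂ] K) : HilbertTensor H K) := by
      simp [opTensor]
    rw [h1, UniformSpace.Completion.norm_coe, UniformSpace.Completion.norm_coe]
    exact (ContinuousLinearMap.le_opNorm _ _).trans
      (mul_le_mul_of_nonneg_right (TensorProduct.norm_mapL_le S T) (norm_nonneg _))

end HilbertTensor

section GNS

attribute [local instance] CStarAlgebra.spectralOrder CStarAlgebra.spectralOrderedRing

variable (A : Type u) [NonUnitalCStarAlgebra A]

/-- Positive linear functionals on the C*-algebra `A`, for the canonical order of `A`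
(whose positive cone is `{a⋆ a}`). They are automatically bounded. -/
abbrev PosFunctional : Type u := A →ₚ[ℂ] ℂ

variable {A}

/-- The Hilbert space of the GNS representation of a positive functional. -/
abbrev GNSSpace (f : PosFunctional A) : Type u := PositiveLinearMap.GNS f

/-- The GNS representation of a positive functional. -/
def gnsRep (f : PosFunctional A) : A →⋆ₙₐ[ℂ] (GNSSpace f →L[ℂ] GNSSpace f) :=
  PositiveLinearMap.gnsNonUnitalStarAlgHom f

end GNS

section MinTensor

variable (A : Type u) (B : Type v) [NonUnitalCStarAlgebra A] [NonUnitalCStarAlgebra B]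

/-- The C*-algebra of bounded families of operators on the Hilbert spaces `H_f ⊗ H_g`, where
`f` and `g` run over the positive functionals of `A` and `B`. -/
def OpFamily : Type (max u v) :=
  lp (fun p : PosFunctional A × PosFunctional B =>
    HilbertTensor (GNSSpace p.1) (GNSSpace p.2) →L[ℂ]
      HilbertTensor (GNSSpace p.1) (GNSSpace p.2)) ∞

instance (p : PosFunctional A × PosFunctional B) :
    NonUnitalCStarAlgebra (HilbertTensor (GNSSpace p.1) (GNSSpace p.2) →L[ℂ]
      HilbertTensor (GNSSpace p.1) (GNSSpace p.2)) := inferInstance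

instance : NonUnitalCStarAlgebra (OpFamily A B) :=
  inferInstanceAs (NonUnitalCStarAlgebra (lp (fun p : PosFunctional A × PosFunctional B =>
    HilbertTensor (GNSSpace p.1) (GNSSpace p.2) →L[ℂ]
      HilbertTensor (GNSSpace p.1) (GNSSpace p.2)) ∞))

variable {A B}

theorem memℓp_pureFamily (a : A) (b : B) :
    Memℓp (fun p : PosFunctional A × PosFunctional B =>
      opTensor (gnsRep p.1 a) (gnsRep p.2 b)) ∞ := by
  refine memℓp_infty ⟨‖a‖ * ‖b‖, ?_⟩
  rintro _ ⟨p, rfl⟩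
  exact (norm_opTensor_le _ _).trans (mul_le_mul
    (NonUnitalStarAlgHom.norm_apply_le (gnsRep p.1) a)
    (NonUnitalStarAlgHom.norm_apply_le (gnsRep p.2) b) (norm_nonneg _) (norm_nonneg _))

/-- The family `(π_f(a) ⊗ π_g(b))_{f, g}`, where `π_f`, `π_g` are the GNS representations. -/
def pureFamily (a : A) (b : B) : OpFamily A B :=
  Subtype.mk (fun p => opTensor (gnsRep p.1 a) (gnsRep p.2 b)) (memℓp_pureFamily a b)

variable (A B)

/-- The C*-algebra generated by the families `(π_f(a) ⊗ π_g(b))_{f, g}`. -/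
def minTensorSubalgebra : NonUnitalStarSubalgebra ℂ (OpFamily A B) :=
  (NonUnitalStarAlgebra.adjoin ℂ
    (Set.range fun p : A × B => pureFamily p.1 p.2)).topologicalClosure

instance : IsClosed (minTensorSubalgebra A B : Set (OpFamily A B)) :=
  NonUnitalStarSubalgebra.isClosed_topologicalClosure _

/-- The spatial (minimal) tensor product of the C*-algebras `A` and `B`: the completion of
the algebraic tensor product in the norm
`‖x‖ = sup {‖(π_f ⊗ π_g)(x)‖ : f, g positive functionals on A, B}`. -/
def MinTensor : Type (max u v) := minTensorSubalgebra A B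

instance : NonUnitalCStarAlgebra (MinTensor A B) :=
  inferInstanceAs (NonUnitalCStarAlgebra (minTensorSubalgebra A B))

variable {A B}

/-- The simple tensor `a ⊗ b`. -/
def tmul (a : A) (b : B) : MinTensor A B :=
  ⟨pureFamily a b, NonUnitalStarSubalgebra.le_topologicalClosure _
    (NonUnitalStarAlgebra.subset_adjoin ℂ _ ⟨(a, b), rfl⟩)⟩

end MinTensor

infixl:70 " ⊗ₘ " => MinTensor

/-! ### Multiplier algebras and morphisms -/

section Morphisms

variable {A : Type*} {B : Type*} {D : Type*} {E : Type*}
  [NonUnitalCStarAlgebra A] [NonUnitalCStarAlgebra B]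
  [NonUnitalCStarAlgebra D] [NonUnitalCStarAlgebra E]

/-- The canonical embedding of `A` as an essential ideal of its multiplier algebra. -/
def emb (A : Type*) [NonUnitalCStarAlgebra A] : A →⋆ₙₐ[ℂ] 𝓜(ℂ, A) := DoubleCentralizer.coeHom

/-- A *-homomorphism `φ : A → M(D)` is nondegenerate if the linear span of `φ(A)D` is dense
in `D`. -/
def Nondegenerate (φ : A →⋆ₙₐ[ℂ] 𝓜(ℂ, D)) : Prop :=
  Dense (Submodule.span ℂ {y : D | ∃ (a : A) (d : D), y = (φ a).fst d} : Set D)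

/-- `Mor A D`: the morphisms from `A` to `D`, i.e. the nondegenerate *-homomorphisms from `A`
to the multiplier algebra of `D`. -/
structure Mor (A : Type*) (D : Type*) [NonUnitalCStarAlgebra A] [NonUnitalCStarAlgebra D] where
  /-- The underlying *-homomorphism. -/
  hom : A →⋆ₙₐ[ℂ] 𝓜(ℂ, D)
  nondegenerate : Nondegenerate hom

open Classical in
/-- The unique `x` with property `P`. It is only used where there is exactly one such `x`. -/
def the {X : Type*} [Zero X] (P : X → Prop) : X :=
  if h : ∃! x, P x then h.choose else 0

theorem the_spec {X : Type*} [Zero X] {P : X → Prop} (h : ∃! x, P x) : P (the P) := by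
  rw [the, dif_pos h]
  exact h.choose_spec.1

/-- For multipliers `m ∈ M(A)` and `n ∈ M(B)`, the multiplier `m ⊗ n ∈ M(A ⊗ B)` given by
`(m ⊗ n)(a ⊗ b) = ma ⊗ nb` and `(a ⊗ b)(m ⊗ n) = am ⊗ bn`. -/
def mulTensor (m : 𝓜(ℂ, A)) (n : 𝓜(ℂ, B)) : 𝓜(ℂ, A ⊗ₘ B) :=
  the fun T => ∀ (a : A) (b : B),
    T.fst (tmul a b) = tmul (m.fst a) (n.fst b) ∧ T.snd (tmul a b) = tmul (m.snd a) (n.snd b)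

/-- The (strictly continuous) extension of a nondegenerate *-homomorphism `φ : A → M(D)` to
`M(A)`: the unique *-homomorphism `M(A) → M(D)` whose restriction to `A` is `φ`. -/
def mulExt (φ : A →⋆ₙₐ[ℂ] 𝓜(ℂ, D)) : 𝓜(ℂ, A) →⋆ₙₐ[ℂ] 𝓜(ℂ, D) :=
  the fun Φ => ∀ a : A, Φ (emb A a) = φ a

/-- The tensor product of *-homomorphisms `φ : A → M(D)` and `ψ : B → M(E)`: the unique
*-homomorphism `φ ⊗ ψ : A ⊗ B → M(D ⊗ E)` with `(φ ⊗ ψ)(a ⊗ b) = φ(a) ⊗ ψ(b)`. -/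
def homTensor (φ : A →⋆ₙₐ[ℂ] 𝓜(ℂ, D)) (ψ : B →⋆ₙₐ[ℂ] 𝓜(ℂ, E)) :
    A ⊗ₘ B →⋆ₙₐ[ℂ] 𝓜(ℂ, D ⊗ₘ E) :=
  the fun Φ => ∀ (a : A) (b : B), Φ (tmul a b) = mulTensor (φ a) (ψ b)

/-- The extension `M(A ⊗ B) → M(D ⊗ E)` of `φ ⊗ ψ`. -/
def extTensor (φ : A →⋆ₙₐ[ℂ] 𝓜(ℂ, D)) (ψ : B →⋆ₙₐ[ℂ] 𝓜(ℂ, E)) :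
    𝓜(ℂ, A ⊗ₘ B) →⋆ₙₐ[ℂ] 𝓜(ℂ, D ⊗ₘ E) :=
  mulExt (homTensor φ ψ)

/-- The canonical isomorphism `(A ⊗ B) ⊗ D → A ⊗ (B ⊗ D)`. -/
def assoc (A B D : Type*) [NonUnitalCStarAlgebra A] [NonUnitalCStarAlgebra B]
    [NonUnitalCStarAlgebra D] : (A ⊗ₘ B) ⊗ₘ D →⋆ₙₐ[ℂ] A ⊗ₘ (B ⊗ₘ D) :=
  the fun Φ => ∀ (a : A) (b : B) (d : D), Φ (tmul (tmul a b) d) = tmul a (tmul b d)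

/-- The canonical isomorphism `M((A ⊗ B) ⊗ D) → M(A ⊗ (B ⊗ D))`. -/
def extAssoc (A B D : Type*) [NonUnitalCStarAlgebra A] [NonUnitalCStarAlgebra B]
    [NonUnitalCStarAlgebra D] : 𝓜(ℂ, (A ⊗ₘ B) ⊗ₘ D) →⋆ₙₐ[ℂ] 𝓜(ℂ, A ⊗ₘ (B ⊗ₘ D)) :=
  mulExt ((emb (A ⊗ₘ (B ⊗ₘ D))).comp (assoc A B D))

end Morphisms

/-! ### Quantum groups and their actions -/

section QuantumGroups

variable {A : Type u} [NonUnitalCStarAlgebra A]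

/-- `(A, Δ)` is a bisimplifiable Hopf C*-algebra: `Δ ∈ Mor(A, A ⊗ A)` is coassociative, and the
closed linear spans of `Δ(A)(1 ⊗ A)` and of `(A ⊗ 1)Δ(A)` in `M(A ⊗ A)` are both equal to
`A ⊗ A`. -/
structure IsBisimplifiableHopf (Δ : Mor A (A ⊗ₘ A)) : Prop where
  coassoc : ∀ a : A,
    extAssoc A A A (extTensor Δ.hom (emb A) (Δ.hom a)) = extTensor (emb A) Δ.hom (Δ.hom a)
  closure_right : closure (Submodule.span ℂ {T : 𝓜(ℂ, A ⊗ₘ A) |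
    ∃ a a' : A, T = Δ.hom a * mulTensor 1 (emb A a')} : Set 𝓜(ℂ, A ⊗ₘ A)) =
      Set.range (emb (A ⊗ₘ A))
  closure_left : closure (Submodule.span ℂ {T : 𝓜(ℂ, A ⊗ₘ A) |
    ∃ a a' : A, T = mulTensor (emb A a) 1 * Δ.hom a'} : Set 𝓜(ℂ, A ⊗ₘ A)) =
      Set.range (emb (A ⊗ₘ A))

/-- `ε ∈ Mor(A, ℂ)` is a (continuous) counit of `(A, Δ)`: `(ε ⊗ id)Δ = id = (id ⊗ ε)Δ`, where
`A` is identified with `ℂ ⊗ A` by `a ↦ 1 ⊗ a` and with `A ⊗ ℂ` by `a ↦ a ⊗ 1`. -/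
structure IsCounit (Δ : Mor A (A ⊗ₘ A)) (ε : Mor A ℂ) : Prop where
  left : ∀ a : A, extTensor ε.hom (emb A) (Δ.hom a) = mulTensor 1 (emb A a)
  right : ∀ a : A, extTensor (emb A) ε.hom (Δ.hom a) = mulTensor (emb A a) 1

/-- `(C, Δ)` is a compact quantum group: a unital C*-algebra `C` with a coassociative
comultiplication such that `Δ(C)(1 ⊗ C)` and `(C ⊗ 1)Δ(C)` have dense linear span in `C ⊗ C`.
(As `C` is unital, `M(C ⊗ C) = C ⊗ C`, and the elements of `Mor(C, C ⊗ C)` are the unital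
*-homomorphisms `C → C ⊗ C`.) -/
def IsCompactQuantumGroup {C : Type v} [CStarAlgebra C] (Δ : Mor C (C ⊗ₘ C)) : Prop :=
  IsBisimplifiableHopf Δ

/-- `α ∈ Mor(B, A ⊗ B)` is a continuous action of the quantum group `(A, Δ)` with continuous
counit `ε` on the C*-algebra `B`. -/
structure IsContinuousAction (Δ : Mor A (A ⊗ₘ A)) (ε : Mor A ℂ) {B : Type v}
    [NonUnitalCStarAlgebra B] (α : Mor B (A ⊗ₘ B)) : Prop where
  coaction : ∀ b : B,
    extAssoc A A B (extTensor Δ.hom (emb B) (α.hom b)) = extTensor (emb A) α.hom (α.hom b)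
  mul_mem : ∀ (a : A) (b : B), mulTensor (emb A a) 1 * α.hom b ∈ Set.range (emb (A ⊗ₘ B))
  counit : ∀ b : B, extTensor ε.hom (emb B) (α.hom b) = mulTensor 1 (emb B b)

end QuantumGroups

end

end PodlesQuotient

/-! The engine is averaging over the quantum subgroup. Put `δ = (id ⊗ π)Δ`. It takes values in `A ⊗
C` and is a right coaction: `(δ ⊗ id)δ = (id ⊗ Δ_C)δ`. If `h` is a state of `C` with `(id ⊗ h)Δ_C =
h(·)1`, then `E = (id ⊗ h)δ` is a bounded idempotent of `A` with range `B`. Coassociativity gives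
`(id ⊗ E)((x ⊗ 1)Δ(a)) = (x ⊗ 1)Δ(E a)`, and `id ⊗ E` maps `A ⊗ A` into `A ⊗ B` and fixes `A ⊗ B`.

Everything follows from this. Applying `id ⊗ E` to the density of `(A ⊗ 1)Δ(A)` in `A ⊗ A` shows
that `(A ⊗ 1)Δ(B)` lies in `A ⊗ B` and spans a dense subspace (`exists_left`, `induction_left`).
Multiplying by `1 ⊗ B` puts `(A ⊗ B)Δ(B)` inside `A ⊗ B`, so `Δ` restricts to `B → M(A ⊗ B)`;
density gives nondegeneracy. The algebra `B` is nondegenerate in `A` because `δ(u)(a ⊗ 1) → a ⊗ 1`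
along an approximate unit, whence `E(u)a → a`. The coaction and counit identities are inherited from
`Δ`, since `M(A ⊗ B) → M(A ⊗ A)` and its analogues are injective.

The state `h` comes from Cesàro limits of convolution powers, a domination argument and weak-*
compactness (`exists_haar`). The tensor calculus rests on three facts: the universal representation
is isometric, vector functionals have bounded slice maps, and these slices separate points. They
yield every required *-homomorphism through `exists_hom_of_dense`. -/

namespace PodlesQuotient

noncomputable section

/-! ### States on unital C*-algebras. -/

section States

attribute [local instance] CStarAlgebra.spectralOrder CStarAlgebra.spectralOrderedRing

/-- The positive functional with underlying linear map `f`, where `f (a⋆ a) ≥ 0` for all `a`. -/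
def posOfStar {A : Type*} [NonUnitalCStarAlgebra A] (f : A →L[ℂ] ℂ)
    (hf : ∀ a, 0 ≤ f (star a * a)) : PosFunctional A :=
  PositiveLinearMap.mk₀ (f : A →ₗ[ℂ] ℂ) fun x hx => by
    obtain ⟨b, rfl⟩ := CStarAlgebra.nonneg_iff_eq_star_mul_self.1 hx
    exact hf b

@[simp]
theorem posOfStar_apply {A : Type*} [NonUnitalCStarAlgebra A] (f : A →L[ℂ] ℂ)
    (hf : ∀ a, 0 ≤ f (star a * a)) (a : A) : posOfStar f hf a = f a := rfl

theorem posFunctional_star_mul_self {A : Type*} [NonUnitalCStarAlgebra A] (f : PosFunctional A)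
    (a : A) : 0 ≤ f (star a * a) := f.map_nonneg (star_mul_self_nonneg a)

variable {N : Type*} [CStarAlgebra N]

/-- From `p + ‖p‖ ≤ ‖p + ‖p‖‖` one gets `p ≤ ‖p + ‖p‖‖ - ‖p‖`, and the norm of a positive element is
its least scalar upper bound. The equality forces a functional norming `p + ‖p‖` to norm both `p`
and `1`. -/
theorem norm_add_algebraMap_norm {p : N} (hp : 0 ≤ p) (hp0 : p ≠ 0) :
    ‖p + algebraMap ℝ N ‖p‖‖ = 2 * ‖p‖ := by
  have : Nontrivial N := ⟨p, 0, hp0⟩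
  refine le_antisymm ((norm_add_le _ _).trans ?_) ?_
  · simp [two_mul]
  · have h0 : 0 ≤ algebraMap ℝ N ‖p‖ := by
      rw [Algebra.algebraMap_eq_smul_one]; exact smul_nonneg (norm_nonneg _) zero_le_one
    have h1 : 0 ≤ p + algebraMap ℝ N ‖p‖ := add_nonneg hp h0
    have h2 := (CStarAlgebra.norm_le_iff_le_algebraMap _ (norm_nonneg _) h1).1 le_rfl
    have h3 : ‖p‖ ≤ ‖p + algebraMap ℝ N ‖p‖‖ := by
      have := CStarAlgebra.norm_le_norm_of_nonneg_of_le hp (le_add_of_nonneg_right h0 : p ≤ p + _)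
      exact this
    have h4 : p ≤ algebraMap ℝ N (‖p + algebraMap ℝ N ‖p‖‖ - ‖p‖) := by
      rw [map_sub]; exact le_sub_iff_add_le.2 h2
    have := (CStarAlgebra.norm_le_iff_le_algebraMap _ (sub_nonneg.2 h3) hp).2 h4
    linarith

/-- Comparing `|s(a + it)|²` with `‖a + it‖² ≤ ‖a‖² + t²` for real `t`, the `t²` terms cancel and a
term linear in `t` stays bounded above, so its coefficient `2 Im s(a)` vanishes. -/
theorem im_apply_eq_zero_of_isSelfAdjoint {s : N →L[ℂ] ℂ} (hs : ‖s‖ ≤ 1) (h1 : s 1 = 1) {a : N}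
    (ha : IsSelfAdjoint a) : (s a).im = 0 := by
  have key : ∀ t : ℝ, (s a).re ^ 2 + ((s a).im + t) ^ 2 ≤ ‖a‖ ^ 2 + t ^ 2 := by
    intro t
    have e1 : s (a + (t * Complex.I) • (1 : N)) = s a + t * Complex.I := by simp [h1]
    have e2 : ‖s (a + (t * Complex.I) • (1 : N))‖ ^ 2 ≤ ‖a + (t * Complex.I) • (1 : N)‖ ^ 2 := by
      gcongr
      exact (s.le_opNorm _).trans (mul_le_of_le_one_left (norm_nonneg _) hs)
    have e3 : ‖a + (t * Complex.I) • (1 : N)‖ ^ 2 ≤ ‖a‖ ^ 2 + t ^ 2 := by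
      have hN : Nontrivial N := by
        by_contra h
        rw [not_nontrivial_iff_subsingleton] at h
        rw [Subsingleton.elim (1 : N) 0, map_zero] at h1
        exact zero_ne_one h1
      have e4 : star (a + (t * Complex.I) • (1 : N)) * (a + (t * Complex.I) • (1 : N)) =
          a * a + ((t : ℂ) ^ 2) • (1 : N) := by
        simp only [star_add, ha.star_eq, star_smul, star_one, add_mul, mul_add, smul_mul_assoc,
          mul_smul_comm, one_mul, mul_one]
        have : star (t * Complex.I : ℂ) = -(t * Complex.I) := by simp
        rw [this]
        match_scalars
        · simp
        · ring
        · linear_combination (-(t : ℂ) ^ 2) * Complex.I_sq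
      rw [pow_two, ← CStarRing.norm_star_mul_self, e4]
      refine (norm_add_le _ _).trans (add_le_add ?_ ?_)
      · rw [pow_two]; exact norm_mul_le _ _
      · rw [norm_smul, norm_one, mul_one, norm_pow, Complex.norm_real]; simp
    have e5 : ‖s a + t * Complex.I‖ ^ 2 = (s a).re ^ 2 + ((s a).im + t) ^ 2 := by
      rw [← Complex.normSq_eq_norm_sq, Complex.normSq_apply]; simp; ring
    rw [← e5, ← e1]
    exact e2.trans e3
  by_contra h
  -- This `t` makes the cross term equal to `2‖a‖²`, which already exceeds what the bound allows.
  have := key (‖a‖ ^ 2 / (s a).im)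
  have h2 : ‖a‖ ^ 2 / (s a).im * (s a).im = ‖a‖ ^ 2 := div_mul_cancel₀ _ h
  have h3 : 0 < (s a).im ^ 2 := by positivity
  nlinarith [sq_nonneg (s a).re, sq_nonneg ‖a‖]

/-- The element `‖a‖ - a` has norm at most `‖a‖`, so the real number `s a` lies within `‖a‖` of
`‖a‖`. -/
theorem nonneg_apply_of_norm_le_one {s : N →L[ℂ] ℂ} (hs : ‖s‖ ≤ 1) (h1 : s 1 = 1) {a : N}
    (ha : 0 ≤ a) : 0 ≤ s a := by
  have him := im_apply_eq_zero_of_isSelfAdjoint hs h1 (IsSelfAdjoint.of_nonneg ha)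
  rw [Complex.nonneg_iff]
  refine ⟨?_, him.symm⟩
  have hle : a ≤ algebraMap ℝ N ‖a‖ := IsSelfAdjoint.le_algebraMap_norm_self (.of_nonneg ha)
  have hn : ‖algebraMap ℝ N ‖a‖ - a‖ ≤ ‖a‖ :=
    (CStarAlgebra.norm_le_iff_le_algebraMap _ (norm_nonneg _) (sub_nonneg.2 hle)).2
      (sub_le_self _ ha)
  have e1 : s (algebraMap ℝ N ‖a‖ - a) = ‖a‖ - s a := by
    rw [map_sub, Algebra.algebraMap_eq_smul_one, ← Complex.coe_smul, map_smul, h1]; simp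
  have e2 : ‖(‖a‖ : ℂ) - s a‖ ≤ ‖a‖ := by
    rw [← e1]
    exact (s.le_opNorm _).trans ((mul_le_of_le_one_left (norm_nonneg _) hs).trans hn)
  have := (Complex.re_le_norm _).trans e2
  simp at this
  linarith

theorem exists_state_apply_eq_norm {p : N} (hp : 0 ≤ p) (hp0 : p ≠ 0) :
    ∃ s : N →L[ℂ] ℂ, (∀ a, 0 ≤ s (star a * a)) ∧ s 1 = 1 ∧ s p = ‖p‖ := by
  have : Nontrivial N := ⟨p, 0, hp0⟩
  have hn := norm_add_algebraMap_norm hp hp0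
  have hpos : 0 < ‖p‖ := norm_pos_iff.2 hp0
  -- Hahn–Banach is applied at `p + ‖p‖` rather than at `p`: the sum `s p + ‖p‖ s 1` reaches `2‖p‖`
  -- only if both summands are extremal, which yields `s 1 = 1` as well.
  obtain ⟨s, hs, hsp⟩ := exists_dual_vector ℂ (p + algebraMap ℝ N ‖p‖) (by rw [hn]; positivity)
  rw [hn, map_add, Algebra.algebraMap_eq_smul_one, ← Complex.coe_smul, map_smul] at hsp
  have b1 : ‖s p‖ ≤ ‖p‖ := by simpa [hs] using s.le_opNorm p
  have b2 : ‖s 1‖ ≤ 1 := by simpa [hs] using s.le_opNorm 1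
  have r1 := (Complex.re_le_norm _).trans b1
  have r2 := (Complex.re_le_norm _).trans b2
  have hre : (s p).re + ‖p‖ * (s 1).re = 2 * ‖p‖ := by
    simpa using congrArg Complex.re hsp
  have q1 : (s 1).re = 1 := by nlinarith
  have q3 : s 1 = 1 := by
    have : (s 1).re ^ 2 + (s 1).im ^ 2 ≤ 1 := by
      have := Complex.normSq_eq_norm_sq (s 1)
      rw [Complex.normSq_apply] at this
      nlinarith [norm_nonneg (s 1)]
    have h0 : (s 1).im = 0 := by
      rw [q1] at this; nlinarith [sq_nonneg (s 1).im]
    apply Complex.ext <;> simp [q1, h0]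
  refine ⟨s, fun a => nonneg_apply_of_norm_le_one hs.le q3 (star_mul_self_nonneg a), q3, ?_⟩
  rw [q3] at hsp
  simp only [smul_eq_mul, mul_one] at hsp
  push_cast at hsp
  linear_combination hsp

end States

/-! ### Elementary calculus of multipliers. -/

section MultiplierBasics

variable {X : Type*} [NonUnitalCStarAlgebra X]

theorem emb_fst (x y : X) : (emb X x).fst y = x * y := rfl

theorem eq_of_forall_mul_left {x y : X} (h : ∀ z, z * x = z * y) : x = y := by
  rw [← sub_eq_zero, ← CStarRing.star_mul_self_eq_zero_iff, mul_sub, h, sub_self]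

theorem eq_of_forall_mul_right {x y : X} (h : ∀ z, x * z = y * z) : x = y := by
  rw [← sub_eq_zero, ← CStarRing.mul_star_self_eq_zero_iff, sub_mul, h, sub_self]

/-- Centrality determines the right component from the left one, because only `0` annihilates the
whole algebra. -/
theorem multiplier_ext {S T : 𝓜(ℂ, X)} (h : ∀ x, S.fst x = T.fst x) : S = T := by
  refine DoubleCentralizer.ext _ _ _ _ (Prod.ext (ContinuousLinearMap.ext h)
    (ContinuousLinearMap.ext fun x => ?_))
  refine eq_of_forall_mul_right fun z => ?_
  exact (S.central x z).trans ((congrArg _ (h z)).trans (T.central x z).symm)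

theorem emb_injective : Function.Injective (emb X) := by
  intro x y h
  exact eq_of_forall_mul_right fun z => by rw [← emb_fst, h, emb_fst]

theorem norm_emb (x : X) : ‖emb X x‖ = ‖x‖ := NonUnitalStarAlgHom.norm_map _ emb_injective x

theorem mul_emb (T : 𝓜(ℂ, X)) (x : X) : T * emb X x = emb X (T.fst x) := by
  refine multiplier_ext fun y => ?_
  rw [DoubleCentralizer.mul_fst]
  change T.fst (x * y) = T.fst x * y
  refine eq_of_forall_mul_left fun z => ?_
  rw [← T.central, ← mul_assoc, ← mul_assoc, T.central]

theorem emb_mul (T : 𝓜(ℂ, X)) (x : X) : emb X x * T = emb X (T.snd x) := by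
  refine multiplier_ext fun y => ?_
  rw [DoubleCentralizer.mul_fst]
  exact (T.central x y).symm

theorem fst_mul (T : 𝓜(ℂ, X)) (x y : X) : T.fst (x * y) = T.fst x * y :=
  emb_injective (by
    rw [← mul_emb, map_mul, map_mul, ← mul_emb, mul_assoc])

theorem mul_fst_apply (S T : 𝓜(ℂ, X)) (x : X) : (S * T).fst x = S.fst (T.fst x) := rfl

end MultiplierBasics

/-! ### GNS vectors and the universal representation. -/

section NormBound

attribute [local instance] CStarAlgebra.spectralOrder CStarAlgebra.spectralOrderedRing

variable {A : Type*} [NonUnitalCStarAlgebra A]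

/-- The canonical linear map from `A` to the GNS space of `f`. -/
def gnsVec (f : PosFunctional A) : A →ₗ[ℂ] GNSSpace f :=
  (UniformSpace.Completion.toComplL : f.PreGNS →L[ℂ] GNSSpace f).toLinearMap ∘ₗ
    f.toPreGNS.toLinearMap

theorem gnsVec_denseRange (f : PosFunctional A) : DenseRange (gnsVec f) :=
  UniformSpace.Completion.denseRange_coe (α := f.PreGNS)

theorem gnsRep_gnsVec (f : PosFunctional A) (a b : A) :
    gnsRep f a (gnsVec f b) = gnsVec f (a * b) := by
  change f.gnsNonUnitalStarAlgHom a ((f.toPreGNS b : f.PreGNS) : GNSSpace f) = _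
  rw [PositiveLinearMap.gnsNonUnitalStarAlgHom_apply_coe]
  rfl

theorem inner_gnsVec (f : PosFunctional A) (a b : A) :
    inner ℂ (gnsVec f a) (gnsVec f b) = f (star a * b) :=
  UniformSpace.Completion.inner_coe (E := f.PreGNS) (f.toPreGNS a) (f.toPreGNS b)

theorem norm_gnsVec_sq (f : PosFunctional A) (a : A) :
    ((‖gnsVec f a‖ ^ 2 : ℝ) : ℂ) = f (star a * a) := by
  rw [← inner_gnsVec, inner_self_eq_norm_sq_to_K]; simp

theorem norm_apply_sq_le (f : PosFunctional A) (a b : A) :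
    ‖f (star a * b)‖ ^ 2 ≤ (f (star a * a)).re * (f (star b * b)).re := by
  rw [← norm_gnsVec_sq, ← norm_gnsVec_sq, ← inner_gnsVec, Complex.ofReal_re, Complex.ofReal_re,
    ← mul_pow]
  gcongr
  exact norm_inner_le_norm _ _

/-- The universal representation is isometric. -/
theorem norm_le_of_forall_gnsRep {x : A} {M : ℝ} (hM : ∀ g : PosFunctional A, ‖gnsRep g x‖ ≤ M) :
    ‖x‖ ≤ M := by
  by_cases hx : x = 0
  · rw [hx, norm_zero]; exact (norm_nonneg _).trans (hM 0)
  -- The state norming `x x⋆` is taken on the multiplier algebra, which has a unit. In the GNS space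
  -- of its restriction, the vector of `x⋆` has norm `‖x‖`, and `x` sends it to a vector of squared
  -- norm `s(p⋆p) ≥ s(p)² = ‖x‖⁴`; hence `‖π(x)‖ ≥ ‖x‖`.
  set p : 𝓜(ℂ, A) := emb A x * star (emb A x) with hp
  have hpos : 0 ≤ p := mul_star_self_nonneg _
  have hnorm : ‖p‖ = ‖x‖ * ‖x‖ := by rw [hp, CStarRing.norm_self_mul_star, norm_emb]
  have hxpos : 0 < ‖x‖ := norm_pos_iff.2 hx
  have hp0 : p ≠ 0 := norm_pos_iff.1 (by rw [hnorm]; positivity)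
  obtain ⟨s, hs, h1, hsp⟩ := exists_state_apply_eq_norm hpos hp0
  let s' := posOfStar s hs
  let ι : A →L[ℂ] 𝓜(ℂ, A) := ⟨(emb A : A →ₗ[ℂ] 𝓜(ℂ, A)),
    (NonUnitalStarAlgHom.isometry (emb A) emb_injective).continuous⟩
  have hι : ∀ a, ι a = emb A a := fun _ => rfl
  let g : PosFunctional A := posOfStar (s.comp ι) fun a => by
    simpa [hι, map_mul, map_star] using hs (emb A a)
  have hg : ∀ a, g a = s (emb A a) := fun _ => rfl
  have e1 : ‖gnsVec g (star x)‖ ^ 2 = ‖x‖ ^ 2 := by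
    have := norm_gnsVec_sq g (star x)
    rw [hg, star_star, map_mul, map_star (emb A), ← hp, hsp, hnorm] at this
    rw [pow_two ‖x‖]
    exact_mod_cast this
  have e2 : ‖gnsRep g x (gnsVec g (star x))‖ ^ 2 = (s (star p * p)).re := by
    have := norm_gnsVec_sq g (x * star x)
    rw [gnsRep_gnsVec, ← Complex.ofReal_re (‖gnsVec g (x * star x)‖ ^ 2), this, hg]
    simp [hp, map_mul, map_star, mul_assoc]
  have e3 : (‖x‖ ^ 2) ^ 2 ≤ (s (star p * p)).re := by
    have := norm_apply_sq_le s' 1 p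
    simp only [s', posOfStar_apply, star_one, one_mul, h1, hsp, hnorm, Complex.one_re] at this
    rw [Complex.norm_real, Real.norm_eq_abs, sq_abs] at this
    rwa [pow_two ‖x‖]
  have e4 := (gnsRep g x).le_opNorm (gnsVec g (star x))
  have e5 : ‖gnsVec g (star x)‖ = ‖x‖ := by
    rwa [sq_eq_sq₀ (norm_nonneg _) (norm_nonneg _)] at e1
  rw [← e2, sq_le_sq₀ (by positivity) (by positivity)] at e3
  rw [e5] at e4
  have : ‖x‖ * ‖x‖ ≤ ‖gnsRep g x‖ * ‖x‖ := by rw [← pow_two]; exact e3.trans e4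
  exact (le_of_mul_le_mul_right this hxpos).trans (hM g)

end NormBound

/-! ### Operators on Hilbert space tensor products. -/

section HilbertTensorVectors

variable {H K : Type*} [NormedAddCommGroup H] [InnerProductSpace ℂ H]
  [NormedAddCommGroup K] [InnerProductSpace ℂ K]

/-- The vector `x ⊗ y` of the Hilbert space tensor product, as a continuous bilinear map. -/
def hvec : H →L[ℂ] K →L[ℂ] HilbertTensor H K :=
  (ContinuousLinearMap.compL ℂ K (H ⊗[ℂ] K) (HilbertTensor H K)
    UniformSpace.Completion.toComplL).comp (TensorProduct.mkL ℂ H K)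

theorem hvec_eq (x : H) (y : K) : hvec x y = ((x ⊗ₜ[ℂ] y : H ⊗[ℂ] K) : HilbertTensor H K) := rfl

theorem norm_hvec (x : H) (y : K) : ‖hvec x y‖ = ‖x‖ * ‖y‖ := by
  rw [hvec_eq, UniformSpace.Completion.norm_coe, TensorProduct.norm_tmul]

theorem inner_hvec (x x' : H) (y y' : K) :
    inner ℂ (hvec x y) (hvec x' y') = inner ℂ x x' * inner ℂ y y' := by
  rw [hvec_eq, hvec_eq, UniformSpace.Completion.inner_coe, TensorProduct.inner_tmul]

theorem opTensor_hvec (S : H →L[ℂ] H) (T : K →L[ℂ] K) (x : H) (y : K) :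
    opTensor S T (hvec x y) = hvec (S x) (T y) := by
  rw [hvec_eq, hvec_eq, opTensor, ContinuousLinearMap.completion_apply_coe,
    TensorProduct.mapL_tmul]

theorem hvec_ext {E : Type*} [NormedAddCommGroup E] [NormedSpace ℂ E]
    {S T : HilbertTensor H K →L[ℂ] E} (h : ∀ x y, S (hvec x y) = T (hvec x y)) : S = T := by
  refine ContinuousLinearMap.ext fun z => ?_
  induction z using UniformSpace.Completion.induction_on with
  | hp => exact isClosed_eq S.continuous T.continuous
  | ih z =>
    induction z using TensorProduct.induction_on with
    | zero => rw [UniformSpace.Completion.coe_zero, map_zero, map_zero]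
    | tmul x y => exact h x y
    | add x y hx hy => rw [UniformSpace.Completion.coe_add, map_add, map_add, hx, hy]

theorem opTensor_add_left (S S' : H →L[ℂ] H) (T : K →L[ℂ] K) :
    opTensor (S + S') T = opTensor S T + opTensor S' T :=
  hvec_ext fun x y => by simp [opTensor_hvec]

theorem opTensor_add_right (S : H →L[ℂ] H) (T T' : K →L[ℂ] K) :
    opTensor S (T + T') = opTensor S T + opTensor S T' :=
  hvec_ext fun x y => by simp [opTensor_hvec]

theorem opTensor_smul_left (c : ℂ) (S : H →L[ℂ] H) (T : K →L[ℂ] K) :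
    opTensor (c • S) T = c • opTensor S T :=
  hvec_ext fun x y => by simp [opTensor_hvec]

theorem opTensor_smul_right (c : ℂ) (S : H →L[ℂ] H) (T : K →L[ℂ] K) :
    opTensor S (c • T) = c • opTensor S T :=
  hvec_ext fun x y => by simp [opTensor_hvec]

theorem opTensor_mul (S S' : H →L[ℂ] H) (T T' : K →L[ℂ] K) :
    opTensor (S * S') (T * T') = opTensor S T * opTensor S' T' :=
  hvec_ext fun x y => by simp [opTensor_hvec]

theorem opTensor_star [CompleteSpace H] [CompleteSpace K] (S : H →L[ℂ] H) (T : K →L[ℂ] K) :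
    opTensor (star S) (star T) = star (opTensor S T) := by
  refine hvec_ext fun x y => ?_
  refine ext_inner_right ℂ fun w => ?_
  have : (innerSL ℂ) (opTensor (star S) (star T) (hvec x y)) =
      (innerSL ℂ) (star (opTensor S T) (hvec x y)) := by
    refine hvec_ext fun x' y' => ?_
    simp only [innerSL_apply_apply, ContinuousLinearMap.star_eq_adjoint,
      ContinuousLinearMap.adjoint_inner_left, opTensor_hvec, inner_hvec]
  exact congrArg (fun φ => φ w) this

end HilbertTensorVectors

/-! ### Simple tensors and representations of the spatial tensor product. -/

section TensorBasics

attribute [local instance] CStarAlgebra.spectralOrder CStarAlgebra.spectralOrderedRing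

variable {A : Type*} {B : Type*} [NonUnitalCStarAlgebra A] [NonUnitalCStarAlgebra B]

/-- Evaluation of bounded families at an index. -/
def lpEval {I : Type*} (E : I → Type*) [∀ i, NonUnitalCStarAlgebra (E i)] (i : I) :
    lp E ∞ →⋆ₙₐ[ℂ] E i where
  toFun z := z i
  map_smul' _ _ := rfl
  map_zero' := rfl
  map_add' _ _ := rfl
  map_mul' _ _ := rfl
  map_star' _ := rfl

/-- Evaluation of a family of operators at a pair of functionals. -/
def opEval (p : PosFunctional A × PosFunctional B) : OpFamily A B →⋆ₙₐ[ℂ]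
    (HilbertTensor (GNSSpace p.1) (GNSSpace p.2) →L[ℂ]
      HilbertTensor (GNSSpace p.1) (GNSSpace p.2)) :=
  lpEval (fun p : PosFunctional A × PosFunctional B =>
    HilbertTensor (GNSSpace p.1) (GNSSpace p.2) →L[ℂ]
      HilbertTensor (GNSSpace p.1) (GNSSpace p.2)) p

variable (A B) in
/-- The inclusion of `A ⊗ B` into the bounded families of operators. -/
def minIncl : A ⊗ₘ B →⋆ₙₐ[ℂ] OpFamily A B :=
  NonUnitalStarSubalgebraClass.subtype (minTensorSubalgebra A B)

/-- The representation `π_f ⊗ π_g` of `A ⊗ B`, where `p = (f, g)`. -/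
def pairRep (p : PosFunctional A × PosFunctional B) :
    A ⊗ₘ B →⋆ₙₐ[ℂ] (HilbertTensor (GNSSpace p.1) (GNSSpace p.2) →L[ℂ]
      HilbertTensor (GNSSpace p.1) (GNSSpace p.2)) :=
  (opEval p).comp (minIncl A B)

theorem pairRep_tmul (p : PosFunctional A × PosFunctional B) (a : A) (b : B) :
    pairRep p (tmul a b) = opTensor (gnsRep p.1 a) (gnsRep p.2 b) := rfl

theorem pairRep_ext {z w : A ⊗ₘ B} (h : ∀ p, pairRep p z = pairRep p w) : z = w :=
  Subtype.ext (Subtype.ext (funext h))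

/-- Simple tensors as a bilinear map. -/
def tmulₗ (A B : Type*) [NonUnitalCStarAlgebra A] [NonUnitalCStarAlgebra B] :
    A →ₗ[ℂ] B →ₗ[ℂ] A ⊗ₘ B :=
  LinearMap.mk₂ ℂ tmul
    (fun a a' b => pairRep_ext fun p => by
      simp only [map_add, pairRep_tmul, opTensor_add_left])
    (fun c a b => pairRep_ext fun p => by
      simp only [map_smul, pairRep_tmul, opTensor_smul_left])
    (fun a b b' => pairRep_ext fun p => by
      simp only [map_add, pairRep_tmul, opTensor_add_right])
    (fun c a b => pairRep_ext fun p => by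
      simp only [map_smul, pairRep_tmul, opTensor_smul_right])

theorem tmul_mul_tmul (a a' : A) (b b' : B) :
    tmul a b * tmul a' b' = tmul (a * a') (b * b') :=
  pairRep_ext fun p => by
    simp only [map_mul, pairRep_tmul, opTensor_mul]

theorem star_tmul (a : A) (b : B) : star (tmul a b) = tmul (star a) (star b) :=
  pairRep_ext fun p => by
    simp only [map_star, pairRep_tmul, opTensor_star]

theorem tmul_add_left (a a' : A) (b : B) : tmul (a + a') b = tmul a b + tmul a' b :=
  (tmulₗ A B).map_add₂ a a' b

theorem tmul_smul_left (c : ℂ) (a : A) (b : B) : tmul (c • a) b = c • tmul a b :=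
  (tmulₗ A B).map_smul₂ c a b

theorem tmul_smul_right (c : ℂ) (a : A) (b : B) : tmul a (c • b) = c • tmul a b :=
  (tmulₗ A B a).map_smul c b

theorem tmul_zero_left (b : B) : tmul (0 : A) b = 0 := (tmulₗ A B).map_zero₂ b

theorem tmul_zero_right (a : A) : tmul a (0 : B) = 0 := (tmulₗ A B a).map_zero

theorem norm_tmul_le (a : A) (b : B) : ‖tmul a b‖ ≤ ‖a‖ * ‖b‖ := by
  refine lp.norm_le_of_forall_le (by positivity) fun p => ?_
  exact (norm_opTensor_le _ _).trans (mul_le_mul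
    (NonUnitalStarAlgHom.norm_apply_le (gnsRep p.1) a)
    (NonUnitalStarAlgHom.norm_apply_le (gnsRep p.2) b) (norm_nonneg _) (norm_nonneg _))

/-- Simple tensors as a continuous bilinear map. -/
def tmulL (A B : Type*) [NonUnitalCStarAlgebra A] [NonUnitalCStarAlgebra B] :
    A →L[ℂ] B →L[ℂ] A ⊗ₘ B :=
  (tmulₗ A B).mkContinuous₂ 1 fun a b => by rw [one_mul]; exact norm_tmul_le a b

variable (A B) in
/-- The linear span of the simple tensors. -/
def algTensor : Submodule ℂ (A ⊗ₘ B) := Submodule.span ℂ (Set.range fun p : A × B => tmul p.1 p.2)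

theorem tmul_mem_algTensor (a : A) (b : B) : tmul a b ∈ algTensor A B :=
  Submodule.subset_span ⟨(a, b), rfl⟩

theorem mul_mem_algTensor {z w : A ⊗ₘ B} (hz : z ∈ algTensor A B) (hw : w ∈ algTensor A B) :
    z * w ∈ algTensor A B := by
  induction hz using Submodule.span_induction with
  | mem x hx =>
    obtain ⟨p, rfl⟩ := hx
    induction hw using Submodule.span_induction with
    | mem y hy =>
      obtain ⟨q, rfl⟩ := hy
      simp only [tmul_mul_tmul]
      exact tmul_mem_algTensor _ _
    | zero => rw [mul_zero]; exact zero_mem _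
    | add x y _ _ hx hy => rw [mul_add]; exact add_mem hx hy
    | smul c x _ hx => rw [mul_smul_comm]; exact Submodule.smul_mem _ _ hx
  | zero => rw [zero_mul]; exact zero_mem _
  | add x y _ _ hx hy => rw [add_mul]; exact add_mem hx hy
  | smul c x _ hx => rw [smul_mul_assoc]; exact Submodule.smul_mem _ _ hx

theorem star_mem_algTensor {z : A ⊗ₘ B} (hz : z ∈ algTensor A B) : star z ∈ algTensor A B := by
  induction hz using Submodule.span_induction with
  | mem x hx =>
    obtain ⟨p, rfl⟩ := hx
    simp only [star_tmul]
    exact tmul_mem_algTensor _ _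
  | zero => rw [star_zero]; exact zero_mem _
  | add x y _ _ hx hy => rw [star_add]; exact add_mem hx hy
  | smul c x _ hx => rw [star_smul]; exact Submodule.smul_mem _ _ hx

variable (A B) in
theorem dense_algTensor : Dense (algTensor A B : Set (A ⊗ₘ B)) := by
  refine (Subtype.dense_iff (s := (minTensorSubalgebra A B : Set (OpFamily A B)))).2 ?_
  refine closure_mono fun x hx => ?_
  induction hx using NonUnitalStarAlgebra.adjoin_induction with
  | mem x hx =>
    obtain ⟨p, rfl⟩ := hx
    exact ⟨tmul p.1 p.2, tmul_mem_algTensor _ _, rfl⟩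
  | add x y _ _ hx hy =>
    obtain ⟨x, hx, rfl⟩ := hx
    obtain ⟨y, hy, rfl⟩ := hy
    exact ⟨_, add_mem hx hy, rfl⟩
  | zero => exact ⟨_, zero_mem _, rfl⟩
  | mul x y _ _ hx hy =>
    obtain ⟨x, hx, rfl⟩ := hx
    obtain ⟨y, hy, rfl⟩ := hy
    exact ⟨_, mul_mem_algTensor hx hy, rfl⟩
  | smul c x _ hx =>
    obtain ⟨x, hx, rfl⟩ := hx
    exact ⟨_, Submodule.smul_mem _ c hx, rfl⟩
  | star x _ hx =>
    obtain ⟨x, hx, rfl⟩ := hx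
    exact ⟨_, star_mem_algTensor hx, rfl⟩

/-- A closed subspace of `A ⊗ B` containing the simple tensors is everything. -/
theorem tensor_induction {S : Submodule ℂ (A ⊗ₘ B)} (hS : IsClosed (S : Set (A ⊗ₘ B)))
    (h : ∀ a b, tmul a b ∈ S) (z : A ⊗ₘ B) : z ∈ S := by
  have : algTensor A B ≤ S := Submodule.span_le.2 (by rintro _ ⟨p, rfl⟩; exact h _ _)
  exact hS.closure_subset_iff.2 this (dense_algTensor A B z)

theorem tensor_ext_clm {E : Type*} [NormedAddCommGroup E] [NormedSpace ℂ E]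
    {S T : A ⊗ₘ B →L[ℂ] E} (h : ∀ a b, S (tmul a b) = T (tmul a b)) : S = T :=
  ContinuousLinearMap.ext fun z =>
    tensor_induction (S := LinearMap.eqLocus S.toLinearMap T.toLinearMap)
      (isClosed_eq S.continuous T.continuous) h z

theorem exists_tensorRep (f : PosFunctional A) (g : PosFunctional B) :
    ∃ ρ : A ⊗ₘ B →⋆ₙₐ[ℂ] (HilbertTensor (GNSSpace f) (GNSSpace g) →L[ℂ]
      HilbertTensor (GNSSpace f) (GNSSpace g)),
      ∀ a b, ρ (tmul a b) = opTensor (gnsRep f a) (gnsRep g b) := by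
  obtain ⟨p, rfl, rfl⟩ : ∃ p : PosFunctional A × PosFunctional B, p.1 = f ∧ p.2 = g :=
    ⟨(f, g), rfl, rfl⟩
  exact ⟨pairRep p, pairRep_tmul p⟩

/-- The representation `π_f ⊗ π_g` of `A ⊗ B`. -/
def tensorRep (f : PosFunctional A) (g : PosFunctional B) :
    A ⊗ₘ B →⋆ₙₐ[ℂ] (HilbertTensor (GNSSpace f) (GNSSpace g) →L[ℂ]
      HilbertTensor (GNSSpace f) (GNSSpace g)) :=
  (exists_tensorRep f g).choose

theorem tensorRep_tmul (f : PosFunctional A) (g : PosFunctional B) (a : A) (b : B) :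
    tensorRep f g (tmul a b) = opTensor (gnsRep f a) (gnsRep g b) :=
  (exists_tensorRep f g).choose_spec a b

/-- A *-homomorphism of C*-algebras as a continuous linear map. -/
def homL {X Y : Type*} [NonUnitalCStarAlgebra X] [NonUnitalCStarAlgebra Y] (φ : X →⋆ₙₐ[ℂ] Y) :
    X →L[ℂ] Y :=
  (φ : X →ₗ[ℂ] Y).mkContinuous 1 fun a => by
    rw [one_mul]; exact NonUnitalStarAlgHom.norm_apply_le φ a

@[simp]
theorem homL_apply {X Y : Type*} [NonUnitalCStarAlgebra X] [NonUnitalCStarAlgebra Y]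
    (φ : X →⋆ₙₐ[ℂ] Y) (x : X) : homL φ x = φ x := rfl

theorem continuous_hom {X Y : Type*} [NonUnitalCStarAlgebra X] [NonUnitalCStarAlgebra Y]
    (φ : X →⋆ₙₐ[ℂ] Y) : Continuous φ := (homL φ).continuous

theorem tensor_ext_hom {Y : Type*} [NonUnitalCStarAlgebra Y] {φ ψ : A ⊗ₘ B →⋆ₙₐ[ℂ] Y}
    (h : ∀ a b, φ (tmul a b) = ψ (tmul a b)) : φ = ψ :=
  DFunLike.ext _ _ fun z =>
    congrArg (fun T => T z) (tensor_ext_clm (S := homL φ) (T := homL ψ) h)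

theorem tensorRep_ext {z w : A ⊗ₘ B} (h : ∀ f g, tensorRep f g z = tensorRep f g w) : z = w :=
  pairRep_ext fun p => by
    have : pairRep p = tensorRep p.1 p.2 := tensor_ext_hom fun a b => by
      rw [pairRep_tmul, tensorRep_tmul]
    rw [this, h]

/-- The vector functional `z ↦ ⟨u, (π_f ⊗ π_g)(z) v⟩`. -/
def tensorVec (f : PosFunctional A) (g : PosFunctional B)
    (u v : HilbertTensor (GNSSpace f) (GNSSpace g)) : A ⊗ₘ B →L[ℂ] ℂ :=
  LinearMap.mkContinuous
    { toFun := fun z => inner ℂ u (tensorRep f g z v)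
      map_add' := fun x y => by rw [map_add, add_apply, inner_add_right]
      map_smul' := fun c x => by rw [map_smul, smul_apply, inner_smul_right]; rfl }
    (‖u‖ * ‖v‖) fun z => by
      refine (norm_inner_le_norm (𝕜 := ℂ) u (tensorRep f g z v)).trans ?_
      rw [mul_assoc]
      gcongr
      rw [mul_comm]
      exact (ContinuousLinearMap.le_opNorm _ _).trans (by
        gcongr; exact NonUnitalStarAlgHom.norm_apply_le (tensorRep f g) z)

theorem tensorVec_apply (f : PosFunctional A) (g : PosFunctional B)
    (u v : HilbertTensor (GNSSpace f) (GNSSpace g)) (z : A ⊗ₘ B) :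
    tensorVec f g u v z = inner ℂ u (tensorRep f g z v) := rfl

end TensorBasics

/-! ### Slice maps. -/

section Slices

attribute [local instance] CStarAlgebra.spectralOrder CStarAlgebra.spectralOrderedRing

variable {A : Type*} [NonUnitalCStarAlgebra A]

variable (A) in
/-- The space of linear combinations of vector functionals of GNS representations. -/
def sliceable : Submodule ℂ (A →L[ℂ] ℂ) :=
  Submodule.span ℂ {F | ∃ (f : PosFunctional A) (ξ η : GNSSpace f),
    ∀ a, F a = inner ℂ ξ (gnsRep f a η)}

variable (X : Type*) [NonUnitalCStarAlgebra X]

/-- The slice is bounded for the spatial norm because its matrix coefficients `⟨k, π_g(·)l⟩` are the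
coefficients of `π_f ⊗ π_g` between `ξ ⊗ k` and `η ⊗ l`, and the universal representation of `X` is
isometric. This bound also makes the slice well defined on the image of the algebraic tensor
product. -/
theorem exists_slice_of_vector {F : A →L[ℂ] ℂ} (f : PosFunctional A) (ξ η : GNSSpace f)
    (hF : ∀ a, F a = inner ℂ ξ (gnsRep f a η)) :
    ∃ L : A ⊗ₘ X →L[ℂ] X, ∀ a x, L (tmul a x) = F a • x := by
  let e : A ⊗[ℂ] X →ₗ[ℂ] A ⊗ₘ X := TensorProduct.lift (tmulₗ A X)
  let φ : A ⊗[ℂ] X →ₗ[ℂ] X := TensorProduct.lift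
    ((LinearMap.lsmul ℂ X).comp (F : A →ₗ[ℂ] ℂ))
  have he : ∀ a x, e (a ⊗ₜ x) = tmul a x := fun _ _ => rfl
  have hφ : ∀ a x, φ (a ⊗ₜ x) = F a • x := fun _ _ => rfl
  have hdense : DenseRange e := by
    refine (dense_algTensor A X).mono ?_
    rw [← LinearMap.coe_range]
    exact Submodule.span_le.2 (by rintro _ ⟨p, rfl⟩; exact ⟨p.1 ⊗ₜ p.2, rfl⟩)
  have key : ∀ (g : PosFunctional X) (k l : GNSSpace g) (t : A ⊗[ℂ] X),
      inner ℂ k (gnsRep g (φ t) l) = inner ℂ (hvec ξ k) (tensorRep f g (e t) (hvec η l)) := by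
    intro g k l t
    induction t using TensorProduct.induction_on with
    | zero => simp
    | tmul a x =>
      rw [he, hφ, tensorRep_tmul, opTensor_hvec, inner_hvec, ← hF, map_smul,
        smul_apply, inner_smul_right]
    | add s t hs ht =>
      simp only [map_add, add_apply, inner_add_right, hs, ht]
  have bound : ∀ t, ‖φ t‖ ≤ (‖ξ‖ * ‖η‖) * ‖e t‖ := by
    intro t
    refine norm_le_of_forall_gnsRep fun g => ?_
    refine ContinuousLinearMap.opNorm_le_bound _ (by positivity) fun l => ?_
    by_cases h0 : ‖gnsRep g (φ t) l‖ = 0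
    · rw [h0]; positivity
    -- Choosing `k = π_g(φ t)l` turns the coefficient into the squared norm to be estimated.
    have h1 := key g (gnsRep g (φ t) l) l t
    have h2 : ‖gnsRep g (φ t) l‖ * ‖gnsRep g (φ t) l‖ ≤
        (‖ξ‖ * ‖gnsRep g (φ t) l‖) * (‖e t‖ * (‖η‖ * ‖l‖)) := by
      have h0 : ‖gnsRep g (φ t) l‖ * ‖gnsRep g (φ t) l‖ =
          ‖inner ℂ (gnsRep g (φ t) l) (gnsRep g (φ t) l)‖ := by
        rw [inner_self_eq_norm_sq_to_K, norm_pow]; simp [pow_two]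
      rw [h0, h1, ← norm_hvec, ← norm_hvec]
      refine (norm_inner_le_norm _ _).trans ?_
      gcongr
      exact (ContinuousLinearMap.le_opNorm _ _).trans (by
        gcongr; exact NonUnitalStarAlgHom.norm_apply_le (tensorRep f g) (e t))
    have h3 : 0 < ‖gnsRep g (φ t) l‖ := lt_of_le_of_ne (norm_nonneg _) (Ne.symm h0)
    refine le_of_mul_le_mul_right (h2.trans (le_of_eq ?_)) h3
    ring
  refine ⟨φ.extendOfNorm e, fun a x => ?_⟩
  rw [← he, LinearMap.extendOfNorm_eq hdense ⟨_, bound⟩, hφ]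

theorem exists_slice {F : A →L[ℂ] ℂ} (hF : F ∈ sliceable A) :
    ∃ L : A ⊗ₘ X →L[ℂ] X, ∀ a x, L (tmul a x) = F a • x := by
  induction hF using Submodule.span_induction with
  | mem F hF =>
    obtain ⟨f, ξ, η, h⟩ := hF
    exact exists_slice_of_vector X f ξ η h
  | zero => exact ⟨0, by simp⟩
  | add F G _ _ hF hG =>
    obtain ⟨L, hL⟩ := hF
    obtain ⟨M, hM⟩ := hG
    exact ⟨L + M, by simp [hL, hM, add_smul]⟩
  | smul c F _ hF =>
    obtain ⟨L, hL⟩ := hF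
    exact ⟨c • L, by simp [hL, mul_smul]⟩

/-- The left slice map `F ⊗ id : A ⊗ X → X`. -/
def lslice (F : sliceable A) : A ⊗ₘ X →L[ℂ] X := (exists_slice X F.2).choose

variable {X}

@[simp]
theorem lslice_tmul (F : sliceable A) (a : A) (x : X) :
    lslice X F (tmul a x) = (F : A →L[ℂ] ℂ) a • x :=
  (exists_slice X F.2).choose_spec a x

/-- The inequality `hK` makes `gnsVec f a ↦ F a` a bounded functional on the GNS space. Its Riesz
vector `Ω` plays the part of the class of the absent unit: it is cyclic and `F` is its vector
functional. -/
theorem mem_sliceable_of_pos {F : A →L[ℂ] ℂ} (h0 : ∀ a, 0 ≤ F (star a * a)) {K : ℝ}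
    (hK : ∀ a, ‖F a‖ ^ 2 ≤ K ^ 2 * (F (star a * a)).re) : F ∈ sliceable A := by
  let f := posOfStar F h0
  have hF : ∀ a, F a = f a := fun _ => rfl
  let ℓ : GNSSpace f →L[ℂ] ℂ := (F : A →ₗ[ℂ] ℂ).extendOfNorm (gnsVec f)
  have hℓ : ∀ a, ℓ (gnsVec f a) = F a := fun a =>
    LinearMap.extendOfNorm_eq (gnsVec_denseRange f) ⟨|K|, fun a => by
      have h := hK a
      rw [hF (star a * a), ← norm_gnsVec_sq, Complex.ofReal_re, ← mul_pow] at h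
      have := sq_le_sq.1 h
      rwa [abs_mul, abs_norm, abs_norm] at this⟩ a
  let Ω := (InnerProductSpace.toDual ℂ _).symm ℓ
  have hΩ : ∀ a, inner ℂ Ω (gnsVec f a) = F a := fun a => by
    rw [← hℓ]; exact InnerProductSpace.toDual_symm_apply
  have hcyc : ∀ a, gnsRep f a Ω = gnsVec f a := by
    intro a
    -- The second variable is a dummy; density is needed in `x` only.
    refine (gnsVec_denseRange f).induction_on₂ (p := fun x y => inner ℂ x (gnsRep f a Ω) =
      inner ℂ x (gnsVec f a) ∧ y = y) ?_ ?_ |> fun h => ext_inner_left ℂ fun v => (h v v).1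
    · exact (isClosed_eq (by fun_prop) (by fun_prop)).and
        (isClosed_eq continuous_snd continuous_snd)
    · intro b _
      refine ⟨?_, rfl⟩
      rw [← ContinuousLinearMap.adjoint_inner_left, ← ContinuousLinearMap.star_eq_adjoint,
        ← map_star, gnsRep_gnsVec, ← inner_conj_symm, hΩ, hF, inner_gnsVec,
        ← inner_gnsVec f b a, ← inner_conj_symm, inner_gnsVec]
  exact Submodule.subset_span ⟨f, Ω, Ω, fun a => by rw [hcyc, hΩ]⟩

/-- `f(c* · d)` for a positive functional `f`. -/
def coeff (f : PosFunctional A) (c d : A) : sliceable A :=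
  ⟨⟨((f : PosFunctional A).toLinearMap ∘ₗ LinearMap.mulLeft ℂ (star c)) ∘ₗ
      LinearMap.mulRight ℂ d, by
      change Continuous fun a => f (star c * (a * d))
      exact (map_continuous f).comp (by fun_prop)⟩,
    Submodule.subset_span ⟨f, gnsVec f c, gnsVec f d, fun a => by
      rw [gnsRep_gnsVec, inner_gnsVec]; rfl⟩⟩

theorem coeff_apply (f : PosFunctional A) (c d a : A) :
    (coeff f c d : A →L[ℂ] ℂ) a = f (star c * (a * d)) := rfl

theorem inner_gnsRep_lslice_coeff (f : PosFunctional A) (c d : A) (g : PosFunctional X)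
    (k l : GNSSpace g) (z : A ⊗ₘ X) :
    inner ℂ k (gnsRep g (lslice X (coeff f c d) z) l) =
      inner ℂ (hvec (gnsVec f c) k) (tensorRep f g z (hvec (gnsVec f d) l)) := by
  let L : A ⊗ₘ X →L[ℂ] ℂ := (innerSL ℂ k).comp ((ContinuousLinearMap.apply ℂ _ l).comp
    ((homL (gnsRep g)).comp (lslice X (coeff f c d))))
  let R := tensorVec f g (hvec (gnsVec f c) k) (hvec (gnsVec f d) l)
  have : L = R := tensor_ext_clm fun a x => by
    change inner ℂ k (gnsRep g (lslice X (coeff f c d) (tmul a x)) l) =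
      inner ℂ (hvec (gnsVec f c) k) (tensorRep f g (tmul a x) (hvec (gnsVec f d) l))
    rw [lslice_tmul, map_smul, tensorRep_tmul, opTensor_hvec, inner_hvec, gnsRep_gnsVec,
      inner_gnsVec, coeff_apply, smul_apply, inner_smul_right]
  exact congrArg (fun φ => φ z) this

/-- Slices with `f(c* · d)` separate the points of `A ⊗ X`. -/
theorem eq_of_lslice_coeff {z w : A ⊗ₘ X}
    (h : ∀ f c d, lslice X (coeff f c d) z = lslice X (coeff f c d) w) : z = w := by
  refine tensorRep_ext fun f g => ?_
  have key : ∀ c d k l, inner ℂ (hvec (gnsVec f c) k) (tensorRep f g z (hvec (gnsVec f d) l)) =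
      inner ℂ (hvec (gnsVec f c) k) (tensorRep f g w (hvec (gnsVec f d) l)) := by
    intro c d k l
    rw [← inner_gnsRep_lslice_coeff, ← inner_gnsRep_lslice_coeff, h]
  have key2 : ∀ ξ η k l, inner ℂ (hvec ξ k) (tensorRep f g z (hvec η l)) =
      inner ℂ (hvec ξ k) (tensorRep f g w (hvec η l)) := by
    intro ξ η k l
    refine (gnsVec_denseRange f).induction_on₂ (p := fun ξ η =>
      inner ℂ (hvec ξ k) (tensorRep f g z (hvec η l)) =
      inner ℂ (hvec ξ k) (tensorRep f g w (hvec η l))) ?_ (fun c d => key c d k l) ξ η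
    exact isClosed_eq (by fun_prop) (by fun_prop)
  refine hvec_ext fun η l => ext_inner_right ℂ fun v => ?_
  have : innerSL ℂ (tensorRep f g z (hvec η l)) = innerSL ℂ (tensorRep f g w (hvec η l)) := by
    refine hvec_ext fun ξ k => ?_
    rw [innerSL_apply_apply, innerSL_apply_apply, ← inner_conj_symm, key2, inner_conj_symm]
  exact congrArg (fun φ => φ v) this

end Slices

/-! ### Constructing *-homomorphisms from their values on generators. -/

section Lifting

variable {W X Y Z : Type*} [NonUnitalCStarAlgebra W] [NonUnitalCStarAlgebra X]
  [NonUnitalCStarAlgebra Y] [NonUnitalCStarAlgebra Z]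

theorem exists_factor (J : X →⋆ₙₐ[ℂ] Z) (hJ : Function.Injective J) (ψ : W →⋆ₙₐ[ℂ] Z)
    (h : ∀ w, ψ w ∈ Set.range J) : ∃ θ : W →⋆ₙₐ[ℂ] X, ∀ w, J (θ w) = ψ w := by
  choose θ hθ using h
  exact ⟨{ toFun := θ
           map_smul' := fun c x => hJ (by simp [hθ])
           map_zero' := hJ (by simp [hθ])
           map_add' := fun x y => hJ (by simp [hθ])
           map_mul' := fun x y => hJ (by simp [hθ])
           map_star' := fun x => hJ (by simp [hθ, map_star]) }, hθ⟩

theorem isClosed_range_hom (J : X →⋆ₙₐ[ℂ] Z) (hJ : Function.Injective J) :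
    IsClosed (Set.range J) :=
  (NonUnitalStarAlgHom.isometry J hJ).isClosedEmbedding.isClosed_range

theorem submodule_eq_top_of_dense_span {I : Type*} {E : Type*} [NormedAddCommGroup E]
    [NormedSpace ℂ E] {s : I → E} (hs : Dense (Submodule.span ℂ (Set.range s) : Set E))
    {S : Submodule ℂ E} (hS : IsClosed (S : Set E)) (h : ∀ i, s i ∈ S) (z : E) : z ∈ S := by
  have : Submodule.span ℂ (Set.range s) ≤ S := Submodule.span_le.2 (by rintro _ ⟨i, rfl⟩; exact h i)
  exact hS.closure_subset_iff.2 this (hs z)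

/-- A map defined on a set of generators, closed under products and adjoints, extends to a
*-homomorphism if sufficiently many functionals on the target pull back to the source. -/
theorem exists_hom_of_dense {I : Type*} (s : I → X) (t : I → Y)
    (hs : Dense (Submodule.span ℂ (Set.range s) : Set X))
    (hmul : ∀ i j, ∃ k, s k = s i * s j ∧ t k = t i * t j)
    (hstar : ∀ i, ∃ k, s k = star (s i) ∧ t k = star (t i))
    (hsep : ∀ y : Y, (∀ Λ : Y →L[ℂ] ℂ, (∃ Λ' : X →L[ℂ] ℂ, ∀ i, Λ' (s i) = Λ (t i)) → Λ y = 0) →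
      y = 0) :
    ∃ Φ : X →⋆ₙₐ[ℂ] Y, ∀ i, Φ (s i) = t i := by
  -- The desired map has for its graph the closed *-algebra spanned by the pairs `(s i, t i)`. The
  -- separation hypothesis makes the first projection injective, hence isometric with closed range;
  -- its range is dense, so it is onto. Inverting it and projecting to `Y` gives the map.
  let G : Submodule ℂ (X × Y) := Submodule.span ℂ (Set.range fun i => (s i, t i))
  have hmem : ∀ i, (s i, t i) ∈ G := fun i => Submodule.subset_span ⟨i, rfl⟩
  have hGmul : ∀ z w, z ∈ G → w ∈ G → z * w ∈ G := by
    intro z w hz hw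
    induction hz using Submodule.span_induction with
    | mem x hx =>
      obtain ⟨i, rfl⟩ := hx
      induction hw using Submodule.span_induction with
      | mem y hy =>
        obtain ⟨j, rfl⟩ := hy
        obtain ⟨k, h1, h2⟩ := hmul i j
        have := hmem k
        rw [h1, h2] at this
        exact this
      | zero => rw [mul_zero]; exact zero_mem _
      | add x y _ _ hx hy => rw [mul_add]; exact add_mem hx hy
      | smul c x _ hx => rw [mul_smul_comm]; exact Submodule.smul_mem _ _ hx
    | zero => rw [zero_mul]; exact zero_mem _
    | add x y _ _ hx hy => rw [add_mul]; exact add_mem hx hy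
    | smul c x _ hx => rw [smul_mul_assoc]; exact Submodule.smul_mem _ _ hx
  have hGstar : ∀ z, z ∈ G → star z ∈ G := by
    intro z hz
    induction hz using Submodule.span_induction with
    | mem x hx =>
      obtain ⟨i, rfl⟩ := hx
      obtain ⟨k, h1, h2⟩ := hstar i
      have := hmem k
      rw [h1, h2] at this
      exact this
    | zero => rw [star_zero]; exact zero_mem _
    | add x y _ _ hx hy => rw [star_add]; exact add_mem hx hy
    | smul c x _ hx => rw [star_smul]; exact Submodule.smul_mem _ _ hx
  let S₀ : NonUnitalStarSubalgebra ℂ (X × Y) :=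
    { G with
      mul_mem' := fun {z w} hz hw => hGmul z w hz hw
      star_mem' := fun {z} hz => hGstar z hz }
  let S := S₀.topologicalClosure
  have : IsClosed (S : Set (X × Y)) := NonUnitalStarSubalgebra.isClosed_topologicalClosure _
  have hS : ∀ i, (s i, t i) ∈ S := fun i => NonUnitalStarSubalgebra.le_topologicalClosure _ (hmem i)
  let p : S →⋆ₙₐ[ℂ] X := (NonUnitalStarAlgHom.fst ℂ X Y).comp
    (NonUnitalStarSubalgebraClass.subtype S)
  let q : S →⋆ₙₐ[ℂ] Y := (NonUnitalStarAlgHom.snd ℂ X Y).comp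
    (NonUnitalStarSubalgebraClass.subtype S)
  have hp : Function.Injective p := by
    rw [injective_iff_map_eq_zero]
    intro z hz
    have hz1 : z.1.1 = 0 := hz
    have hz2 : z.1.2 = 0 := by
      refine hsep _ fun Λ ⟨Λ', hΛ⟩ => ?_
      have hle : G ≤ LinearMap.eqLocus (Λ'.comp (ContinuousLinearMap.fst ℂ X Y)).toLinearMap
          (Λ.comp (ContinuousLinearMap.snd ℂ X Y)).toLinearMap :=
        Submodule.span_le.2 (by rintro _ ⟨i, rfl⟩; exact hΛ i)
      have hcl : IsClosed {w : X × Y | Λ' w.1 = Λ w.2} :=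
        isClosed_eq (by fun_prop) (by fun_prop)
      have := hcl.closure_subset_iff.2 hle z.2
      rw [Set.mem_ofPred_eq, hz1, map_zero] at this
      exact this.symm
    exact Subtype.ext (Prod.ext hz1 hz2)
  have hsurj : ∀ x, x ∈ Set.range p :=
    submodule_eq_top_of_dense_span hs (S := LinearMap.range (p : S →ₗ[ℂ] X))
      (isClosed_range_hom p hp) fun i => ⟨⟨_, hS i⟩, rfl⟩
  obtain ⟨θ, hθ⟩ := exists_factor p hp (NonUnitalStarAlgHom.id ℂ X) hsurj
  refine ⟨q.comp θ, fun i => ?_⟩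
  have : θ (s i) = ⟨_, hS i⟩ := hp (hθ (s i))
  change q (θ (s i)) = _
  rw [this]
  rfl

end Lifting

/-! ### Pulling coefficient functionals back along morphisms. -/

section PullBack

attribute [local instance] CStarAlgebra.spectralOrder CStarAlgebra.spectralOrderedRing

variable {A D : Type*} [NonUnitalCStarAlgebra A] [NonUnitalCStarAlgebra D]

theorem star_fst_mul (T : 𝓜(ℂ, D)) (x y : D) : star (T.fst x) * y = star x * (star T).fst y := by
  rw [DoubleCentralizer.star_fst, ← star_inj, star_mul, star_mul, star_star, star_star, star_star,
    T.central]

/-- Reduces off-diagonal coefficients to the diagonal ones `f(e⋆ T e)`, to which positivity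
arguments apply. -/
theorem polarization (f : PosFunctional D) (T : D →ₗ[ℂ] D) (c d : D) :
    f (star c * T d) = (1 / 4 : ℂ) * (f (star (d + c) * T (d + c)) - f (star (d - c) * T (d - c))
      + Complex.I * f (star (d + Complex.I • c) * T (d + Complex.I • c))
      - Complex.I * f (star (d - Complex.I • c) * T (d - Complex.I • c))) := by
  simp only [star_add, star_sub, star_smul, map_add, map_sub, map_smul, add_mul, sub_mul, mul_add,
    mul_sub, smul_mul_assoc, mul_smul_comm, smul_eq_mul, Complex.star_def, Complex.conj_I, smul_add,
    smul_sub]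
  linear_combination (f (star c * T d) / 2 - f (star d * T c) / 2) * Complex.I_sq

/-- The functional is positive because `φ` is a *-homomorphism, and Cauchy–Schwarz for `f` supplies
the bound of `mem_sliceable_of_pos` with `K² = f(d⋆d)`. Thus functionals pulled back along a
morphism can still be used to slice. -/
theorem exists_sliceable_conj (φ : A →⋆ₙₐ[ℂ] 𝓜(ℂ, D)) (f : PosFunctional D) (d : D) :
    ∃ F : sliceable A, ∀ a, (F : A →L[ℂ] ℂ) a = f (star d * (φ a).fst d) := by
  let ev : 𝓜(ℂ, D) →L[ℂ] D := LinearMap.mkContinuous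
    { toFun := fun T => T.fst d, map_add' := fun _ _ => rfl, map_smul' := fun _ _ => rfl } ‖d‖
    fun T => by
      rw [mul_comm, ← DoubleCentralizer.norm_fst]
      exact T.fst.le_opNorm d
  let fL : D →L[ℂ] ℂ := ⟨f.toLinearMap, map_continuous f⟩
  let F : A →L[ℂ] ℂ := fL.comp ((ContinuousLinearMap.mul ℂ D (star d)).comp (ev.comp (homL φ)))
  have hF : ∀ a, F a = f (star d * (φ a).fst d) := fun _ => rfl
  have hFF : ∀ a, F (star a * a) = f (star ((φ a).fst d) * (φ a).fst d) := fun a => by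
    rw [hF, map_mul φ, map_star φ, mul_fst_apply, star_fst_mul]
  have h0 : ∀ a, 0 ≤ F (star a * a) := fun a => by
    rw [hFF]; exact posFunctional_star_mul_self f _
  refine ⟨⟨F, mem_sliceable_of_pos h0 (K := √(f (star d * d)).re) fun a => ?_⟩, hF⟩
  rw [Real.sq_sqrt (Complex.nonneg_iff.1 (posFunctional_star_mul_self f d)).1, hFF]
  exact norm_apply_sq_le f d _

theorem exists_sliceable_coeff (φ : A →⋆ₙₐ[ℂ] 𝓜(ℂ, D)) (f : PosFunctional D) (c d : D) :
    ∃ F : sliceable A, ∀ a, (F : A →L[ℂ] ℂ) a = f (star c * (φ a).fst d) := by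
  choose F hF using exists_sliceable_conj φ f
  refine ⟨(1 / 4 : ℂ) • (F (d + c) - F (d - c) + Complex.I • F (d + Complex.I • c)
    - Complex.I • F (d - Complex.I • c)), fun a => ?_⟩
  have := polarization f (φ a).fst.toLinearMap c d
  change _ = f (star c * (φ a).fst.toLinearMap d)
  rw [this]
  simp only [Submodule.coe_smul, Submodule.coe_add, Submodule.coe_sub, smul_apply, add_apply,
    sub_apply, hF, smul_eq_mul]
  rfl

theorem exists_sliceable_comp (φ : A →⋆ₙₐ[ℂ] D) (f : PosFunctional D) (c d : D) :
    ∃ F : sliceable A, ∀ a, (F : A →L[ℂ] ℂ) a = (coeff f c d : D →L[ℂ] ℂ) (φ a) :=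
  exists_sliceable_coeff ((emb D).comp φ) f c d

/-- The coefficient functionals separate points. -/
theorem eq_of_coeff {x y : A}
    (h : ∀ f c d, (coeff f c d).1 x = (coeff f c d).1 y) : x = y := by
  rw [← sub_eq_zero, ← norm_le_zero_iff]
  refine norm_le_of_forall_gnsRep fun f => ?_
  have hz : gnsRep f (x - y) = 0 := by
    refine ContinuousLinearMap.ext fun l => ext_inner_left ℂ fun k => ?_
    refine (gnsVec_denseRange f).induction_on₂ (p := fun k l =>
      inner ℂ k (gnsRep f (x - y) l) = inner ℂ k ((0 : GNSSpace f →L[ℂ] GNSSpace f) l)) ?_ ?_ k l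
    · exact isClosed_eq (by fun_prop) (by fun_prop)
    · intro c d
      have := h f c d
      rw [coeff_apply, coeff_apply] at this
      rw [gnsRep_gnsVec, inner_gnsVec, sub_mul, mul_sub, map_sub, this, sub_self, zero_apply,
        inner_zero_right]
  rw [hz, norm_zero]

end PullBack

/-! ### Tensor products of *-homomorphisms, the flip and right slices. -/

section TensorMaps

attribute [local instance] CStarAlgebra.spectralOrder CStarAlgebra.spectralOrderedRing

variable {A B D E : Type*} [NonUnitalCStarAlgebra A] [NonUnitalCStarAlgebra B]
  [NonUnitalCStarAlgebra D] [NonUnitalCStarAlgebra E]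

theorem eq_of_coeff_lslice {z w : A ⊗ₘ B}
    (h : ∀ f c d g k l, (coeff g k l).1 (lslice B (coeff f c d) z) =
      (coeff g k l).1 (lslice B (coeff f c d) w)) : z = w :=
  eq_of_lslice_coeff fun f c d => eq_of_coeff fun g k l => h f c d g k l

/-- Products of coefficient functionals separate the points of `D ⊗ E`. They pull back to bounded
functionals on `A ⊗ B` because a coefficient functional composed with `φ` is sliceable. -/
theorem exists_tmap (φ : A →⋆ₙₐ[ℂ] D) (ψ : B →⋆ₙₐ[ℂ] E) :
    ∃ Φ : A ⊗ₘ B →⋆ₙₐ[ℂ] D ⊗ₘ E, ∀ a b, Φ (tmul a b) = tmul (φ a) (ψ b) := by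
  obtain ⟨Φ, hΦ⟩ := exists_hom_of_dense (fun p : A × B => tmul p.1 p.2)
    (fun p => tmul (φ p.1) (ψ p.2)) (dense_algTensor A B)
    (fun p q => ⟨(p.1 * q.1, p.2 * q.2), by simp [tmul_mul_tmul]⟩)
    (fun p => ⟨(star p.1, star p.2), by simp [star_tmul, map_star]⟩) (fun z hz => by
      refine eq_of_coeff_lslice fun f c d g k l => ?_
      rw [map_zero, map_zero]
      obtain ⟨F, hF⟩ := exists_sliceable_comp φ f c d
      exact hz ((coeff g k l : E →L[ℂ] ℂ).comp (lslice E (coeff f c d)))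
        ⟨((coeff g k l : E →L[ℂ] ℂ).comp (homL ψ)).comp (lslice B F), fun p => by
          simp [hF]⟩)
  exact ⟨Φ, fun a b => hΦ (a, b)⟩

/-- The tensor product of *-homomorphisms. -/
def tmap (φ : A →⋆ₙₐ[ℂ] D) (ψ : B →⋆ₙₐ[ℂ] E) : A ⊗ₘ B →⋆ₙₐ[ℂ] D ⊗ₘ E := (exists_tmap φ ψ).choose

@[simp]
theorem tmap_tmul (φ : A →⋆ₙₐ[ℂ] D) (ψ : B →⋆ₙₐ[ℂ] E) (a : A) (b : B) :
    tmap φ ψ (tmul a b) = tmul (φ a) (ψ b) := (exists_tmap φ ψ).choose_spec a b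

theorem exists_flip (A B : Type*) [NonUnitalCStarAlgebra A] [NonUnitalCStarAlgebra B] :
    ∃ Φ : A ⊗ₘ B →⋆ₙₐ[ℂ] B ⊗ₘ A, ∀ a b, Φ (tmul a b) = tmul b a := by
  obtain ⟨Φ, hΦ⟩ := exists_hom_of_dense (fun p : A × B => tmul p.1 p.2)
    (fun p => tmul p.2 p.1) (dense_algTensor A B)
    (fun p q => ⟨(p.1 * q.1, p.2 * q.2), by simp [tmul_mul_tmul]⟩)
    (fun p => ⟨(star p.1, star p.2), by simp [star_tmul]⟩) (fun z hz => by
      refine eq_of_coeff_lslice fun f c d g k l => ?_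
      rw [map_zero, map_zero]
      exact hz ((coeff g k l : A →L[ℂ] ℂ).comp (lslice A (coeff f c d)))
        ⟨(coeff f c d : B →L[ℂ] ℂ).comp (lslice B (coeff g k l)), fun p => by
          simp [mul_comm]⟩)
  exact ⟨Φ, fun a b => hΦ (a, b)⟩

/-- The flip `A ⊗ B → B ⊗ A`. -/
def flip (A B : Type*) [NonUnitalCStarAlgebra A] [NonUnitalCStarAlgebra B] :
    A ⊗ₘ B →⋆ₙₐ[ℂ] B ⊗ₘ A := (exists_flip A B).choose

@[simp]
theorem flip_tmul (a : A) (b : B) : flip A B (tmul a b) = tmul b a :=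
  (exists_flip A B).choose_spec a b

/-- The right slice map `id ⊗ G : A ⊗ B → A`. -/
def rslice (A : Type*) [NonUnitalCStarAlgebra A] (G : sliceable B) : A ⊗ₘ B →L[ℂ] A :=
  (lslice A G).comp (homL (flip A B))

@[simp]
theorem rslice_tmul (G : sliceable B) (a : A) (b : B) :
    rslice A G (tmul a b) = (G : B →L[ℂ] ℂ) b • a := by
  simp [rslice]

theorem apply_rslice (F : sliceable A) (G : sliceable B) (z : A ⊗ₘ B) :
    (F : A →L[ℂ] ℂ) (rslice A G z) = (G : B →L[ℂ] ℂ) (lslice B F z) :=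
  congrArg (fun T => T z) (tensor_ext_clm (S := (F : A →L[ℂ] ℂ).comp (rslice A G))
    (T := (G : B →L[ℂ] ℂ).comp (lslice B F)) fun a b => by simp [mul_comm])

theorem eq_of_rslice_coeff {z w : A ⊗ₘ B}
    (h : ∀ f c d, rslice A (coeff f c d) z = rslice A (coeff f c d) w) : z = w :=
  eq_of_coeff_lslice fun f c d g k l => by rw [← apply_rslice, ← apply_rslice, h]

theorem map_lslice (ψ : B →⋆ₙₐ[ℂ] E) (F : sliceable A) (z : A ⊗ₘ B) :
    ψ (lslice B F z) = lslice E F (tmap (NonUnitalStarAlgHom.id ℂ A) ψ z) :=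
  congrArg (fun T => T z) (tensor_ext_clm (S := (homL ψ).comp (lslice B F))
    (T := (lslice E F).comp (homL (tmap (NonUnitalStarAlgHom.id ℂ A) ψ))) fun a b => by simp)

theorem map_rslice (φ : A →⋆ₙₐ[ℂ] D) (G : sliceable B) (z : A ⊗ₘ B) :
    φ (rslice A G z) = rslice D G (tmap φ (NonUnitalStarAlgHom.id ℂ B) z) :=
  congrArg (fun T => T z) (tensor_ext_clm (S := (homL φ).comp (rslice A G))
    (T := (rslice D G).comp (homL (tmap φ (NonUnitalStarAlgHom.id ℂ B)))) fun a b => by simp)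

theorem tmap_comp_apply {A' B' : Type*} [NonUnitalCStarAlgebra A'] [NonUnitalCStarAlgebra B']
    (φ' : D →⋆ₙₐ[ℂ] A') (ψ' : E →⋆ₙₐ[ℂ] B') (φ : A →⋆ₙₐ[ℂ] D) (ψ : B →⋆ₙₐ[ℂ] E) (z : A ⊗ₘ B) :
    tmap φ' ψ' (tmap φ ψ z) = tmap (φ'.comp φ) (ψ'.comp ψ) z :=
  DFunLike.congr_fun (tensor_ext_hom (φ := (tmap φ' ψ').comp (tmap φ ψ)) fun a b => by simp) z

/-- The map factors as `(φ ⊗ id)(id ⊗ ψ)`. Right slices intertwine `φ ⊗ id` with `φ`, left slices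
intertwine `id ⊗ ψ` with `ψ`, and slices separate points. -/
theorem tmap_injective {φ : A →⋆ₙₐ[ℂ] D} {ψ : B →⋆ₙₐ[ℂ] E} (hφ : Function.Injective φ)
    (hψ : Function.Injective ψ) : Function.Injective (tmap φ ψ) := by
  intro z w h
  have e : ∀ z, tmap φ ψ z = tmap φ (NonUnitalStarAlgHom.id ℂ E)
      (tmap (NonUnitalStarAlgHom.id ℂ A) ψ z) := fun z => by
    rw [tmap_comp_apply]; rfl
  rw [e, e] at h
  have h1 : tmap (NonUnitalStarAlgHom.id ℂ A) ψ z = tmap (NonUnitalStarAlgHom.id ℂ A) ψ w :=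
    eq_of_rslice_coeff fun f c d => hφ (by rw [map_rslice, map_rslice, h])
  exact eq_of_lslice_coeff fun f c d => hψ (by rw [map_lslice, map_lslice, h1])

end TensorMaps

/-! ### The associativity isomorphism. -/

section Associativity

attribute [local instance] CStarAlgebra.spectralOrder CStarAlgebra.spectralOrderedRing

variable (A B D : Type*) [NonUnitalCStarAlgebra A] [NonUnitalCStarAlgebra B]
  [NonUnitalCStarAlgebra D]

variable {A B D} in
theorem tensor_induction_left {S : Submodule ℂ ((A ⊗ₘ B) ⊗ₘ D)}
    (hS : IsClosed (S : Set ((A ⊗ₘ B) ⊗ₘ D))) (h : ∀ a b d, tmul (tmul a b) d ∈ S)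
    (z : (A ⊗ₘ B) ⊗ₘ D) : z ∈ S :=
  tensor_induction hS (fun w d => tensor_induction
    (S := S.comap ((tmulL (A ⊗ₘ B) D).flip d).toLinearMap)
    (hS.preimage ((tmulL (A ⊗ₘ B) D).flip d).continuous) (fun a b => h a b d) w) z

variable {A B D} in
theorem tensor_induction_right {S : Submodule ℂ (A ⊗ₘ (B ⊗ₘ D))}
    (hS : IsClosed (S : Set (A ⊗ₘ (B ⊗ₘ D)))) (h : ∀ a b d, tmul a (tmul b d) ∈ S)
    (z : A ⊗ₘ (B ⊗ₘ D)) : z ∈ S :=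
  tensor_induction hS (fun a w => tensor_induction
    (S := S.comap (tmulL A (B ⊗ₘ D) a).toLinearMap)
    (hS.preimage (tmulL A (B ⊗ₘ D) a).continuous) (fun b d => h a b d) w) z

theorem dense_tensor_left : Dense (Submodule.span ℂ (Set.range fun p : A × B × D =>
    tmul (tmul p.1 p.2.1) p.2.2) : Set ((A ⊗ₘ B) ⊗ₘ D)) := fun z =>
  tensor_induction_left (S := (Submodule.span ℂ (Set.range fun p : A × B × D =>
    tmul (tmul p.1 p.2.1) p.2.2)).topologicalClosure) (Submodule.isClosed_topologicalClosure _)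
    (fun a b d => Submodule.le_topologicalClosure _ (Submodule.subset_span ⟨(a, b, d), rfl⟩)) z

theorem dense_tensor_right : Dense (Submodule.span ℂ (Set.range fun p : A × B × D =>
    tmul p.1 (tmul p.2.1 p.2.2)) : Set (A ⊗ₘ (B ⊗ₘ D))) := fun z =>
  tensor_induction_right (S := (Submodule.span ℂ (Set.range fun p : A × B × D =>
    tmul p.1 (tmul p.2.1 p.2.2))).topologicalClosure) (Submodule.isClosed_topologicalClosure _)
    (fun a b d => Submodule.le_topologicalClosure _ (Submodule.subset_span ⟨(a, b, d), rfl⟩)) z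

/-- A product of three functionals can be evaluated by slicing in either bracketing, so separating
functionals on the target are bounded on the source. -/
theorem exists_assoc : ∃ Φ : (A ⊗ₘ B) ⊗ₘ D →⋆ₙₐ[ℂ] A ⊗ₘ (B ⊗ₘ D),
    ∀ a b d, Φ (tmul (tmul a b) d) = tmul a (tmul b d) := by
  obtain ⟨Φ, hΦ⟩ := exists_hom_of_dense (fun p : A × B × D => tmul (tmul p.1 p.2.1) p.2.2)
    (fun p => tmul p.1 (tmul p.2.1 p.2.2)) (dense_tensor_left A B D)
    (fun p q => ⟨(p.1 * q.1, p.2.1 * q.2.1, p.2.2 * q.2.2), by simp [tmul_mul_tmul]⟩)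
    (fun p => ⟨(star p.1, star p.2.1, star p.2.2), by simp [star_tmul]⟩) (fun z hz => by
      refine eq_of_lslice_coeff fun f c d => eq_of_coeff_lslice fun g k l h m n => ?_
      simp only [map_zero]
      exact hz ((coeff h m n : D →L[ℂ] ℂ).comp ((lslice D (coeff g k l)).comp
        (lslice (B ⊗ₘ D) (coeff f c d))))
        ⟨(coeff g k l : B →L[ℂ] ℂ).comp ((lslice B (coeff f c d)).comp
          (rslice (A ⊗ₘ B) (coeff h m n))), fun p => by simp; ring⟩)
  exact ⟨Φ, fun a b d => hΦ (a, b, d)⟩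

theorem exists_assoc_inv : ∃ Φ : A ⊗ₘ (B ⊗ₘ D) →⋆ₙₐ[ℂ] (A ⊗ₘ B) ⊗ₘ D,
    ∀ a b d, Φ (tmul a (tmul b d)) = tmul (tmul a b) d := by
  obtain ⟨Φ, hΦ⟩ := exists_hom_of_dense (fun p : A × B × D => tmul p.1 (tmul p.2.1 p.2.2))
    (fun p => tmul (tmul p.1 p.2.1) p.2.2) (dense_tensor_right A B D)
    (fun p q => ⟨(p.1 * q.1, p.2.1 * q.2.1, p.2.2 * q.2.2), by simp [tmul_mul_tmul]⟩)
    (fun p => ⟨(star p.1, star p.2.1, star p.2.2), by simp [star_tmul]⟩) (fun z hz => by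
      refine eq_of_rslice_coeff fun h m n => eq_of_coeff_lslice fun f c d g k l => ?_
      simp only [map_zero]
      exact hz ((coeff g k l : B →L[ℂ] ℂ).comp ((lslice B (coeff f c d)).comp
          (rslice (A ⊗ₘ B) (coeff h m n))))
        ⟨(coeff h m n : D →L[ℂ] ℂ).comp ((lslice D (coeff g k l)).comp
        (lslice (B ⊗ₘ D) (coeff f c d))), fun p => by simp; ring⟩)
  exact ⟨Φ, fun a b d => hΦ (a, b, d)⟩

variable {A B D}

theorem assoc_tmul (a : A) (b : B) (d : D) :
    assoc A B D (tmul (tmul a b) d) = tmul a (tmul b d) := by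
  obtain ⟨Φ, hΦ⟩ := exists_assoc A B D
  refine the_spec (P := fun Φ : (A ⊗ₘ B) ⊗ₘ D →⋆ₙₐ[ℂ] A ⊗ₘ (B ⊗ₘ D) =>
    ∀ (a : A) (b : B) (d : D), Φ (tmul (tmul a b) d) = tmul a (tmul b d))
    ⟨Φ, hΦ, fun Ψ hΨ => DFunLike.ext _ _ fun z => ?_⟩ a b d
  exact tensor_induction_left (S := LinearMap.eqLocus (homL Ψ).toLinearMap (homL Φ).toLinearMap)
    (isClosed_eq (homL Ψ).continuous (homL Φ).continuous)
    (fun a b d => (hΨ a b d).trans (hΦ a b d).symm) z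

variable (A B D) in
/-- The canonical isomorphism `A ⊗ (B ⊗ D) → (A ⊗ B) ⊗ D`. -/
def assocInv : A ⊗ₘ (B ⊗ₘ D) →⋆ₙₐ[ℂ] (A ⊗ₘ B) ⊗ₘ D := (exists_assoc_inv A B D).choose

@[simp]
theorem assocInv_tmul (a : A) (b : B) (d : D) :
    assocInv A B D (tmul a (tmul b d)) = tmul (tmul a b) d :=
  (exists_assoc_inv A B D).choose_spec a b d

theorem assocInv_assoc (z : (A ⊗ₘ B) ⊗ₘ D) : assocInv A B D (assoc A B D z) = z :=
  tensor_induction_left (S := LinearMap.eqLocus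
      ((homL (assocInv A B D)).comp (homL (assoc A B D))).toLinearMap LinearMap.id)
    (isClosed_eq ((homL (assocInv A B D)).comp (homL (assoc A B D))).continuous continuous_id)
    (fun a b d => by
      change assocInv A B D (assoc A B D (tmul (tmul a b) d)) = _
      rw [assoc_tmul, assocInv_tmul]; rfl) z

theorem assoc_assocInv (z : A ⊗ₘ (B ⊗ₘ D)) : assoc A B D (assocInv A B D z) = z :=
  tensor_induction_right (S := LinearMap.eqLocus
      ((homL (assoc A B D)).comp (homL (assocInv A B D))).toLinearMap LinearMap.id)
    (isClosed_eq ((homL (assoc A B D)).comp (homL (assocInv A B D))).continuous continuous_id)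
    (fun a b d => by
      change assoc A B D (assocInv A B D (tmul a (tmul b d))) = _
      rw [assocInv_tmul, assoc_tmul]; rfl) z

end Associativity

/-! ### Idealizers and tensor products of multipliers. -/

section Idealizer

variable {W X Z : Type*} [NonUnitalCStarAlgebra W] [NonUnitalCStarAlgebra X]
  [NonUnitalCStarAlgebra Z]

/-- If `Ψ : W → Z` takes values in the idealizer of `J(X)`, then it induces a *-homomorphism from
`W` to the multiplier algebra of `X`. -/
theorem exists_idealizer_hom (J : X →⋆ₙₐ[ℂ] Z) (hJ : Function.Injective J) (Ψ : W →⋆ₙₐ[ℂ] Z)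
    (hl : ∀ w x, Ψ w * J x ∈ Set.range J) (hr : ∀ w x, J x * Ψ w ∈ Set.range J) :
    ∃ θ : W →⋆ₙₐ[ℂ] 𝓜(ℂ, X), ∀ w x, J ((θ w).fst x) = Ψ w * J x := by
  choose L hL using hl
  choose R hR using hr
  have hn := NonUnitalStarAlgHom.norm_map J hJ
  let l : W → X →L[ℂ] X := fun w => LinearMap.mkContinuous
    { toFun := L w
      map_add' := fun x y => hJ (by simp [hL, mul_add])
      map_smul' := fun c x => hJ (by simp [hL, mul_smul_comm]) } ‖Ψ w‖ fun x => by
    rw [← hn, ← hn x]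
    change ‖J (L w x)‖ ≤ _
    rw [hL]
    exact norm_mul_le _ _
  let r : W → X →L[ℂ] X := fun w => LinearMap.mkContinuous
    { toFun := R w
      map_add' := fun x y => hJ (by simp [hR, add_mul])
      map_smul' := fun c x => hJ (by simp [hR, smul_mul_assoc]) } ‖Ψ w‖ fun x => by
    rw [← hn, ← hn x, mul_comm]
    change ‖J (R w x)‖ ≤ _
    rw [hR]
    exact norm_mul_le _ _
  have hl' : ∀ w x, J (l w x) = Ψ w * J x := hL
  have hr' : ∀ w x, J (r w x) = J x * Ψ w := hR
  let m : W → 𝓜(ℂ, X) := fun w => ⟨(l w, r w), fun x y => hJ (by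
    rw [map_mul, map_mul J x]
    change J (r w x) * _ = _ * J (l w y)
    rw [hr', hl', mul_assoc])⟩
  have hm : ∀ w x, J ((m w).fst x) = Ψ w * J x := hL
  have hm' : ∀ w x, J ((m w).snd x) = J x * Ψ w := hR
  refine ⟨{ toFun := m
            map_smul' := fun c x => multiplier_ext fun y => hJ ?_
            map_zero' := multiplier_ext fun y => hJ ?_
            map_add' := fun x x' => multiplier_ext fun y => hJ ?_
            map_mul' := fun x x' => multiplier_ext fun y => hJ ?_
            map_star' := fun x => multiplier_ext fun y => hJ ?_ }, hm⟩
  · change _ = J (c • (m x).fst y)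
    rw [hm, map_smul, map_smul, hm, smul_mul_assoc]
  · change _ = J 0
    rw [hm, map_zero, zero_mul, map_zero]
  · change _ = J ((m x).fst y + (m x').fst y)
    rw [hm, map_add, map_add, hm, hm, add_mul]
  · rw [hm, mul_fst_apply, hm, hm, map_mul, mul_assoc]
  · rw [hm, DoubleCentralizer.star_fst, map_star, map_star, hm', map_star, star_mul, star_star]

end Idealizer

section MulTensor

variable {A B : Type*} [NonUnitalCStarAlgebra A] [NonUnitalCStarAlgebra B]

/-- Evaluation of multipliers at an element. -/
def evL {X : Type*} [NonUnitalCStarAlgebra X] (x : X) : 𝓜(ℂ, X) →L[ℂ] X :=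
  LinearMap.mkContinuous
    { toFun := fun T => T.fst x, map_add' := fun _ _ => rfl, map_smul' := fun _ _ => rfl } ‖x‖
    fun T => by
      rw [mul_comm, ← DoubleCentralizer.norm_fst]
      exact T.fst.le_opNorm x

@[simp]
theorem evL_apply {X : Type*} [NonUnitalCStarAlgebra X] (x : X) (T : 𝓜(ℂ, X)) :
    evL x T = T.fst x := rfl

theorem tensor_multiplier_ext {S T : 𝓜(ℂ, A ⊗ₘ B)}
    (h : ∀ a b, S.fst (tmul a b) = T.fst (tmul a b)) : S = T :=
  multiplier_ext fun z => congrArg (fun L => L z) (tensor_ext_clm h)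

theorem isClosed_comap_clm {E F : Type*} [NormedAddCommGroup E] [NormedSpace ℂ E]
    [NormedAddCommGroup F] [NormedSpace ℂ F] (L : E →L[ℂ] F) {R : Submodule ℂ F}
    (hR : IsClosed (R : Set F)) : IsClosed (R.comap L.toLinearMap : Set E) :=
  hR.preimage L.continuous

theorem mul_mem_of_tmul_mul_mem {X Y Z W : Type*} [NonUnitalCStarAlgebra X]
    [NonUnitalCStarAlgebra Y] [NonUnitalCStarAlgebra Z] [NonUnitalCStarAlgebra W]
    (L : Z ⊗ₘ W →L[ℂ] X →L[ℂ] X) (J : Y →L[ℂ] X) {R : Submodule ℂ X} (hR : IsClosed (R : Set X))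
    (y : Y) (h : ∀ m n, L (tmul m n) (J y) ∈ R) (w : Z ⊗ₘ W) : L w (J y) ∈ R :=
  tensor_induction (isClosed_comap_clm (L.flip (J y)) hR) h w

/-- `A ⊗ B` sits in `M(A) ⊗ M(B)` as an ideal; `exists_idealizer_hom` then yields `M(A) ⊗ M(B) → M(A
⊗ B)`. -/
theorem mul_mem_range_tmap_emb (w : 𝓜(ℂ, A) ⊗ₘ 𝓜(ℂ, B)) (x : A ⊗ₘ B) :
    w * tmap (emb A) (emb B) x ∈ Set.range (tmap (emb A) (emb B)) := by
  have hinj := tmap_injective (emb_injective (X := A)) (emb_injective (X := B))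
  have hcl : IsClosed (LinearMap.range (homL (tmap (emb A) (emb B))).toLinearMap :
      Set (𝓜(ℂ, A) ⊗ₘ 𝓜(ℂ, B))) := isClosed_range_hom _ hinj
  refine mul_mem_of_tmul_mul_mem (ContinuousLinearMap.mul ℂ _) (homL (tmap (emb A) (emb B))) hcl x
    (fun m n => ?_) w
  refine tensor_induction (isClosed_comap_clm ((ContinuousLinearMap.mul ℂ _ (tmul m n)).comp
    (homL (tmap (emb A) (emb B)))) hcl) (fun a b => ?_) x
  refine ⟨tmul (m.fst a) (n.fst b), ?_⟩
  change tmap (emb A) (emb B) _ = tmul m n * tmap (emb A) (emb B) (tmul a b)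
  rw [tmap_tmul, tmap_tmul, tmul_mul_tmul, mul_emb, mul_emb]

theorem exists_mulTensorHom (A B : Type*) [NonUnitalCStarAlgebra A] [NonUnitalCStarAlgebra B] :
    ∃ ν : 𝓜(ℂ, A) ⊗ₘ 𝓜(ℂ, B) →⋆ₙₐ[ℂ] 𝓜(ℂ, A ⊗ₘ B),
      ∀ w x, tmap (emb A) (emb B) ((ν w).fst x) = w * tmap (emb A) (emb B) x :=
  exists_idealizer_hom (tmap (emb A) (emb B)) (tmap_injective emb_injective emb_injective)
    (NonUnitalStarAlgHom.id ℂ _) mul_mem_range_tmap_emb fun w x => by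
      obtain ⟨y, hy⟩ := mul_mem_range_tmap_emb (star w) (star x)
      refine ⟨star y, ?_⟩
      rw [map_star, hy, star_mul, map_star, star_star, star_star]
      rfl

/-- The *-homomorphism `M(A) ⊗ M(B) → M(A ⊗ B)`. -/
def mulTensorHom (A B : Type*) [NonUnitalCStarAlgebra A] [NonUnitalCStarAlgebra B] :
    𝓜(ℂ, A) ⊗ₘ 𝓜(ℂ, B) →⋆ₙₐ[ℂ] 𝓜(ℂ, A ⊗ₘ B) := (exists_mulTensorHom A B).choose

theorem mulTensorHom_tmul_fst (m : 𝓜(ℂ, A)) (n : 𝓜(ℂ, B)) (a : A) (b : B) :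
    (mulTensorHom A B (tmul m n)).fst (tmul a b) = tmul (m.fst a) (n.fst b) :=
  tmap_injective (emb_injective (X := A)) (emb_injective (X := B)) (by
    rw [mulTensorHom, (exists_mulTensorHom A B).choose_spec, tmap_tmul, tmap_tmul, tmul_mul_tmul,
      mul_emb, mul_emb])

/-- Identifies `mulTensor` with the values of a *-homomorphism, from which products and adjoints of
tensor multipliers are computed. -/
theorem mulTensor_eq (m : 𝓜(ℂ, A)) (n : 𝓜(ℂ, B)) :
    mulTensor m n = mulTensorHom A B (tmul m n) := by
  have hex : ∀ (a : A) (b : B), (mulTensorHom A B (tmul m n)).fst (tmul a b) =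
      tmul (m.fst a) (n.fst b) ∧ (mulTensorHom A B (tmul m n)).snd (tmul a b) =
      tmul (m.snd a) (n.snd b) := fun a b => by
    refine ⟨mulTensorHom_tmul_fst m n a b, ?_⟩
    have h := mulTensorHom_tmul_fst (star m) (star n) (star a) (star b)
    rw [← star_tmul, ← star_tmul, map_star (mulTensorHom A B), DoubleCentralizer.star_fst,
      DoubleCentralizer.star_fst, DoubleCentralizer.star_fst, ← star_tmul, star_star, star_star,
      star_star, star_inj] at h
    exact h
  have hsp := the_spec (P := fun T : 𝓜(ℂ, A ⊗ₘ B) => ∀ (a : A) (b : B),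
    T.fst (tmul a b) = tmul (m.fst a) (n.fst b) ∧ T.snd (tmul a b) = tmul (m.snd a) (n.snd b))
    ⟨_, hex, fun T hT => tensor_multiplier_ext fun a b => by rw [(hT a b).1, (hex a b).1]⟩
  exact tensor_multiplier_ext fun a b => (hsp a b).1.trans (hex a b).1.symm

theorem mulTensor_fst (m : 𝓜(ℂ, A)) (n : 𝓜(ℂ, B)) (a : A) (b : B) :
    (mulTensor m n).fst (tmul a b) = tmul (m.fst a) (n.fst b) := by
  rw [mulTensor_eq, mulTensorHom_tmul_fst]

theorem mulTensor_mul (m m' : 𝓜(ℂ, A)) (n n' : 𝓜(ℂ, B)) :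
    mulTensor m n * mulTensor m' n' = mulTensor (m * m') (n * n') := by
  simp only [mulTensor_eq, ← map_mul, tmul_mul_tmul]

theorem star_mulTensor (m : 𝓜(ℂ, A)) (n : 𝓜(ℂ, B)) :
    star (mulTensor m n) = mulTensor (star m) (star n) := by
  simp only [mulTensor_eq, ← map_star, star_tmul]

theorem mulTensor_emb (a : A) (b : B) : mulTensor (emb A a) (emb B b) = emb (A ⊗ₘ B) (tmul a b) :=
  tensor_multiplier_ext fun c d => by
    rw [mulTensor_fst, emb_fst, emb_fst, emb_fst, tmul_mul_tmul]

theorem mulTensor_one : mulTensor (1 : 𝓜(ℂ, A)) (1 : 𝓜(ℂ, B)) = 1 :=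
  tensor_multiplier_ext fun c d => by
    rw [mulTensor_fst]; rfl

end MulTensor

/-! ### Extending nondegenerate morphisms to multiplier algebras. -/

section Extension

variable {X Y Z : Type*} [NonUnitalCStarAlgebra X] [NonUnitalCStarAlgebra Y]
  [NonUnitalCStarAlgebra Z]

theorem nondegenerate_induction {φ : X →⋆ₙₐ[ℂ] 𝓜(ℂ, Y)} (hφ : Nondegenerate φ) {S : Submodule ℂ Y}
    (hS : IsClosed (S : Set Y)) (h : ∀ x y, (φ x).fst y ∈ S) (y : Y) : y ∈ S := by
  have : Submodule.span ℂ {y : Y | ∃ (a : X) (d : Y), y = (φ a).fst d} ≤ S :=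
    Submodule.span_le.2 (by rintro _ ⟨x, y, rfl⟩; exact h x y)
  exact hS.closure_subset_iff.2 this (hφ y)

theorem nondegenerate_of_induction {φ : X →⋆ₙₐ[ℂ] 𝓜(ℂ, Y)}
    (h : ∀ S : Submodule ℂ Y, IsClosed (S : Set Y) → (∀ x y, (φ x).fst y ∈ S) → ∀ y, y ∈ S) :
    Nondegenerate φ := fun y =>
  h (Submodule.span ℂ {y : Y | ∃ (a : X) (d : Y), y = (φ a).fst d}).topologicalClosure
    (Submodule.isClosed_topologicalClosure _)
    (fun x y => Submodule.le_topologicalClosure _ (Submodule.subset_span ⟨x, y, rfl⟩)) y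

theorem nondegenerate_ext_clm {φ : X →⋆ₙₐ[ℂ] 𝓜(ℂ, Y)} (hφ : Nondegenerate φ) {E : Type*}
    [NormedAddCommGroup E] [NormedSpace ℂ E] {S T : Y →L[ℂ] E}
    (h : ∀ x y, S ((φ x).fst y) = T ((φ x).fst y)) : S = T :=
  ContinuousLinearMap.ext fun z =>
    nondegenerate_induction hφ (S := LinearMap.eqLocus S.toLinearMap T.toLinearMap)
      (isClosed_eq S.continuous T.continuous) h z

theorem nondegenerate_multiplier_ext {φ : X →⋆ₙₐ[ℂ] 𝓜(ℂ, Y)} (hφ : Nondegenerate φ)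
    {S T : 𝓜(ℂ, Y)} (h : ∀ x, S * φ x = T * φ x) : S = T :=
  multiplier_ext fun y => congrArg (fun L => L y) (nondegenerate_ext_clm hφ
    (S := S.fst) (T := T.fst) fun x y => by rw [← mul_fst_apply, h, mul_fst_apply])

section

attribute [local instance] CStarAlgebra.spectralOrder CStarAlgebra.spectralOrderedRing

/-- The prescription `φ(x)y ↦ φ(Tx)y` is well defined and bounded by `‖T‖` on the dense span, since
it is the limit of the operators `φ(Tu)` along an approximate unit `u`. -/
theorem exists_extension_clm {φ : X →⋆ₙₐ[ℂ] 𝓜(ℂ, Y)} (hφ : Nondegenerate φ) (T : 𝓜(ℂ, X)) :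
    ∃ L : Y →L[ℂ] Y, ∀ x y, L ((φ x).fst y) = (φ (T.fst x)).fst y := by
  let act : X →ₗ[ℂ] Y →ₗ[ℂ] Y := LinearMap.mk₂ ℂ (fun x y => (φ x).fst y)
    (fun x x' y => by rw [map_add]; rfl) (fun c x y => by rw [map_smul]; rfl)
    (fun x y y' => map_add _ _ _) (fun c x y => map_smul _ _ _)
  let e : X ⊗[ℂ] Y →ₗ[ℂ] Y := TensorProduct.lift act
  let g : X ⊗[ℂ] Y →ₗ[ℂ] Y := TensorProduct.lift (act.comp T.fst.toLinearMap)
  have he : ∀ x y, e (x ⊗ₜ y) = (φ x).fst y := fun _ _ => rfl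
  have hg : ∀ x y, g (x ⊗ₜ y) = (φ (T.fst x)).fst y := fun _ _ => rfl
  have hdense : DenseRange e := by
    refine Dense.mono ?_ hφ
    rw [← LinearMap.coe_range]
    exact Submodule.span_le.2 (by rintro _ ⟨x, y, rfl⟩; exact ⟨x ⊗ₜ y, rfl⟩)
  have hu := CStarAlgebra.increasingApproximateUnit X
  have hlim : ∀ t, Filter.Tendsto (fun u => (φ (T.fst u)).fst (e t))
      (CStarAlgebra.approximateUnit X) (nhds (g t)) := by
    intro t
    induction t using TensorProduct.induction_on with
    | zero => simp only [map_zero]; exact tendsto_const_nhds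
    | tmul x y =>
      have h1 : ∀ u, (φ (T.fst u)).fst (e (x ⊗ₜ y)) =
          ((evL y).comp ((homL φ).comp T.fst)) (u * x) := fun u => by
        rw [he, ← mul_fst_apply, ← map_mul, ← fst_mul]; rfl
      simp only [h1, hg]
      exact (((evL y).comp ((homL φ).comp T.fst)).continuous.tendsto x).comp
        (hu.tendsto_mul_right x)
    | add s t hs ht => simpa only [map_add] using hs.add ht
  have hne : (CStarAlgebra.approximateUnit X).NeBot := hu.neBot
  have bound : ∀ t, ‖g t‖ ≤ ‖T‖ * ‖e t‖ := by
    intro t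
    refine le_of_tendsto (hlim t).norm (hu.eventually_norm.mono fun u hnu => ?_)
    refine ((φ (T.fst u)).fst.le_opNorm _).trans ?_
    gcongr
    rw [DoubleCentralizer.norm_fst]
    refine (NonUnitalStarAlgHom.norm_apply_le φ _).trans ((T.fst.le_opNorm u).trans ?_)
    rw [DoubleCentralizer.norm_fst]
    exact mul_le_of_le_one_right (norm_nonneg _) hnu
  refine ⟨g.extendOfNorm e, fun x y => ?_⟩
  rw [← he, LinearMap.extendOfNorm_eq hdense ⟨_, bound⟩, hg]

end

theorem exists_extension {φ : X →⋆ₙₐ[ℂ] 𝓜(ℂ, Y)} (hφ : Nondegenerate φ) :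
    ∃ Φ : 𝓜(ℂ, X) →⋆ₙₐ[ℂ] 𝓜(ℂ, Y), ∀ T x, Φ T * φ x = φ (T.fst x) := by
  choose L hL using exists_extension_clm hφ
  -- The operators attached to `T` and `star T` are formal adjoints of each other. This provides the
  -- right multiplication `y ↦ (L(T⋆)y⋆)⋆` and the centrality condition.
  have h1 : ∀ T x y z, star (L (star T) ((φ x).fst y)) * z = star ((φ x).fst y) * L T z := by
    intro T x y z
    refine congrArg (fun R => R z) (nondegenerate_ext_clm hφ
      (S := ContinuousLinearMap.mul ℂ Y (star (L (star T) ((φ x).fst y))))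
      (T := (ContinuousLinearMap.mul ℂ Y (star ((φ x).fst y))).comp (L T)) fun x' y' => ?_)
    change star (L (star T) ((φ x).fst y)) * (φ x').fst y' =
      star ((φ x).fst y) * L T ((φ x').fst y')
    rw [hL, hL, star_fst_mul, star_fst_mul, ← map_star φ, ← map_star φ, ← mul_fst_apply,
      ← mul_fst_apply, ← map_mul φ, ← map_mul φ, star_fst_mul, star_star]
  have h2 : ∀ T y z, star (L (star T) y) * z = star y * L T z := by
    intro T y z
    rw [← star_inj, star_mul, star_mul, star_star, star_star]
    refine congrArg (fun R => R y) (nondegenerate_ext_clm hφ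
      (S := (ContinuousLinearMap.mul ℂ Y (star z)).comp (L (star T)))
      (T := ContinuousLinearMap.mul ℂ Y (star (L T z))) fun x' y' => ?_)
    change star z * L (star T) ((φ x').fst y') = star (L T z) * (φ x').fst y'
    rw [← star_inj, star_mul, star_mul, star_star, star_star, h1]
  let R : 𝓜(ℂ, X) → Y →L[ℂ] Y := fun T => LinearMap.mkContinuous
    { toFun := fun y => star (L (star T) (star y))
      map_add' := fun y z => by simp
      map_smul' := fun c y => by simp } ‖L (star T)‖ fun y => by
    change ‖star (L (star T) (star y))‖ ≤ _
    rw [norm_star, ← norm_star y]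
    exact (L (star T)).le_opNorm _
  let m : 𝓜(ℂ, X) → 𝓜(ℂ, Y) := fun T => ⟨(L T, R T), fun y z => by
    change star (L (star T) (star y)) * z = y * L T z
    rw [h2, star_star]⟩
  have hm : ∀ T x, m T * φ x = φ (T.fst x) := fun T x => multiplier_ext fun y => hL T x y
  have hmL : ∀ T y, (star (m T)).fst y = L (star T) y := fun T y => by
    rw [DoubleCentralizer.star_fst]
    change star (star (L (star T) (star (star y)))) = _
    rw [star_star, star_star]
  refine ⟨{ toFun := m
            map_smul' := fun c x => nondegenerate_multiplier_ext hφ fun y => ?_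
            map_zero' := nondegenerate_multiplier_ext hφ fun y => ?_
            map_add' := fun x x' => nondegenerate_multiplier_ext hφ fun y => ?_
            map_mul' := fun x x' => nondegenerate_multiplier_ext hφ fun y => ?_
            map_star' := fun x => multiplier_ext fun y => (hmL x y).symm }, hm⟩
  · rw [hm, smul_mul_assoc, MonoidHom.id_apply, hm, ← map_smul]; rfl
  · rw [hm, zero_mul]; exact map_zero φ
  · rw [hm, add_mul, hm, hm, ← map_add]; rfl
  · rw [hm, mul_assoc, hm, hm]; rfl

/-- Any extension satisfies `Φ(T)φ(x) = φ(Tx)`, and nondegeneracy lets this relation determine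
`Φ(T)`. Hence the unique choice in `mulExt` is legitimate. -/
theorem mulExt_emb {φ : X →⋆ₙₐ[ℂ] 𝓜(ℂ, Y)} (hφ : Nondegenerate φ) (x : X) :
    mulExt φ (emb X x) = φ x := by
  obtain ⟨Φ, hΦ⟩ := exists_extension hφ
  refine the_spec (P := fun Φ : 𝓜(ℂ, X) →⋆ₙₐ[ℂ] 𝓜(ℂ, Y) => ∀ a : X, Φ (emb X a) = φ a)
    ⟨Φ, fun x => ?_, fun Ψ hΨ => DFunLike.ext _ _ fun T => ?_⟩ x
  · exact nondegenerate_multiplier_ext hφ fun y => by rw [hΦ, emb_fst, map_mul]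
  · exact nondegenerate_multiplier_ext hφ fun y => by
      rw [hΦ, ← hΨ, ← hΨ, ← map_mul, mul_emb]

theorem mulExt_mul {φ : X →⋆ₙₐ[ℂ] 𝓜(ℂ, Y)} (hφ : Nondegenerate φ) (T : 𝓜(ℂ, X)) (x : X) :
    mulExt φ T * φ x = φ (T.fst x) := by
  rw [← mulExt_emb hφ, ← mulExt_emb hφ, ← map_mul, mul_emb]

theorem mulExt_fst {φ : X →⋆ₙₐ[ℂ] 𝓜(ℂ, Y)} (hφ : Nondegenerate φ) (T : 𝓜(ℂ, X)) (x : X) (y : Y) :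
    (mulExt φ T).fst ((φ x).fst y) = (φ (T.fst x)).fst y := by
  rw [← mulExt_mul hφ]; rfl

theorem eq_mulExt {φ : X →⋆ₙₐ[ℂ] 𝓜(ℂ, Y)} (hφ : Nondegenerate φ) {T : 𝓜(ℂ, X)} {S : 𝓜(ℂ, Y)}
    (h : ∀ x, S * φ x = φ (T.fst x)) : S = mulExt φ T :=
  nondegenerate_multiplier_ext hφ fun x => by rw [h, mulExt_mul hφ]

theorem mulExt_one {φ : X →⋆ₙₐ[ℂ] 𝓜(ℂ, Y)} (hφ : Nondegenerate φ) : mulExt φ 1 = 1 :=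
  (eq_mulExt hφ fun x => by rw [one_mul]; rfl).symm

section

attribute [local instance] CStarAlgebra.spectralOrder CStarAlgebra.spectralOrderedRing

/-- Products are dense in a C*-algebra. -/
theorem mul_induction {S : Submodule ℂ X} (hS : IsClosed (S : Set X)) (h : ∀ x y, x * y ∈ S)
    (x : X) : x ∈ S := by
  have hu := CStarAlgebra.increasingApproximateUnit X
  have hne : (CStarAlgebra.approximateUnit X).NeBot := hu.neBot
  exact hS.mem_of_tendsto (hu.tendsto_mul_left x) (Filter.Eventually.of_forall fun u => h x u)

end

theorem nondegenerate_emb : Nondegenerate (emb X) :=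
  nondegenerate_of_induction fun _ hS h => mul_induction hS h

theorem nondegenerate_emb_comp_of_surjective {π : X →⋆ₙₐ[ℂ] Y} (hπ : Function.Surjective π) :
    Nondegenerate ((emb Y).comp π) :=
  nondegenerate_of_induction fun _ hS h => mul_induction hS fun x y => by
    obtain ⟨x, rfl⟩ := hπ x
    exact h x y

theorem mulExt_emb_self (T : 𝓜(ℂ, X)) : mulExt (emb X) T = T :=
  (eq_mulExt nondegenerate_emb fun x => mul_emb T x).symm

theorem nondegenerate_comp {φ : X →⋆ₙₐ[ℂ] 𝓜(ℂ, Y)} (hφ : Nondegenerate φ)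
    {ψ : Y →⋆ₙₐ[ℂ] 𝓜(ℂ, Z)} (hψ : Nondegenerate ψ) : Nondegenerate ((mulExt ψ).comp φ) :=
  nondegenerate_of_induction fun S hS h => nondegenerate_induction hψ hS fun v z =>
    nondegenerate_induction hφ (S := S.comap ((evL z).comp (homL ψ)).toLinearMap)
      (hS.preimage ((evL z).comp (homL ψ)).continuous) (fun x y => by
        change (ψ ((φ x).fst y)).fst z ∈ S
        rw [← mulExt_fst hψ]
        exact h _ _) v

theorem mulExt_mulExt {φ : X →⋆ₙₐ[ℂ] 𝓜(ℂ, Y)} (hφ : Nondegenerate φ)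
    {ψ : Y →⋆ₙₐ[ℂ] 𝓜(ℂ, Z)} (hψ : Nondegenerate ψ) (T : 𝓜(ℂ, X)) :
    mulExt ψ (mulExt φ T) = mulExt ((mulExt ψ).comp φ) T :=
  eq_mulExt (nondegenerate_comp hφ hψ) fun x => by
    change _ * mulExt ψ (φ x) = mulExt ψ (φ _)
    rw [← map_mul, mulExt_mul hφ]

theorem mulExt_comp_emb {φ : X →⋆ₙₐ[ℂ] 𝓜(ℂ, Y)} (hφ : Nondegenerate φ) :
    (mulExt φ).comp (emb X) = φ := DFunLike.ext _ _ fun x => mulExt_emb hφ x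

theorem mulExt_emb_comp (φ : X →⋆ₙₐ[ℂ] 𝓜(ℂ, Y)) : (mulExt (emb Y)).comp φ = φ :=
  DFunLike.ext _ _ fun _ => mulExt_emb_self _

/-- The extension of an injective nondegenerate *-homomorphism `X → Y` to multipliers is
injective. -/
theorem mulExt_injective {J : X →⋆ₙₐ[ℂ] Y} (hJ : Function.Injective J)
    (hnd : Nondegenerate ((emb Y).comp J)) : Function.Injective (mulExt ((emb Y).comp J)) := by
  intro S T h
  refine multiplier_ext fun x => hJ (emb_injective ?_)
  exact (mulExt_mul hnd S x).symm.trans ((congrArg (· * _) h).trans (mulExt_mul hnd T x))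

end Extension

/-! ### Tensor products of morphisms and their functoriality. -/

section HomTensor

attribute [local instance] CStarAlgebra.spectralOrder CStarAlgebra.spectralOrderedRing

variable {A B D E F G : Type*} [NonUnitalCStarAlgebra A] [NonUnitalCStarAlgebra B]
  [NonUnitalCStarAlgebra D] [NonUnitalCStarAlgebra E] [NonUnitalCStarAlgebra F]
  [NonUnitalCStarAlgebra G]

theorem homTensor_tmul (φ : A →⋆ₙₐ[ℂ] 𝓜(ℂ, D)) (ψ : B →⋆ₙₐ[ℂ] 𝓜(ℂ, E)) (a : A) (b : B) :
    homTensor φ ψ (tmul a b) = mulTensor (φ a) (ψ b) := by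
  obtain ⟨Φ, hΦ⟩ := exists_hom_of_dense (fun p : A × B => tmul p.1 p.2)
    (fun p => mulTensor (φ p.1) (ψ p.2)) (dense_algTensor A B)
    (fun p q => ⟨(p.1 * q.1, p.2 * q.2), by simp [tmul_mul_tmul, mulTensor_mul]⟩)
    (fun p => ⟨(star p.1, star p.2), by simp [star_tmul, star_mulTensor, map_star]⟩) (fun T hT => by
      refine tensor_multiplier_ext fun d e => eq_of_coeff_lslice fun f c c' g k l => ?_
      rw [DoubleCentralizer.zero_fst, zero_apply, map_zero, map_zero]
      -- Applying `φ(a) ⊗ ψ(b)` to `d ⊗ e` and slicing by `f(c⋆ · c')` produces `f(c⋆ φ(a)(d c'))`,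
      -- so `d` is absorbed into the right-hand vector.
      obtain ⟨F, hF⟩ := exists_sliceable_coeff φ f c (d * c')
      obtain ⟨G, hG⟩ := exists_sliceable_coeff ψ g k (e * l)
      refine hT ((coeff g k l : E →L[ℂ] ℂ).comp ((lslice E (coeff f c c')).comp (evL (tmul d e))))
        ⟨(G : B →L[ℂ] ℂ).comp (lslice B F), fun p => ?_⟩
      simp [mulTensor_fst, hF, hG, coeff_apply, fst_mul, mul_smul_comm])
  exact the_spec (P := fun Φ : A ⊗ₘ B →⋆ₙₐ[ℂ] 𝓜(ℂ, D ⊗ₘ E) =>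
    ∀ (a : A) (b : B), Φ (tmul a b) = mulTensor (φ a) (ψ b)) ⟨Φ, fun a b => hΦ (a, b),
      fun Ψ hΨ => tensor_ext_hom fun a b => (hΨ a b).trans (hΦ (a, b)).symm⟩ a b

theorem homTensor_emb_comp (φ : A →⋆ₙₐ[ℂ] D) (ψ : B →⋆ₙₐ[ℂ] E) :
    homTensor ((emb D).comp φ) ((emb E).comp ψ) = (emb (D ⊗ₘ E)).comp (tmap φ ψ) :=
  tensor_ext_hom fun a b => by
    rw [homTensor_tmul, NonUnitalStarAlgHom.comp_apply, NonUnitalStarAlgHom.comp_apply,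
      mulTensor_emb, NonUnitalStarAlgHom.comp_apply, tmap_tmul]

theorem homTensor_emb_emb : homTensor (emb A) (emb B) = emb (A ⊗ₘ B) :=
  tensor_ext_hom fun a b => by rw [homTensor_tmul, mulTensor_emb]

variable {φ : A →⋆ₙₐ[ℂ] 𝓜(ℂ, D)} {ψ : B →⋆ₙₐ[ℂ] 𝓜(ℂ, E)}

theorem nondegenerate_homTensor (hφ : Nondegenerate φ) (hψ : Nondegenerate ψ) :
    Nondegenerate (homTensor φ ψ) :=
  nondegenerate_of_induction fun S hS h => tensor_induction hS fun d e =>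
    nondegenerate_induction hφ (S := S.comap ((tmulL D E).flip e).toLinearMap)
      (hS.preimage ((tmulL D E).flip e).continuous) (fun a d =>
        nondegenerate_induction hψ (S := S.comap (tmulL D E ((φ a).fst d)).toLinearMap)
          (hS.preimage (tmulL D E ((φ a).fst d)).continuous) (fun b e => by
            change tmul ((φ a).fst d) ((ψ b).fst e) ∈ S
            rw [← mulTensor_fst, ← homTensor_tmul]
            exact h _ _) e) d

theorem extTensor_emb (hφ : Nondegenerate φ) (hψ : Nondegenerate ψ) (z : A ⊗ₘ B) :
    extTensor φ ψ (emb _ z) = homTensor φ ψ z :=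
  mulExt_emb (nondegenerate_homTensor hφ hψ) z

theorem extTensor_mulTensor (hφ : Nondegenerate φ) (hψ : Nondegenerate ψ) (m : 𝓜(ℂ, A))
    (n : 𝓜(ℂ, B)) : extTensor φ ψ (mulTensor m n) = mulTensor (mulExt φ m) (mulExt ψ n) := by
  refine (eq_mulExt (nondegenerate_homTensor hφ hψ) fun z => ?_).symm
  refine congrArg (fun L => L z) (tensor_ext_clm
    (S := (ContinuousLinearMap.mul ℂ _ (mulTensor (mulExt φ m) (mulExt ψ n))).comp
      (homL (homTensor φ ψ)))
    (T := (homL (homTensor φ ψ)).comp (mulTensor m n).fst) fun a b => ?_)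
  change mulTensor (mulExt φ m) (mulExt ψ n) * homTensor φ ψ (tmul a b) =
    homTensor φ ψ ((mulTensor m n).fst (tmul a b))
  rw [homTensor_tmul, mulTensor_fst, homTensor_tmul, mulTensor_mul, mulExt_mul hφ, mulExt_mul hψ]

theorem extTensor_comp_homTensor {φ' : D →⋆ₙₐ[ℂ] 𝓜(ℂ, F)} {ψ' : E →⋆ₙₐ[ℂ] 𝓜(ℂ, G)}
    (hφ' : Nondegenerate φ') (hψ' : Nondegenerate ψ') (φ : A →⋆ₙₐ[ℂ] 𝓜(ℂ, D))
    (ψ : B →⋆ₙₐ[ℂ] 𝓜(ℂ, E)) :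
    (extTensor φ' ψ').comp (homTensor φ ψ) =
      homTensor ((mulExt φ').comp φ) ((mulExt ψ').comp ψ) :=
  tensor_ext_hom fun a b => by
    rw [NonUnitalStarAlgHom.comp_apply, homTensor_tmul, homTensor_tmul,
      extTensor_mulTensor hφ' hψ']
    rfl

/-- Functoriality of the extended tensor product. Together with naturality of the associator it
reduces identities between iterated comultiplications to compositions on each leg. -/
theorem extTensor_extTensor {φ' : D →⋆ₙₐ[ℂ] 𝓜(ℂ, F)} {ψ' : E →⋆ₙₐ[ℂ] 𝓜(ℂ, G)}
    (hφ' : Nondegenerate φ') (hψ' : Nondegenerate ψ') (hφ : Nondegenerate φ)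
    (hψ : Nondegenerate ψ) (T : 𝓜(ℂ, A ⊗ₘ B)) :
    extTensor φ' ψ' (extTensor φ ψ T) =
      extTensor ((mulExt φ').comp φ) ((mulExt ψ').comp ψ) T := by
  have := extTensor_comp_homTensor hφ' hψ' φ ψ
  rw [extTensor, extTensor, mulExt_mulExt (nondegenerate_homTensor hφ hψ)
    (nondegenerate_homTensor hφ' hψ'), extTensor, ← this]
  rfl

variable (A B D) in
theorem nondegenerate_emb_comp_assoc : Nondegenerate ((emb (A ⊗ₘ (B ⊗ₘ D))).comp (assoc A B D)) :=
  nondegenerate_emb_comp_of_surjective fun z => ⟨assocInv A B D z, assoc_assocInv z⟩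

theorem extAssoc_emb (z : (A ⊗ₘ B) ⊗ₘ D) :
    extAssoc A B D (emb _ z) = emb _ (assoc A B D z) :=
  mulExt_emb (nondegenerate_emb_comp_assoc A B D) z

theorem extAssoc_mulTensor (l : 𝓜(ℂ, A)) (m : 𝓜(ℂ, B)) (n : 𝓜(ℂ, D)) :
    extAssoc A B D (mulTensor (mulTensor l m) n) = mulTensor l (mulTensor m n) := by
  refine (eq_mulExt (nondegenerate_emb_comp_assoc A B D) fun z => ?_).symm
  refine tensor_induction_left (S := LinearMap.eqLocus
    ((ContinuousLinearMap.mul ℂ _ (mulTensor l (mulTensor m n))).comp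
      (homL ((emb (A ⊗ₘ (B ⊗ₘ D))).comp (assoc A B D)))).toLinearMap
    ((homL ((emb (A ⊗ₘ (B ⊗ₘ D))).comp (assoc A B D))).comp
      (mulTensor (mulTensor l m) n).fst).toLinearMap)
    (isClosed_eq (ContinuousLinearMap.continuous _) (ContinuousLinearMap.continuous _))
    (fun a b d => ?_) z
  change mulTensor l (mulTensor m n) * emb _ (assoc A B D (tmul (tmul a b) d)) =
    emb _ (assoc A B D ((mulTensor (mulTensor l m) n).fst (tmul (tmul a b) d)))
  rw [mul_emb, assoc_tmul, mulTensor_fst, mulTensor_fst, mulTensor_fst, mulTensor_fst, assoc_tmul]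

theorem extAssoc_extTensor {χ : F →⋆ₙₐ[ℂ] 𝓜(ℂ, G)} (hφ : Nondegenerate φ) (hψ : Nondegenerate ψ)
    (hχ : Nondegenerate χ) (T : 𝓜(ℂ, (A ⊗ₘ B) ⊗ₘ F)) :
    extAssoc D E G (extTensor (homTensor φ ψ) χ T) =
      extTensor φ (homTensor ψ χ) (extAssoc A B F T) := by
  have h1 := nondegenerate_homTensor (nondegenerate_homTensor hφ hψ) hχ
  have h2 := nondegenerate_homTensor hφ (nondegenerate_homTensor hψ hχ)
  rw [extAssoc, extTensor, extTensor, extAssoc,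
    mulExt_mulExt h1 (nondegenerate_emb_comp_assoc D E G),
    mulExt_mulExt (nondegenerate_emb_comp_assoc A B F) h2]
  congr 2
  refine DFunLike.ext _ _ fun z => ?_
  refine tensor_induction_left (S := LinearMap.eqLocus
    (homL ((extAssoc D E G).comp (homTensor (homTensor φ ψ) χ))).toLinearMap
    (homL ((extTensor φ (homTensor ψ χ)).comp ((emb _).comp (assoc A B F)))).toLinearMap)
    (isClosed_eq (ContinuousLinearMap.continuous _) (ContinuousLinearMap.continuous _))
    (fun a b d => ?_) z
  change extAssoc D E G (homTensor (homTensor φ ψ) χ (tmul (tmul a b) d)) =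
    extTensor φ (homTensor ψ χ) (emb _ (assoc A B F (tmul (tmul a b) d)))
  rw [homTensor_tmul, homTensor_tmul, extAssoc_mulTensor, assoc_tmul,
    extTensor_emb hφ (nondegenerate_homTensor hψ hχ), homTensor_tmul, homTensor_tmul]

end HomTensor

/-! ### Separation, compactness and products of positive functionals. -/

section States

attribute [local instance] CStarAlgebra.spectralOrder CStarAlgebra.spectralOrderedRing

variable {C : Type*} [CStarAlgebra C]

/-- A positive functional on a unital C*-algebra, as a sliceable functional. -/
def posSlice (f : PosFunctional C) : sliceable C := coeff f 1 1

@[simp]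
theorem posSlice_apply (f : PosFunctional C) (a : C) : (posSlice f : C →L[ℂ] ℂ) a = f a := by
  rw [posSlice, coeff_apply, star_one, one_mul, mul_one]

theorem posFunctional_apply_one_nonneg (f : PosFunctional C) : 0 ≤ f 1 := by
  simpa using posFunctional_star_mul_self f (1 : C)

theorem posFunctional_star_mul_conj {A : Type*} [NonUnitalCStarAlgebra A] (f : PosFunctional A)
    (a b : A) :
    f (star a * b) = starRingEnd ℂ (f (star b * a)) := by
  rw [← inner_gnsVec, ← inner_gnsVec, inner_conj_symm]

theorem norm_state_apply_le {f : PosFunctional C} (hf : f 1 = 1) (a : C) : ‖f a‖ ≤ ‖a‖ := by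
  have h1 := norm_apply_sq_le f 1 a
  rw [star_one, one_mul, one_mul, hf, Complex.one_re, one_mul] at h1
  have h2 : f (star a * a) ≤ f (algebraMap ℝ C (‖a‖ ^ 2)) :=
    f.monotone' CStarAlgebra.star_mul_le_algebraMap_norm_sq
  have h3 : f (algebraMap ℝ C (‖a‖ ^ 2)) = ((‖a‖ ^ 2 : ℝ) : ℂ) := by
    rw [IsScalarTower.algebraMap_apply ℝ ℂ C, Algebra.algebraMap_eq_smul_one, map_smul, hf,
      smul_eq_mul, mul_one]
    rfl
  rw [h3] at h2
  have h4 := (Complex.le_def.1 h2).1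
  rw [Complex.ofReal_re] at h4
  exact abs_le_of_sq_le_sq' (h1.trans h4) (norm_nonneg _) |>.2

/-- Every compression `f(e⋆ · e)` is again positive, and polarization recovers all coefficients from
these. -/
theorem eq_of_posFunctional {x y : C} (h : ∀ f : PosFunctional C, f x = f y) : x = y := by
  refine eq_of_coeff fun f c d => ?_
  have key : ∀ e, f (star e * (x * e)) = f (star e * (y * e)) := fun e =>
    h (posOfStar (coeff f e e).1 fun a => by
      rw [coeff_apply, ← mul_assoc, ← mul_assoc, ← star_mul, mul_assoc]
      exact posFunctional_star_mul_self f _)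
  have h1 := polarization f (LinearMap.mulLeft ℂ x) c d
  have h2 := polarization f (LinearMap.mulLeft ℂ y) c d
  simp only [LinearMap.mulLeft_apply] at h1 h2
  rw [coeff_apply, coeff_apply, h1, h2]
  simp only [key]

theorem exists_state [Nontrivial C] : ∃ f : PosFunctional C, f 1 = 1 := by
  obtain ⟨s, h0, h1, -⟩ := exists_state_apply_eq_norm (p := (1 : C)) zero_le_one one_ne_zero
  exact ⟨posOfStar s h0, h1⟩

/-- Weak-* compactness of the state space. -/
theorem exists_state_tendsto {I : Type*} (U : Ultrafilter I) (f : I → PosFunctional C)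
    (hf : ∀ i, f i 1 = 1) : ∃ h : PosFunctional C, h 1 = 1 ∧
      ∀ a, Filter.Tendsto (fun i => f i a) U (nhds (h a)) := by
  -- The values at `a` stay in the compact disc of radius `‖a‖`, so they converge along the
  -- ultrafilter.
  have hlim : ∀ a, ∃ z : ℂ, ‖z‖ ≤ ‖a‖ ∧ Filter.Tendsto (fun i => f i a) U (nhds z) := by
    intro a
    obtain ⟨z, hz, h⟩ := (isCompact_closedBall (0 : ℂ) ‖a‖).ultrafilter_le_nhds
      (U.map fun i => f i a) (by
        rw [Filter.le_principal_iff]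
        exact Filter.mem_map.2 <| Filter.univ_mem' fun i =>
          mem_closedBall_zero_iff.2 (norm_state_apply_le (hf i) a))
    exact ⟨z, by simpa using hz, h⟩
  choose h hb hl using hlim
  let L : C →L[ℂ] ℂ := LinearMap.mkContinuous
    { toFun := h
      map_add' := fun a b => tendsto_nhds_unique (hl (a + b)) (by
        simpa only [map_add] using (hl a).add (hl b))
      map_smul' := fun c a => tendsto_nhds_unique (hl (c • a)) (by
        simpa only [map_smul, RingHom.id_apply] using (hl a).const_smul c) } 1
    fun a => by rw [one_mul]; exact hb a
  have hpos : ∀ a, 0 ≤ L (star a * a) := fun a =>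
    ge_of_tendsto' (hl (star a * a)) fun i => posFunctional_star_mul_self (f i) a
  exact ⟨posOfStar L hpos, tendsto_nhds_unique (hl 1) (by simp [hf]), hl⟩

variable {D : Type*} [CStarAlgebra D]

/-- The product of two positive functionals. -/
def posProd (f : PosFunctional C) (g : PosFunctional D) : PosFunctional (C ⊗ₘ D) :=
  posOfStar (tensorVec f g (hvec (gnsVec f 1) (gnsVec g 1)) (hvec (gnsVec f 1) (gnsVec g 1)))
    fun z => by
      rw [tensorVec_apply, map_mul, map_star]
      change 0 ≤ inner ℂ _ (ContinuousLinearMap.adjoint (tensorRep f g z)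
        (tensorRep f g z (hvec (gnsVec f 1) (gnsVec g 1))))
      rw [ContinuousLinearMap.adjoint_inner_right, inner_self_eq_norm_sq_to_K]
      positivity

theorem posProd_eq_lslice (f : PosFunctional C) (g : PosFunctional D) (z : C ⊗ₘ D) :
    posProd f g z = g (lslice D (posSlice f) z) := by
  have h := inner_gnsRep_lslice_coeff f 1 1 g (gnsVec g 1) (gnsVec g 1) z
  rw [gnsRep_gnsVec, inner_gnsVec, star_one, one_mul, mul_one] at h
  exact h.symm

theorem posProd_eq_rslice (f : PosFunctional C) (g : PosFunctional D) (z : C ⊗ₘ D) :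
    posProd f g z = f (rslice C (posSlice g) z) := by
  rw [posProd_eq_lslice, ← posSlice_apply f, apply_rslice, posSlice_apply]

end States

/-! ### Module properties of slices, and coactions. -/

section Slices

variable {A C : Type*} [NonUnitalCStarAlgebra A] [CStarAlgebra C]

theorem rslice_mul_tmul_one (G : sliceable C) (z : A ⊗ₘ C) (a : A) :
    rslice A G (z * tmul a 1) = rslice A G z * a :=
  congrArg (fun L => L z) (tensor_ext_clm
    (S := (rslice A G).comp ((ContinuousLinearMap.mul ℂ (A ⊗ₘ C)).flip (tmul a 1)))
    (T := ((ContinuousLinearMap.mul ℂ A).flip a).comp (rslice A G)) fun b c => by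
      change rslice A G (tmul b c * tmul a 1) = rslice A G (tmul b c) * a
      rw [tmul_mul_tmul, mul_one, rslice_tmul, rslice_tmul, smul_mul_assoc])

theorem rslice_tmul_one_mul (G : sliceable C) (z : A ⊗ₘ C) (a : A) :
    rslice A G (tmul a 1 * z) = a * rslice A G z :=
  congrArg (fun L => L z) (tensor_ext_clm
    (S := (rslice A G).comp (ContinuousLinearMap.mul ℂ (A ⊗ₘ C) (tmul a 1)))
    (T := (ContinuousLinearMap.mul ℂ A a).comp (rslice A G)) fun b c => by
      change rslice A G (tmul a 1 * tmul b c) = a * rslice A G (tmul b c)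
      rw [tmul_mul_tmul, one_mul, rslice_tmul, rslice_tmul, mul_smul_comm])

variable {X Y Z : Type*} [NonUnitalCStarAlgebra X] [NonUnitalCStarAlgebra Y]
  [NonUnitalCStarAlgebra Z]

theorem rslice_assocInv_tmul (G : sliceable Z) (x : X) (w : Y ⊗ₘ Z) :
    rslice (X ⊗ₘ Y) G (assocInv X Y Z (tmul x w)) = tmul x (rslice Y G w) :=
  congrArg (fun L => L w) (tensor_ext_clm
    (S := (rslice (X ⊗ₘ Y) G).comp ((homL (assocInv X Y Z)).comp (tmulL X (Y ⊗ₘ Z) x)))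
    (T := (tmulL X Y x).comp (rslice Y G)) fun y z => by
      change rslice (X ⊗ₘ Y) G (assocInv X Y Z (tmul x (tmul y z))) = tmul x (rslice Y G (tmul y z))
      rw [assocInv_tmul, rslice_tmul, rslice_tmul, tmul_smul_right])

/-- `θ : X → X ⊗ C` satisfies `(θ ⊗ id)θ = (id ⊗ δ)θ`. -/
def IsCoaction (δ : C →⋆ₙₐ[ℂ] C ⊗ₘ C) (θ : X →⋆ₙₐ[ℂ] X ⊗ₘ C) : Prop :=
  ∀ x, assoc X C C (tmap θ (NonUnitalStarAlgHom.id ℂ C) (θ x)) =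
    tmap (NonUnitalStarAlgHom.id ℂ X) δ (θ x)

theorem IsCoaction.map_rslice {δ : C →⋆ₙₐ[ℂ] C ⊗ₘ C} {θ : X →⋆ₙₐ[ℂ] X ⊗ₘ C} (hθ : IsCoaction δ θ)
    (G : sliceable C) (x : X) : θ (rslice X G (θ x)) =
      rslice (X ⊗ₘ C) G (assocInv X C C (tmap (NonUnitalStarAlgHom.id ℂ X) δ (θ x))) := by
  rw [PodlesQuotient.map_rslice, ← hθ x, assocInv_assoc]

end Slices

/-! ### Convolution and the Haar state. -/

section Convolution

attribute [local instance] CStarAlgebra.spectralOrder CStarAlgebra.spectralOrderedRing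

variable {C : Type*} [CStarAlgebra C] (δ : C →⋆ₙₐ[ℂ] C ⊗ₘ C)

/-- The convolution of two positive functionals. -/
def conv (f g : PosFunctional C) : PosFunctional C :=
  posOfStar ((tensorVec f g (hvec (gnsVec f 1) (gnsVec g 1))
    (hvec (gnsVec f 1) (gnsVec g 1))).comp (homL δ)) fun a => by
      change 0 ≤ posProd f g (δ (star a * a))
      rw [map_mul, map_star]
      exact posFunctional_star_mul_self _ _

variable {δ}

theorem conv_eq_rslice (f g : PosFunctional C) (a : C) :
    conv δ f g a = f (rslice C (posSlice g) (δ a)) := posProd_eq_rslice f g (δ a)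

theorem conv_eq_lslice (f g : PosFunctional C) (a : C) :
    conv δ f g a = g (lslice C (posSlice f) (δ a)) := posProd_eq_lslice f g (δ a)

theorem IsCoaction.rslice_map_rslice {X : Type*} [NonUnitalCStarAlgebra X] {θ : X →⋆ₙₐ[ℂ] X ⊗ₘ C}
    (hθ : IsCoaction δ θ) (f g : PosFunctional C) (x : X) :
    rslice X (posSlice f) (θ (rslice X (posSlice g) (θ x))) =
      rslice X (posSlice (conv δ f g)) (θ x) := by
  rw [hθ.map_rslice]
  refine congrArg (fun L => L (θ x)) (tensor_ext_clm
    (S := (rslice X (posSlice f)).comp ((rslice (X ⊗ₘ C) (posSlice g)).comp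
      ((homL (assocInv X C C)).comp (homL (tmap (NonUnitalStarAlgHom.id ℂ X) δ)))))
    (T := rslice X (posSlice (conv δ f g))) fun y c => ?_)
  change rslice X (posSlice f) (rslice (X ⊗ₘ C) (posSlice g)
    (assocInv X C C (tmap (NonUnitalStarAlgHom.id ℂ X) δ (tmul y c)))) = _
  rw [tmap_tmul, rslice_assocInv_tmul, rslice_tmul, rslice_tmul, posSlice_apply, posSlice_apply,
    conv_eq_rslice]
  rfl

theorem conv_assoc (hδ : IsCoaction δ δ) (f g k : PosFunctional C) (a : C) :
    conv δ (conv δ f g) k a = conv δ f (conv δ g k) a := by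
  rw [conv_eq_rslice, conv_eq_rslice, conv_eq_rslice, hδ.rslice_map_rslice]

theorem conv_one (h1 : δ 1 = tmul 1 1) (f g : PosFunctional C) : conv δ f g 1 = f 1 * g 1 := by
  rw [conv_eq_rslice, h1, rslice_tmul, map_smul, posSlice_apply, smul_eq_mul, mul_comm]

/-- The averages of a sequence of states. -/
def cesaro (p : ℕ → PosFunctional C) (n : ℕ) : PosFunctional C :=
  posOfStar (((n + 1 : ℝ) : ℂ)⁻¹ • ∑ k ∈ Finset.range (n + 1), (posSlice (p k)).1) fun a => by
    rw [smul_apply, sum_apply, smul_eq_mul]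
    refine mul_nonneg ?_ (Finset.sum_nonneg fun k _ => ?_)
    · rw [inv_nonneg]
      exact Complex.zero_le_real.2 (by positivity)
    · rw [posSlice_apply]; exact posFunctional_star_mul_self _ _

theorem cesaro_apply (p : ℕ → PosFunctional C) (n : ℕ) (a : C) :
    cesaro p n a = ((n + 1 : ℝ) : ℂ)⁻¹ * ∑ k ∈ Finset.range (n + 1), p k a := by
  rw [cesaro, posOfStar_apply, smul_apply, sum_apply, smul_eq_mul]
  simp only [posSlice_apply]

theorem exists_invariant_state (hδ : IsCoaction δ δ) (h1 : δ 1 = tmul 1 1) {ω : PosFunctional C}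
    (hω : ω 1 = 1) : ∃ h : PosFunctional C, h 1 = 1 ∧ (∀ a, conv δ h ω a = h a) ∧
      ∀ a, conv δ ω h a = h a := by
  -- Here `p n` is the convolution power `ω^{*(n+1)}`. It is built by multiplying by `ω` on the
  -- right; `hp'` gives the recursion on the left, needed for the other invariance.
  obtain ⟨p, hp0, hp⟩ : ∃ p : ℕ → PosFunctional C, p 0 = ω ∧ ∀ n, p (n + 1) = conv δ (p n) ω :=
    ⟨fun n => Nat.rec ω (fun _ f => conv δ f ω) n, rfl, fun _ => rfl⟩
  have hp' : ∀ n a, p (n + 1) a = conv δ ω (p n) a := by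
    intro n
    induction n with
    | zero => intro a; rw [hp, hp0]
    | succ n ih =>
      intro a
      rw [hp (n + 1), conv_eq_rslice, ih, hp n, ← conv_eq_rslice, conv_assoc hδ]
  have hp1 : ∀ n, p n 1 = 1 := by
    intro n
    induction n with
    | zero => rw [hp0, hω]
    | succ n ih => rw [hp, conv_one h1, ih, hω, one_mul]
  have hn0 : ∀ n : ℕ, (((n + 1 : ℝ) : ℂ)) ≠ 0 := fun n => by
    rw [Complex.ofReal_ne_zero]; positivity
  obtain ⟨h, hh1, hlim⟩ := exists_state_tendsto (Filter.hyperfilter ℕ) (cesaro p) fun n => by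
    rw [cesaro_apply, Finset.sum_congr rfl fun k _ => hp1 k, Finset.sum_const, Finset.card_range,
      nsmul_one]
    have := hn0 n
    push_cast at this ⊢
    exact inv_mul_cancel₀ this
  -- The difference of the two averages telescopes to `(p (n + 1) a - p 0 a)/(n + 1)`, which tends
  -- to `0`.
  have key : ∀ a b, (∀ n, p n b = p (n + 1) a) → h b = h a := by
    intro a b hab
    have hd : ∀ n, cesaro p n b - cesaro p n a =
        ((n + 1 : ℝ) : ℂ)⁻¹ * (p (n + 1) a - p 0 a) := fun n => by
      rw [cesaro_apply, cesaro_apply, ← mul_sub, ← Finset.sum_sub_distrib]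
      simp only [hab]
      rw [Finset.sum_range_sub fun n => p n a]
    have h0 : Filter.Tendsto (fun n => cesaro p n b - cesaro p n a) (Filter.hyperfilter ℕ)
        (nhds 0) := by
      refine Filter.Tendsto.mono_left ?_ (Nat.hyperfilter_le_atTop)
      refine squeeze_zero_norm (a := fun n : ℕ => (1 / ((n : ℝ) + 1)) * (2 * ‖a‖)) (fun n => ?_) ?_
      · rw [hd, norm_mul, norm_inv, Complex.norm_real, Real.norm_of_nonneg (by positivity),
          one_div]
        gcongr
        refine (norm_sub_le _ _).trans ?_
        have := norm_state_apply_le (hp1 (n + 1)) a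
        have := norm_state_apply_le (hp1 0) a
        linarith
      · simpa using tendsto_one_div_add_atTop_nhds_zero_nat.mul_const (2 * ‖a‖)
    exact sub_eq_zero.1 (tendsto_nhds_unique ((hlim b).sub (hlim a)) h0)
  refine ⟨h, hh1, fun a => ?_, fun a => ?_⟩
  · rw [conv_eq_rslice]
    exact key a _ fun n => by rw [hp, conv_eq_rslice]
  · rw [conv_eq_lslice]
    exact key a _ fun n => by rw [hp', conv_eq_lslice]

/-- Invariance under `ω` passes to every positive `ρ` dominated by a multiple of `ω`. For `b = (id ⊗
h)δ(a)`, invariance gives `(id ⊗ ω)δ(b) = b`, and then `(h ⊗ ω)` annihilates `|δ(b) - b ⊗ 1|²`.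
Domination transfers this to `h ⊗ ρ`; Cauchy–Schwarz and density finish. -/
theorem conv_eq_of_le (hδ : IsCoaction δ δ)
    (hd : Dense (Submodule.span ℂ {z : C ⊗ₘ C | ∃ a a', z = tmul a 1 * δ a'} : Set (C ⊗ₘ C)))
    {h ω : PosFunctional C} (hh : h 1 = 1) (hω : ω 1 = 1) (hl : ∀ a, conv δ h ω a = h a)
    (hr : ∀ a, conv δ ω h a = h a) {ρ σ : PosFunctional C} {t : ℂ}
    (hρ : ∀ a, ρ a + σ a = t * ω a) (a : C) : conv δ ρ h a = ρ 1 * h a := by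
  have hr' : posSlice (conv δ ω h) = posSlice h := by
    refine Subtype.ext (ContinuousLinearMap.ext fun a => ?_)
    rw [posSlice_apply, posSlice_apply, hr]
  have h0 : ∀ (b : C), rslice C (posSlice ω) (δ b) = b →
      posProd h ρ (star (δ b - tmul b 1) * (δ b - tmul b 1)) = 0 := by
    intro b hb
    have hωx : posProd h ω (star (δ b - tmul b 1) * (δ b - tmul b 1)) = 0 := by
      have e1 : posProd h ω (star (δ b) * δ b) = h (star b * b) := by
        rw [← map_star, ← map_mul, posProd_eq_rslice, ← conv_eq_rslice, hl]
      have e2 : posProd h ω (star (tmul b (1 : C)) * δ b) = h (star b * b) := by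
        rw [star_tmul, star_one, posProd_eq_rslice, rslice_tmul_one_mul, hb]
      have e3 : posProd h ω (star (tmul b (1 : C)) * tmul b 1) = h (star b * b) := by
        rw [star_tmul, star_one, posProd_eq_rslice, rslice_tmul_one_mul, rslice_tmul,
          posSlice_apply, hω, one_smul]
      have e4 : posProd h ω (star (δ b) * tmul b 1) = h (star b * b) := by
        rw [posFunctional_star_mul_conj (posProd h ω), e2, ← posFunctional_star_mul_conj h b b]
      rw [star_sub, sub_mul, mul_sub, mul_sub, map_sub, map_sub, map_sub, e1, e2, e3, e4]
      ring
    have hsum := hρ (lslice C (posSlice h) (star (δ b - tmul b 1) * (δ b - tmul b 1)))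
    rw [← posProd_eq_lslice, ← posProd_eq_lslice, ← posProd_eq_lslice, hωx, mul_zero] at hsum
    have p1 := posFunctional_star_mul_self (posProd h ρ) (δ b - tmul b 1)
    have p2 := posFunctional_star_mul_self (posProd h σ) (δ b - tmul b 1)
    exact ((add_eq_zero_iff_of_nonneg p1 p2).1 hsum).1
  -- Cauchy–Schwarz against `c⋆ ⊗ 1` replaces `δ(b)` by `b ⊗ 1` under `h ⊗ ρ`, where `b = (id ⊗
  -- h)δ(a)`.
  have h2 : ∀ c a, h (c * rslice C (posSlice (conv δ ρ h)) (δ a)) =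
      ρ 1 * h (c * rslice C (posSlice h) (δ a)) := by
    intro c a
    have hb : rslice C (posSlice ω) (δ (rslice C (posSlice h) (δ a))) =
        rslice C (posSlice h) (δ a) := by rw [hδ.rslice_map_rslice, hr']
    have hz := norm_apply_sq_le (posProd h ρ) (tmul (star c) 1)
      (δ (rslice C (posSlice h) (δ a)) - tmul (rslice C (posSlice h) (δ a)) 1)
    rw [h0 _ hb, Complex.zero_re, mul_zero, star_tmul, star_star, star_one, mul_sub, map_sub,
      posProd_eq_rslice, posProd_eq_rslice, rslice_tmul_one_mul, rslice_tmul_one_mul,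
      hδ.rslice_map_rslice, rslice_tmul, posSlice_apply, mul_smul_comm, map_smul, smul_eq_mul] at hz
    exact sub_eq_zero.1 (norm_eq_zero.1 (pow_eq_zero_iff two_ne_zero |>.1
      (le_antisymm hz (sq_nonneg _))))
  -- The identity `h2` says that `h ⊗ (ρ * h)` and `ρ(1)(h ⊗ h)` agree on `(c ⊗ 1)δ(a)`; by density
  -- they agree everywhere, in particular at `1 ⊗ a`.
  have h3 : ∀ z, (posSlice h).1 (rslice C (posSlice (conv δ ρ h)) z) =
      ρ 1 * (posSlice h).1 (rslice C (posSlice h) z) := by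
    have hS : IsClosed (LinearMap.eqLocus
        ((posSlice h).1.comp (rslice C (posSlice (conv δ ρ h)))).toLinearMap
        (ρ 1 • (posSlice h).1.comp (rslice C (posSlice h))).toLinearMap : Set (C ⊗ₘ C)) :=
      isClosed_eq (ContinuousLinearMap.continuous _) (ContinuousLinearMap.continuous _)
    refine fun z => hS.closure_subset_iff.2 (Submodule.span_le.2 ?_) (hd z)
    rintro _ ⟨c, a, rfl⟩
    change (posSlice h).1 (rslice C (posSlice (conv δ ρ h)) (tmul c 1 * δ a)) =
      ρ 1 • (posSlice h).1 (rslice C (posSlice h) (tmul c 1 * δ a))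
    rw [posSlice_apply, posSlice_apply, rslice_tmul_one_mul, rslice_tmul_one_mul, h2, smul_eq_mul]
  have h4 := h3 (tmul 1 a)
  rw [rslice_tmul, rslice_tmul, posSlice_apply, posSlice_apply, map_smul, map_smul, posSlice_apply,
    posSlice_apply, hh, smul_eq_mul, smul_eq_mul, mul_one, mul_one] at h4
  exact h4

/-- Existence of the Haar state. -/
theorem exists_haar [Nontrivial C] (hδ : IsCoaction δ δ) (h1 : δ 1 = tmul 1 1)
    (hd : Dense (Submodule.span ℂ {z : C ⊗ₘ C | ∃ a a', z = tmul a 1 * δ a'} : Set (C ⊗ₘ C))) :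
    ∃ h : PosFunctional C, h 1 = 1 ∧ ∀ a, rslice C (posSlice h) (δ a) = h a • (1 : C) := by
  classical
  obtain ⟨ω₀, hω₀⟩ := exists_state (C := C)
  -- The sum over `s` dominates each member of `s`; the state `ω₀` is added so that it can be
  -- normalized even when `s` is empty or has only zero functionals.
  let P : Finset (PosFunctional C) → PosFunctional C := fun s =>
    posOfStar ((posSlice ω₀).1 + ∑ ρ ∈ s, (posSlice ρ).1) fun a => by
      rw [add_apply, sum_apply]
      refine add_nonneg ?_ (Finset.sum_nonneg fun ρ _ => ?_) <;> rw [posSlice_apply] <;>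
        exact posFunctional_star_mul_self _ _
  have hP : ∀ s a, P s a = ω₀ a + ∑ ρ ∈ s, ρ a := fun s a => by
    change ((posSlice ω₀).1 + ∑ ρ ∈ s, (posSlice ρ).1) a = _
    rw [add_apply, sum_apply]
    simp only [posSlice_apply]
  have hP1 : ∀ s, 0 < P s 1 := fun s => by
    rw [hP, hω₀]
    exact add_pos_of_pos_of_nonneg one_pos
      (Finset.sum_nonneg fun ρ _ => posFunctional_apply_one_nonneg ρ)
  have hQ : ∀ s, ∃ ω : PosFunctional C, ∀ a, ω a = (P s 1)⁻¹ * P s a := fun s =>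
    ⟨posOfStar ((P s 1)⁻¹ • (posSlice (P s)).1) fun a => by
      rw [smul_apply, posSlice_apply, smul_eq_mul]
      exact mul_nonneg (inv_nonneg.2 (hP1 s).le) (posFunctional_star_mul_self _ _), fun a => by
      rw [posOfStar_apply, smul_apply, posSlice_apply, smul_eq_mul]⟩
  choose ω hω using hQ
  have hω1 : ∀ s, ω s 1 = 1 := fun s => by rw [hω, inv_mul_cancel₀ (hP1 s).ne']
  choose h hh1 hl hr using fun s => exists_invariant_state hδ h1 (hω1 s)
  have hs : ∀ s, ∀ ρ ∈ s, ∀ a, conv δ ρ (h s) a = ρ 1 * h s a := fun s ρ hρ a =>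
    conv_eq_of_le hδ hd (hh1 s) (hω1 s) (hl s) (hr s) (σ := P (s.erase ρ)) (t := P s 1)
      (fun a => by
        rw [hω, mul_inv_cancel_left₀ (hP1 s).ne', hP, hP, ← Finset.add_sum_erase s _ hρ]
        ring) a
  obtain ⟨k, hk1, hk⟩ := exists_state_tendsto (Ultrafilter.of Filter.atTop) h hh1
  refine ⟨k, hk1, fun a => eq_of_posFunctional fun ρ => ?_⟩
  rw [← conv_eq_rslice, map_smul, smul_eq_mul, mul_comm, conv_eq_lslice]
  -- The ultrafilter refines the upward filter on finite sets, so eventually `ρ ∈ s`. The limit thus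
  -- satisfies `ρ * k = ρ(1)k` for every positive `ρ`.
  have hev : ∀ᶠ s in (Ultrafilter.of Filter.atTop : Ultrafilter (Finset (PosFunctional C))),
      h s (lslice C (posSlice ρ) (δ a)) = ρ 1 * h s a := by
    refine Ultrafilter.of_le _ ((Filter.eventually_ge_atTop {ρ}).mono fun s hρ => ?_)
    rw [← conv_eq_lslice]
    exact hs s ρ (Finset.singleton_subset_iff.1 hρ) a
  exact tendsto_nhds_unique ((hk _).congr' hev) ((hk a).const_mul (ρ 1))

end Convolution

/-! ### Approximate units, fixed points and the density conditions. -/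

section Multipliers

variable {X Y Z : Type*} [NonUnitalCStarAlgebra X] [NonUnitalCStarAlgebra Y]
  [NonUnitalCStarAlgebra Z]

theorem mulExt_comp_emb_comp {φ : X →⋆ₙₐ[ℂ] 𝓜(ℂ, Y)} (hφ : Nondegenerate φ) (ι : Z →⋆ₙₐ[ℂ] X) :
    (mulExt φ).comp ((emb X).comp ι) = φ.comp ι :=
  DFunLike.ext _ _ fun _ => mulExt_emb hφ _

theorem emb_one (C : Type*) [CStarAlgebra C] : emb C 1 = 1 :=
  multiplier_ext fun c => one_mul c

theorem multiplier_eq_emb {e : X} (he : ∀ x, e * x = x) (T : 𝓜(ℂ, X)) : T = emb X (T.fst e) :=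
  multiplier_ext fun x => by rw [emb_fst, ← fst_mul, he]

/-- A closed subspace of `X` is everything if it contains a set which spans a subspace of the
multiplier algebra with closure `X`. -/
theorem induction_of_closure_span {s : Set 𝓜(ℂ, X)}
    (hs : closure (Submodule.span ℂ s : Set 𝓜(ℂ, X)) = Set.range (emb X)) {S : Submodule ℂ X}
    (hS : IsClosed (S : Set X)) (h : ∀ x, emb X x ∈ s → x ∈ S) (x : X) : x ∈ S := by
  have hcl : IsClosed (S.map (homL (emb X)).toLinearMap : Set 𝓜(ℂ, X)) :=
    (NonUnitalStarAlgHom.isometry (emb X) emb_injective).isClosedEmbedding.isClosedMap _ hS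
  have hle : Submodule.span ℂ s ≤ S.map (homL (emb X)).toLinearMap :=
      Submodule.span_le.2 fun T hT => by
        obtain ⟨y, rfl⟩ : T ∈ Set.range (emb X) := hs ▸ subset_closure (Submodule.subset_span hT)
        exact ⟨y, h y hT, rfl⟩
  obtain ⟨y, hy, hyx⟩ := hcl.closure_subset_iff.2 hle (hs ▸ ⟨x, rfl⟩ : emb X x ∈ closure _)
  exact emb_injective hyx ▸ hy

section

attribute [local instance] CStarAlgebra.spectralOrder CStarAlgebra.spectralOrderedRing

/-- The operators `φ(u)` are eventually contractions, so the set of good `y` is a closed subspace;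
it contains `φ(X)Y`. -/
theorem tendsto_approximateUnit_fst {φ : X →⋆ₙₐ[ℂ] 𝓜(ℂ, Y)} (hφ : Nondegenerate φ) (y : Y) :
    Filter.Tendsto (fun u => (φ u).fst y) (CStarAlgebra.approximateUnit X) (nhds y) := by
  have hu := CStarAlgebra.increasingApproximateUnit X
  let S : Submodule ℂ Y :=
    { carrier := {y | Filter.Tendsto (fun u => (φ u).fst y)
        (CStarAlgebra.approximateUnit X) (nhds y)}
      add_mem' := fun {y z} hy hz => by
        simpa only [Set.mem_ofPred_eq, map_add] using Filter.Tendsto.add hy hz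
      zero_mem' := by simp only [Set.mem_ofPred_eq, map_zero]; exact tendsto_const_nhds
      smul_mem' := fun c y hy => by
        simpa only [Set.mem_ofPred_eq, map_smul] using Filter.Tendsto.const_smul hy c }
  refine nondegenerate_induction hφ (S := S) ?_ (fun x y => ?_) y
  · refine isClosed_of_closure_subset fun y hy => Metric.tendsto_nhds.2 fun r hr => ?_
    obtain ⟨z, hz, hyz⟩ := Metric.mem_closure_iff.1 hy (r / 3) (by positivity)
    filter_upwards [Metric.tendsto_nhds.1 hz (r / 3) (by positivity),
      hu.eventually_norm] with u h1 h2
    have h3 : dist ((φ u).fst y) ((φ u).fst z) ≤ dist y z := by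
      rw [dist_eq_norm, dist_eq_norm, ← map_sub]
      refine ((φ u).fst.le_opNorm _).trans (mul_le_of_le_one_left (norm_nonneg _) ?_)
      rw [DoubleCentralizer.norm_fst]
      exact (NonUnitalStarAlgHom.norm_apply_le φ u).trans h2
    have h4 := dist_triangle4 ((φ u).fst y) ((φ u).fst z) z y
    rw [dist_comm z y] at h4
    linarith
  · have h := (((evL y).comp (homL φ)).continuous.tendsto x).comp (hu.tendsto_mul_right x)
    refine h.congr fun u => ?_
    change (φ (u * x)).fst y = _
    rw [map_mul]; rfl

end

end Multipliers

section Fixed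

variable {A C : Type*} [NonUnitalCStarAlgebra A] [CStarAlgebra C]

/-- The fixed points of a *-homomorphism `δ : A → A ⊗ C`. -/
def fixedPoints (δ : A →⋆ₙₐ[ℂ] A ⊗ₘ C) : NonUnitalStarSubalgebra ℂ A where
  carrier := {x | δ x = tmul x 1}
  add_mem' {x y} hx hy := by
    rw [Set.mem_ofPred_eq] at *
    rw [map_add, hx, hy, tmul_add_left]
  zero_mem' := by rw [Set.mem_ofPred_eq, map_zero, tmul_zero_left]
  mul_mem' {x y} hx hy := by
    rw [Set.mem_ofPred_eq] at *
    rw [map_mul, hx, hy, tmul_mul_tmul, one_mul]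
  smul_mem' c x hx := by
    rw [Set.mem_ofPred_eq] at *
    rw [map_smul, hx, tmul_smul_left]
  star_mem' {x} hx := by
    rw [Set.mem_ofPred_eq] at *
    rw [map_star, hx, star_tmul, star_one]

theorem isClosed_fixedPoints (δ : A →⋆ₙₐ[ℂ] A ⊗ₘ C) : IsClosed (fixedPoints δ : Set A) :=
  isClosed_eq (continuous_hom δ) ((tmulL A C).flip 1).continuous

end Fixed

section Hopf

variable {A : Type*} [NonUnitalCStarAlgebra A] {Δ : Mor A (A ⊗ₘ A)}

theorem IsBisimplifiableHopf.induction_left (hΔ : IsBisimplifiableHopf Δ)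
    {S : Submodule ℂ (A ⊗ₘ A)} (hS : IsClosed (S : Set (A ⊗ₘ A)))
    (h : ∀ x a w, emb _ w = mulTensor (emb A x) 1 * Δ.hom a → w ∈ S) (z : A ⊗ₘ A) : z ∈ S :=
  induction_of_closure_span hΔ.closure_left hS (fun w ⟨x, a, hw⟩ => h x a w hw) z

theorem IsBisimplifiableHopf.exists_left (hΔ : IsBisimplifiableHopf Δ) (x a : A) :
    ∃ w, emb _ w = mulTensor (emb A x) 1 * Δ.hom a := by
  have : mulTensor (emb A x) 1 * Δ.hom a ∈ Set.range (emb (A ⊗ₘ A)) :=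
    hΔ.closure_left ▸ subset_closure (Submodule.subset_span ⟨x, a, rfl⟩)
  exact this

theorem IsBisimplifiableHopf.exists_right (hΔ : IsBisimplifiableHopf Δ) (a x : A) :
    ∃ w, emb _ w = Δ.hom a * mulTensor 1 (emb A x) := by
  have : Δ.hom a * mulTensor 1 (emb A x) ∈ Set.range (emb (A ⊗ₘ A)) :=
    hΔ.closure_right ▸ subset_closure (Submodule.subset_span ⟨a, x, rfl⟩)
  exact this

end Hopf

section Compact

variable {C : Type*} [CStarAlgebra C] {ΔC : Mor C (C ⊗ₘ C)}

theorem emb_tmul_one {A : Type*} [NonUnitalCStarAlgebra A] (a : A) :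
    emb (A ⊗ₘ C) (tmul a 1) = mulTensor (emb A a) 1 := by
  rw [← mulTensor_emb, emb_one]

variable (ΔC) in
theorem exists_comul : ∃ δ : C →⋆ₙₐ[ℂ] C ⊗ₘ C, (emb _).comp δ = ΔC.hom := by
  obtain ⟨δ, hδ⟩ := exists_factor (emb (C ⊗ₘ C)) emb_injective ΔC.hom fun c =>
    ⟨_, (multiplier_eq_emb (e := tmul 1 1) (fun z => congrArg (fun L => L z) (tensor_ext_clm
      (S := ContinuousLinearMap.mul ℂ (C ⊗ₘ C) (tmul 1 1)) (T := ContinuousLinearMap.id ℂ _)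
        fun a b => by
          change tmul 1 1 * tmul a b = tmul a b
          rw [tmul_mul_tmul, one_mul, one_mul])) _).symm⟩
  exact ⟨δ, DFunLike.ext _ _ hδ⟩

theorem exists_haar_of_compact [Nontrivial C] (hΔC : IsCompactQuantumGroup ΔC)
    {δ : C →⋆ₙₐ[ℂ] C ⊗ₘ C} (hδ : (emb _).comp δ = ΔC.hom) :
    ∃ (h : sliceable C), h.1 1 = 1 ∧ ∀ a, rslice C h (δ a) = h.1 a • (1 : C) := by
  have hδ' : ∀ c, emb _ (δ c) = ΔC.hom c := fun c => congrArg (fun φ => φ c) hδ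
  have hco : IsCoaction δ δ := fun c => emb_injective (by
    have := hΔC.coassoc c
    rw [← hδ, NonUnitalStarAlgHom.comp_apply,
      extTensor_emb (hδ ▸ ΔC.nondegenerate) nondegenerate_emb,
      extTensor_emb nondegenerate_emb (hδ ▸ ΔC.nondegenerate)] at this
    have h1 := homTensor_emb_comp δ (NonUnitalStarAlgHom.id ℂ C)
    have h2 := homTensor_emb_comp (NonUnitalStarAlgHom.id ℂ C) δ
    rw [NonUnitalStarAlgHom.comp_id] at h1 h2
    rw [h1, h2, NonUnitalStarAlgHom.comp_apply, extAssoc_emb] at this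
    exact this)
  have h1 : δ 1 = tmul 1 1 := emb_injective (by
    rw [hδ', ← mulExt_emb ΔC.nondegenerate, emb_one, mulExt_one ΔC.nondegenerate, ← mulTensor_emb,
      emb_one, mulTensor_one])
  obtain ⟨h, hh, hR⟩ := exists_haar hco h1 fun z => by
    refine IsBisimplifiableHopf.induction_left hΔC (S := (Submodule.span ℂ
      {z : C ⊗ₘ C | ∃ a a', z = tmul a 1 * δ a'}).topologicalClosure)
      (Submodule.isClosed_topologicalClosure _) (fun x a w hw => ?_) z
    rw [← emb_tmul_one, ← hδ', ← map_mul] at hw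
    rw [emb_injective hw]
    exact Submodule.le_topologicalClosure _ (Submodule.subset_span ⟨x, a, rfl⟩)
  exact ⟨posSlice h, by rw [posSlice_apply, hh], fun a => by rw [hR, posSlice_apply]⟩

end Compact

/-! ### Averaging over the quantum subgroup. -/

section Expectation

variable {A C : Type*} [NonUnitalCStarAlgebra A] [CStarAlgebra C] {Δ : Mor A (A ⊗ₘ A)}
  {ΔC : Mor C (C ⊗ₘ C)} {π : A →⋆ₙₐ[ℂ] C}

/-- The coaction of the quantum subgroup `C` on `A`. -/
theorem exists_right_coaction (hΔ : IsBisimplifiableHopf Δ) (hπ : Function.Surjective π) :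
    ∃ δ : A →⋆ₙₐ[ℂ] A ⊗ₘ C,
      (emb _).comp δ = (extTensor (emb A) ((emb C).comp π)).comp Δ.hom := by
  have hπ' := nondegenerate_emb_comp_of_surjective hπ
  -- With `π(u) = 1`, applying `id ⊗ π` to `Δ(a)(1 ⊗ u) ∈ A ⊗ A` leaves `(id ⊗ π)Δ(a)` itself, which
  -- therefore lies in `A ⊗ C`.
  obtain ⟨u, hu⟩ := hπ 1
  obtain ⟨δ, hδ⟩ := exists_factor (emb (A ⊗ₘ C)) emb_injective
    ((extTensor (emb A) ((emb C).comp π)).comp Δ.hom) fun a => by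
      obtain ⟨w, hw⟩ := hΔ.exists_right a u
      have h := congrArg (extTensor (emb A) ((emb C).comp π)) hw
      have h1 := homTensor_emb_comp (NonUnitalStarAlgHom.id ℂ A) π
      rw [NonUnitalStarAlgHom.comp_id] at h1
      rw [extTensor_emb nondegenerate_emb hπ', map_mul, extTensor_mulTensor nondegenerate_emb hπ',
        mulExt_emb hπ', mulExt_one nondegenerate_emb, NonUnitalStarAlgHom.comp_apply, hu, emb_one,
        mulTensor_one, mul_one, h1] at h
      exact ⟨_, h⟩
  exact ⟨δ, DFunLike.ext _ _ hδ⟩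

variable {δ : A →⋆ₙₐ[ℂ] A ⊗ₘ C}

theorem nondegenerate_right_coaction (hπ : Function.Surjective π)
    (hδ : (emb _).comp δ = (extTensor (emb A) ((emb C).comp π)).comp Δ.hom) :
    Nondegenerate ((emb _).comp δ) :=
  hδ ▸ nondegenerate_comp Δ.nondegenerate (nondegenerate_homTensor nondegenerate_emb
    (nondegenerate_emb_comp_of_surjective hπ))

/-- The multiplier form of `(Δ ⊗ id)δ = (id ⊗ δ)Δ`. -/
theorem extAssoc_extTensor_right_coaction (hΔ : IsBisimplifiableHopf Δ)
    (hπ : Function.Surjective π)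
    (hδ : (emb _).comp δ = (extTensor (emb A) ((emb C).comp π)).comp Δ.hom) (a : A) :
    extAssoc A A C (extTensor Δ.hom (emb C) (emb _ (δ a))) =
      extTensor (emb A) ((emb _).comp δ) (Δ.hom a) := by
  have hπ' := nondegenerate_emb_comp_of_surjective hπ
  have e0 : emb _ (δ a) = extTensor (emb A) ((emb C).comp π) (Δ.hom a) :=
    congrArg (fun φ => φ a) hδ
  have e1 : extTensor Δ.hom (emb C) (emb _ (δ a)) =
      extTensor (homTensor (emb A) (emb A)) ((emb C).comp π)
        (extTensor Δ.hom (emb A) (Δ.hom a)) := by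
    rw [e0, homTensor_emb_emb, extTensor_extTensor Δ.nondegenerate nondegenerate_emb
      nondegenerate_emb hπ', extTensor_extTensor nondegenerate_emb hπ' Δ.nondegenerate
      nondegenerate_emb, mulExt_comp_emb Δ.nondegenerate, mulExt_emb_comp, mulExt_emb_comp,
      mulExt_comp_emb hπ']
  rw [e1, extAssoc_extTensor nondegenerate_emb nondegenerate_emb hπ', hΔ.coassoc,
    extTensor_extTensor nondegenerate_emb (nondegenerate_homTensor nondegenerate_emb hπ')
      nondegenerate_emb Δ.nondegenerate, mulExt_emb_comp, hδ]
  rfl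

/-- Both sides equal `id ⊗ π ⊗ π` applied to the iterated comultiplication, by coassociativity and
`(π ⊗ π)Δ = Δ_C π`. -/
theorem isCoaction_right_coaction (hΔ : IsBisimplifiableHopf Δ) (hπ : Function.Surjective π)
    (hπΔ : ∀ a : A, extTensor ((emb C).comp π) ((emb C).comp π) (Δ.hom a) = ΔC.hom (π a))
    (hδ : (emb _).comp δ = (extTensor (emb A) ((emb C).comp π)).comp Δ.hom)
    {δC : C →⋆ₙₐ[ℂ] C ⊗ₘ C} (hδC : (emb _).comp δC = ΔC.hom) : IsCoaction δC δ := by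
  intro a
  have hπ' := nondegenerate_emb_comp_of_surjective hπ
  have hδn := nondegenerate_right_coaction hπ hδ
  have e0 : emb _ (δ a) = extTensor (emb A) ((emb C).comp π) (Δ.hom a) :=
    congrArg (fun φ => φ a) hδ
  have hd : Nondegenerate (homTensor (emb A) ((emb C).comp π)) :=
    nondegenerate_homTensor nondegenerate_emb hπ'
  have h1 := homTensor_emb_comp δ (NonUnitalStarAlgHom.id ℂ C)
  have h2 := homTensor_emb_comp (NonUnitalStarAlgHom.id ℂ A) δC
  rw [NonUnitalStarAlgHom.comp_id] at h1 h2
  have l1 : emb _ (tmap δ (NonUnitalStarAlgHom.id ℂ C) (δ a)) =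
      extTensor (homTensor (emb A) ((emb C).comp π)) ((emb C).comp π)
        (extTensor Δ.hom (emb A) (Δ.hom a)) := by
    rw [extTensor_extTensor hd hπ' Δ.nondegenerate nondegenerate_emb, mulExt_comp_emb hπ']
    have : emb _ (tmap δ (NonUnitalStarAlgHom.id ℂ C) (δ a)) =
        extTensor ((emb _).comp δ) (emb C) (emb _ (δ a)) := by
      rw [extTensor_emb hδn nondegenerate_emb, h1]; rfl
    rw [this, e0, extTensor_extTensor hδn nondegenerate_emb nondegenerate_emb hπ',
      mulExt_comp_emb hδn, mulExt_emb_comp, hδ]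
    rfl
  have r1 : emb _ (tmap (NonUnitalStarAlgHom.id ℂ A) δC (δ a)) =
      extTensor (emb A) (ΔC.hom.comp π) (Δ.hom a) := by
    have : emb _ (tmap (NonUnitalStarAlgHom.id ℂ A) δC (δ a)) =
        extTensor (emb A) ((emb _).comp δC) (emb _ (δ a)) := by
      rw [extTensor_emb nondegenerate_emb (hδC ▸ ΔC.nondegenerate), h2]; rfl
    rw [this, hδC, e0, extTensor_extTensor nondegenerate_emb ΔC.nondegenerate nondegenerate_emb hπ',
      mulExt_emb_comp, mulExt_comp_emb_comp ΔC.nondegenerate]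
  have hππ : (extTensor ((emb C).comp π) ((emb C).comp π)).comp Δ.hom = ΔC.hom.comp π :=
    DFunLike.ext _ _ hπΔ
  refine emb_injective ?_
  rw [← extAssoc_emb, l1, r1, extAssoc_extTensor nondegenerate_emb hπ' hπ', hΔ.coassoc,
    extTensor_extTensor nondegenerate_emb (nondegenerate_homTensor hπ' hπ') nondegenerate_emb
      Δ.nondegenerate, mulExt_emb_comp, ← hππ]
  rfl

/-- Averaging over the quantum subgroup: an idempotent map `E` onto the fixed points of `δ`,
together with the map `id ⊗ E`. -/
structure Averaging (Δ : Mor A (A ⊗ₘ A)) (δ : A →⋆ₙₐ[ℂ] A ⊗ₘ C) where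
  /-- The averaging map. -/
  map : A →L[ℂ] A
  /-- The map `id ⊗ E`. -/
  idTensor : A ⊗ₘ A →L[ℂ] A ⊗ₘ A
  mem : ∀ a, map a ∈ fixedPoints δ
  map_eq : ∀ b ∈ fixedPoints δ, map b = b
  idTensor_tmul : ∀ x a, idTensor (tmul x a) = tmul x (map a)
  emb_idTensor : ∀ x a w, emb _ w = mulTensor (emb A x) 1 * Δ.hom a →
    emb _ (idTensor w) = mulTensor (emb A x) 1 * Δ.hom (map a)
  mem_closure : ∀ a, a ∈ closure (Set.range fun x => map x * a)

section

attribute [local instance] CStarAlgebra.spectralOrder CStarAlgebra.spectralOrderedRing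

/-- The zero algebra has no state. In that case `A ⊗ C = 0`, every element is fixed, and the
identity serves as averaging map. -/
theorem nonempty_averaging_of_subsingleton [Subsingleton C] :
    Nonempty (Averaging Δ δ) := by
  have h0 : ∀ z w : A ⊗ₘ C, z = w := fun z w => congrArg (fun L => L z) (tensor_ext_clm
    (S := ContinuousLinearMap.id ℂ (A ⊗ₘ C)) (T := 0) fun a c => by
      change tmul a c = 0
      rw [Subsingleton.elim c 0, tmul_zero_right]) |>.trans
    (congrArg (fun L => L w) (tensor_ext_clm
    (S := ContinuousLinearMap.id ℂ (A ⊗ₘ C)) (T := 0) fun a c => by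
      change tmul a c = 0
      rw [Subsingleton.elim c 0, tmul_zero_right])).symm
  refine ⟨{ map := ContinuousLinearMap.id ℂ A
            idTensor := ContinuousLinearMap.id ℂ _
            mem := fun a => h0 _ _
            map_eq := fun _ _ => rfl
            idTensor_tmul := fun _ _ => rfl
            emb_idTensor := fun _ _ _ h => h
            mem_closure := fun a => ?_ }⟩
  have hne : (CStarAlgebra.approximateUnit A).NeBot :=
    (CStarAlgebra.increasingApproximateUnit A).neBot
  exact mem_closure_of_tendsto (tendsto_approximateUnit_fst nondegenerate_emb a)
    (Filter.Eventually.of_forall fun u => ⟨u, rfl⟩)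

/-- The averaging map is `(id ⊗ h)δ` with `h` the Haar state of `C`. -/
theorem nonempty_averaging [Nontrivial C] (hΔ : IsBisimplifiableHopf Δ)
    (hΔC : IsCompactQuantumGroup ΔC) (hπ : Function.Surjective π)
    (hπΔ : ∀ a : A, extTensor ((emb C).comp π) ((emb C).comp π) (Δ.hom a) = ΔC.hom (π a))
    (hδ : (emb _).comp δ = (extTensor (emb A) ((emb C).comp π)).comp Δ.hom) :
    Nonempty (Averaging Δ δ) := by
  have hπ' := nondegenerate_emb_comp_of_surjective hπ
  have hδn := nondegenerate_right_coaction hπ hδ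
  obtain ⟨δC, hδC⟩ := exists_comul ΔC
  obtain ⟨h, hh1, hh⟩ := exists_haar_of_compact hΔC hδC
  have hco := isCoaction_right_coaction hΔ hπ hπΔ hδ hδC
  refine ⟨{ map := (rslice A h).comp (homL δ)
            idTensor := (rslice (A ⊗ₘ A) h).comp ((homL (assocInv A A C)).comp
              (homL (tmap (NonUnitalStarAlgHom.id ℂ A) δ)))
            mem := fun a => ?_
            map_eq := fun b hb => ?_
            idTensor_tmul := fun x a => ?_
            emb_idTensor := fun x a w hw => ?_
            mem_closure := fun a => ?_ }⟩
  -- The coaction identity turns `δ(E a)` into `(id ⊗ id ⊗ h)(id ⊗ Δ_C)δ(a)`, and invariance of `h`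
  -- makes this `E a ⊗ 1`.
  · change δ (rslice A h (δ a)) = tmul (rslice A h (δ a)) 1
    rw [hco.map_rslice]
    refine congrArg (fun L => L (δ a)) (tensor_ext_clm
      (S := (rslice (A ⊗ₘ C) h).comp ((homL (assocInv A C C)).comp
        (homL (tmap (NonUnitalStarAlgHom.id ℂ A) δC))))
      (T := ((tmulL A C).flip 1).comp (rslice A h)) fun x c => ?_)
    change rslice (A ⊗ₘ C) h (assocInv A C C (tmap (NonUnitalStarAlgHom.id ℂ A) δC (tmul x c))) =
      tmul (rslice A h (tmul x c)) 1
    rw [tmap_tmul, rslice_assocInv_tmul, hh, rslice_tmul, tmul_smul_right, tmul_smul_left]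
    rfl
  · change rslice A h (δ b) = b
    rw [show δ b = tmul b 1 from hb, rslice_tmul, hh1, one_smul]
  · change rslice (A ⊗ₘ A) h (assocInv A A C (tmap (NonUnitalStarAlgHom.id ℂ A) δ (tmul x a))) = _
    rw [tmap_tmul, rslice_assocInv_tmul]
    rfl
  · have h2 := homTensor_emb_comp (NonUnitalStarAlgHom.id ℂ A) δ
    rw [NonUnitalStarAlgHom.comp_id] at h2
    -- Applying `id ⊗ δ` to `w = (x ⊗ 1)Δ(a)` gives `(x ⊗ 1 ⊗ 1)(Δ ⊗ id)δ(a)`. Slicing the last leg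
    -- by `h` then yields the claim; `hs` and `hm` say that the slice commutes with `Δ ⊗ id` and
    -- with multipliers of the first two legs.
    have key : mulTensor (mulTensor (emb A x) 1) 1 * homTensor Δ.hom (emb C) (δ a) =
        emb _ (assocInv A A C (tmap (NonUnitalStarAlgHom.id ℂ A) δ w)) := by
      refine mulExt_injective (J := assoc A A C)
        (fun z z' hz => by rw [← assocInv_assoc z, hz, assocInv_assoc])
        (nondegenerate_emb_comp_assoc A A C) ?_
      change extAssoc A A C _ = extAssoc A A C _
      rw [map_mul, extAssoc_mulTensor, mulTensor_one, extAssoc_emb, assoc_assocInv,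
        ← extTensor_emb Δ.nondegenerate nondegenerate_emb,
        extAssoc_extTensor_right_coaction hΔ hπ hδ]
      have h3 := congrArg (extTensor (emb A) ((emb _).comp δ)) hw
      rw [map_mul, extTensor_mulTensor nondegenerate_emb hδn, mulExt_one hδn, mulExt_emb_self,
        extTensor_emb nondegenerate_emb hδn, h2] at h3
      exact h3.symm
    have hs : ∀ y v, (Δ.hom (rslice A h v)).fst y =
        rslice (A ⊗ₘ A) h ((homTensor Δ.hom (emb C) v).fst (tmul y 1)) := fun y v =>
      congrArg (fun L => L v) (tensor_ext_clm
        (S := (evL y).comp ((homL Δ.hom).comp (rslice A h)))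
        (T := (rslice (A ⊗ₘ A) h).comp ((evL (tmul y 1)).comp (homL (homTensor Δ.hom (emb C)))))
        fun b c => by
          change (Δ.hom (rslice A h (tmul b c))).fst y =
            rslice (A ⊗ₘ A) h ((homTensor Δ.hom (emb C) (tmul b c)).fst (tmul y 1))
          rw [homTensor_tmul, mulTensor_fst, emb_fst, mul_one, rslice_tmul, rslice_tmul, map_smul]
          rfl)
    have hm : ∀ (m : 𝓜(ℂ, A ⊗ₘ A)) (v : (A ⊗ₘ A) ⊗ₘ C),
        rslice (A ⊗ₘ A) h ((mulTensor m 1).fst v) = m.fst (rslice (A ⊗ₘ A) h v) := fun m v =>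
      congrArg (fun L => L v) (tensor_ext_clm
        (S := (rslice (A ⊗ₘ A) h).comp (mulTensor m (1 : 𝓜(ℂ, C))).fst)
        (T := m.fst.comp (rslice (A ⊗ₘ A) h)) fun b c => by
          change rslice (A ⊗ₘ A) h ((mulTensor m 1).fst (tmul b c)) =
            m.fst (rslice (A ⊗ₘ A) h (tmul b c))
          rw [mulTensor_fst, rslice_tmul, rslice_tmul, map_smul]
          rfl)
    refine multiplier_ext fun y => ?_
    change rslice (A ⊗ₘ A) h (assocInv A A C (tmap (NonUnitalStarAlgHom.id ℂ A) δ w)) * y =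
      (mulTensor (emb A x) 1).fst ((Δ.hom (rslice A h (δ a))).fst y)
    rw [hs, ← hm, ← mul_fst_apply, key, emb_fst, rslice_mul_tmul_one]
  · have hne : (CStarAlgebra.approximateUnit A).NeBot :=
      (CStarAlgebra.increasingApproximateUnit A).neBot
    -- Nondegeneracy of `δ` gives `δ(u)(a ⊗ 1) → a ⊗ 1`; the slice by `h` turns this into `E(u)a →
    -- a`.
    have ht := ((rslice A h).continuous.tendsto _).comp
      (tendsto_approximateUnit_fst hδn (tmul a (1 : C)))
    rw [rslice_tmul, hh1, one_smul] at ht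
    refine mem_closure_of_tendsto ht (Filter.Eventually.of_forall fun u => ⟨u, ?_⟩)
    change rslice A h (δ u) * a = rslice A h (δ u * tmul a 1)
    rw [rslice_mul_tmul_one]

end

end Expectation

/-! ### The quotient algebra and its action. -/

section Quotient

variable {A C : Type*} [NonUnitalCStarAlgebra A] [CStarAlgebra C] {Δ : Mor A (A ⊗ₘ A)}
  {δ : A →⋆ₙₐ[ℂ] A ⊗ₘ C}

instance : IsClosed (fixedPoints δ : Set A) := isClosed_fixedPoints δ

variable (δ) in
/-- The inclusion of the fixed points. -/
def fixedIncl : fixedPoints δ →⋆ₙₐ[ℂ] A := NonUnitalStarSubalgebraClass.subtype (fixedPoints δ)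

theorem fixedIncl_injective : Function.Injective (fixedIncl δ) := Subtype.val_injective

variable (δ) in
/-- The inclusion of `A ⊗ B` into `A ⊗ A`, where `B` is the algebra of fixed points. -/
def tensorIncl : A ⊗ₘ fixedPoints δ →⋆ₙₐ[ℂ] A ⊗ₘ A :=
  tmap (NonUnitalStarAlgHom.id ℂ A) (fixedIncl δ)

theorem tensorIncl_tmul (x : A) (b : fixedPoints δ) :
    tensorIncl δ (tmul x b) = tmul x (b : A) := tmap_tmul _ _ _ _

theorem tensorIncl_injective : Function.Injective (tensorIncl δ) :=
  tmap_injective Function.injective_id fixedIncl_injective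

theorem homTensor_emb_fixedIncl :
    homTensor (emb A) ((emb A).comp (fixedIncl δ)) = (emb _).comp (tensorIncl δ) := by
  have h := homTensor_emb_comp (NonUnitalStarAlgHom.id ℂ A) (fixedIncl δ)
  rwa [NonUnitalStarAlgHom.comp_id] at h

theorem isClosed_range_tensorIncl :
    IsClosed (LinearMap.range (homL (tensorIncl δ)).toLinearMap : Set (A ⊗ₘ A)) :=
  isClosed_range_hom _ tensorIncl_injective

namespace Averaging

theorem nondegenerate_fixedIncl (E : Averaging Δ δ) : Nondegenerate ((emb A).comp (fixedIncl δ)) :=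
  nondegenerate_of_induction fun S hS h a =>
    hS.closure_subset_iff.2 (by rintro _ ⟨x, rfl⟩; exact h ⟨E.map x, E.mem x⟩ a) (E.mem_closure a)

theorem idTensor_mem_range (E : Averaging Δ δ) (w : A ⊗ₘ A) :
    E.idTensor w ∈ LinearMap.range (homL (tensorIncl δ)).toLinearMap :=
  tensor_induction (isClosed_comap_clm E.idTensor isClosed_range_tensorIncl)
    (fun x a => ⟨tmul x ⟨E.map a, E.mem a⟩,
      (tensorIncl_tmul _ _).trans (E.idTensor_tmul x a).symm⟩) w

/-- The element `(x ⊗ 1)Δ(b)` of `A ⊗ A` is fixed by `id ⊗ E` because `E b = b`, and the range of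
`id ⊗ E` lies in `A ⊗ B`. -/
theorem exists_left (E : Averaging Δ δ) (hΔ : IsBisimplifiableHopf Δ) (x : A) (b : fixedPoints δ) :
    ∃ z, emb _ (tensorIncl δ z) = mulTensor (emb A x) 1 * Δ.hom b := by
  obtain ⟨w, hw⟩ := hΔ.exists_left x b
  obtain ⟨z, hz⟩ := E.idTensor_mem_range w
  refine ⟨z, ?_⟩
  have h := E.emb_idTensor x b w hw
  rw [E.map_eq _ b.2, ← hz] at h
  exact h

/-- Density of `(A ⊗ 1)Δ(B)` in `A ⊗ B`: the map `id ⊗ E` carries the dense span of `(A ⊗ 1)Δ(A)`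
into that of `(A ⊗ 1)Δ(B)` and is the identity on `A ⊗ B`. -/
theorem induction_left (E : Averaging Δ δ) (hΔ : IsBisimplifiableHopf Δ) {S : Submodule ℂ (A ⊗ₘ A)}
    (hS : IsClosed (S : Set (A ⊗ₘ A)))
    (h : ∀ x (b : fixedPoints δ) w, emb _ w = mulTensor (emb A x) 1 * Δ.hom b → w ∈ S)
    (z : A ⊗ₘ fixedPoints δ) : tensorIncl δ z ∈ S := by
  have h1 : ∀ w, E.idTensor w ∈ S := hΔ.induction_left (isClosed_comap_clm E.idTensor hS)
    fun x a w hw => h x ⟨E.map a, E.mem a⟩ _ (E.emb_idTensor x a w hw)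
  refine tensor_induction (isClosed_comap_clm (homL (tensorIncl δ)) hS) (fun x b => ?_) z
  change tensorIncl δ (tmul x b) ∈ S
  have h2 := E.idTensor_tmul x b
  rw [E.map_eq _ b.2] at h2
  rw [tensorIncl_tmul, ← h2]
  exact h1 _

theorem induction_right (E : Averaging Δ δ) (hΔ : IsBisimplifiableHopf Δ)
    {S : Submodule ℂ (A ⊗ₘ A)} (hS : IsClosed (S : Set (A ⊗ₘ A)))
    (h : ∀ x (b : fixedPoints δ) w, emb _ w = Δ.hom b * mulTensor (emb A x) 1 → w ∈ S)
    (z : A ⊗ₘ fixedPoints δ) : tensorIncl δ z ∈ S := by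
  let S' : Submodule ℂ (A ⊗ₘ A) :=
    { carrier := {w | star w ∈ S}
      add_mem' := fun {v w} hv hw => by
        rw [Set.mem_ofPred_eq, star_add]; exact S.add_mem hv hw
      zero_mem' := by rw [Set.mem_ofPred_eq, star_zero]; exact S.zero_mem
      smul_mem' := fun c w hw => by
        rw [Set.mem_ofPred_eq, star_smul]; exact S.smul_mem _ hw }
  have h1 := E.induction_left hΔ (S := S') (hS.preimage continuous_star) (fun x b w hw => by
    refine h (star x) (star b) _ ?_
    rw [map_star, hw, star_mul, star_mulTensor, star_one, ← map_star, ← map_star]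
    rfl) (star z)
  change star (tensorIncl δ (star z)) ∈ S at h1
  rwa [← map_star, star_star] at h1

/-- On simple tensors, `(x ⊗ c)Δ(b) = (1 ⊗ c)((x ⊗ 1)Δ(b))`, where the second factor is in `A ⊗ B`
and `1 ⊗ c` preserves `A ⊗ B`. -/
theorem emb_mul_mem_range (E : Averaging Δ δ) (hΔ : IsBisimplifiableHopf Δ) (b : fixedPoints δ)
    (z : A ⊗ₘ fixedPoints δ) :
    ∃ y, emb _ (tensorIncl δ y) = emb _ (tensorIncl δ z) * Δ.hom b := by
  have h1 : ∀ (c : fixedPoints δ) (y : A ⊗ₘ fixedPoints δ),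
      (mulTensor 1 (emb A c)).fst (tensorIncl δ y) ∈
        LinearMap.range (homL (tensorIncl δ)).toLinearMap := fun c y =>
    tensor_induction (isClosed_comap_clm ((mulTensor 1 (emb A c)).fst.comp (homL (tensorIncl δ)))
      isClosed_range_tensorIncl) (fun x d => ⟨tmul x (c * d), by
        change tensorIncl δ (tmul x (c * d)) = (mulTensor 1 (emb A c)).fst (tensorIncl δ (tmul x d))
        rw [tensorIncl_tmul, tensorIncl_tmul, mulTensor_fst]
        rfl⟩) y
  have h2 : (Δ.hom b).snd (tensorIncl δ z) ∈
      LinearMap.range (homL (tensorIncl δ)).toLinearMap := by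
    refine tensor_induction (isClosed_comap_clm ((Δ.hom b).snd.comp (homL (tensorIncl δ)))
      isClosed_range_tensorIncl) (fun x c => ?_) z
    change (Δ.hom b).snd (tensorIncl δ (tmul x c)) ∈
      LinearMap.range (homL (tensorIncl δ)).toLinearMap
    obtain ⟨y, hy⟩ := E.exists_left hΔ x b
    have : (Δ.hom b).snd (tensorIncl δ (tmul x c)) =
        (mulTensor 1 (emb A c)).fst (tensorIncl δ y) := emb_injective (by
      rw [← emb_mul, ← mul_emb, hy, ← mul_assoc, mulTensor_mul, one_mul, mul_one, tensorIncl_tmul,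
        mulTensor_emb])
    rw [this]
    exact h1 c y
  obtain ⟨y, hy⟩ := h2
  refine ⟨y, ?_⟩
  rw [emb_mul, ← hy]
  rfl

/-- The comultiplication restricts to the fixed points. -/
theorem exists_action_hom (E : Averaging Δ δ) (hΔ : IsBisimplifiableHopf Δ) :
    ∃ α : fixedPoints δ →⋆ₙₐ[ℂ] 𝓜(ℂ, A ⊗ₘ fixedPoints δ),
      ∀ b z, emb _ (tensorIncl δ ((α b).fst z)) = Δ.hom b * emb _ (tensorIncl δ z) :=
  exists_idealizer_hom ((emb _).comp (tensorIncl δ)) (emb_injective.comp tensorIncl_injective)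
    (Δ.hom.comp (fixedIncl δ)) (fun b z => by
      obtain ⟨y, hy⟩ := E.emb_mul_mem_range hΔ (star b) (star z)
      refine ⟨star y, ?_⟩
      change emb _ (tensorIncl δ (star y)) = Δ.hom b * emb _ (tensorIncl δ z)
      rw [map_star (tensorIncl δ), map_star (emb _), hy, star_mul, ← map_star Δ.hom,
        ← map_star (emb _), ← map_star (tensorIncl δ), star_star]
      exact congrArg (fun c => Δ.hom c * _) (star_star (b : A)))
    fun b z => E.emb_mul_mem_range hΔ b z

variable {α : fixedPoints δ →⋆ₙₐ[ℂ] 𝓜(ℂ, A ⊗ₘ fixedPoints δ)}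

/-- Products `z(y ⊗ c)` span a dense subspace. Approximating `z` by sums of `Δ(b)(x ⊗ 1)` brings
them to the form `α(b)(xy ⊗ c)`. -/
theorem nondegenerate_action (E : Averaging Δ δ) (hΔ : IsBisimplifiableHopf Δ)
    (hα : ∀ b z, emb _ (tensorIncl δ ((α b).fst z)) = Δ.hom b * emb _ (tensorIncl δ z)) :
    Nondegenerate α := by
  refine nondegenerate_of_induction fun S hS h z => mul_induction hS (fun z z' => ?_) z
  refine tensor_induction (isClosed_comap_clm (ContinuousLinearMap.mul ℂ _ z) hS) (fun y c => ?_) z'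
  change z * tmul y c ∈ S
  have hS' : IsClosed (S.map (homL (tensorIncl δ)).toLinearMap : Set (A ⊗ₘ A)) :=
    (NonUnitalStarAlgHom.isometry (tensorIncl δ) tensorIncl_injective).isClosedEmbedding.isClosedMap
      _ hS
  obtain ⟨s, hs, hsz⟩ := E.induction_right hΔ (isClosed_comap_clm
    ((ContinuousLinearMap.mul ℂ _).flip (tensorIncl δ (tmul y c))) hS') (fun x b w hw => by
      refine ⟨(α b).fst (tmul (x * y) c), h _ _, emb_injective ?_⟩
      change emb _ (tensorIncl δ ((α b).fst (tmul (x * y) c))) =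
        emb _ (w * tensorIncl δ (tmul y c))
      rw [hα, map_mul, hw, mul_assoc, mul_emb (mulTensor (emb A x) 1), tensorIncl_tmul,
        tensorIncl_tmul, mulTensor_fst]
      rfl) z
  have : s = z * tmul y c := tensorIncl_injective (by rw [map_mul]; exact hsz)
  exact this ▸ hs

variable {α : Mor (fixedPoints δ) (A ⊗ₘ fixedPoints δ)}

theorem extTensor_action (E : Averaging Δ δ)
    (hα : ∀ b z, emb _ (tensorIncl δ ((α.hom b).fst z)) = Δ.hom b * emb _ (tensorIncl δ z))
    (b : fixedPoints δ) :
    extTensor (emb A) ((emb A).comp (fixedIncl δ)) (α.hom b) = Δ.hom b := by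
  refine (eq_mulExt (nondegenerate_homTensor nondegenerate_emb E.nondegenerate_fixedIncl)
    fun z => ?_).symm
  rw [homTensor_emb_fixedIncl]
  exact (hα b z).symm

/-- The embedding `id ⊗ ι` into `M(K ⊗ A)`, with `ι` the inclusion of `B`, is injective and commutes
with `ε ⊗ id`, so the identity may be checked for `Δ(b)`. -/
theorem counit_action (E : Averaging Δ δ) {K : Type*} [NonUnitalCStarAlgebra K] {ε : Mor A K}
    (hα : ∀ b, extTensor (emb A) ((emb A).comp (fixedIncl δ)) (α.hom b) = Δ.hom b)
    {b : fixedPoints δ} (hb : extTensor ε.hom (emb A) (Δ.hom b) = mulTensor 1 (emb A b)) :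
    extTensor ε.hom (emb (fixedPoints δ)) (α.hom b) = mulTensor 1 (emb (fixedPoints δ) b) := by
  have hι := E.nondegenerate_fixedIncl
  have hinj : Function.Injective (extTensor (emb K) ((emb A).comp (fixedIncl δ))) := by
    have h := homTensor_emb_comp (NonUnitalStarAlgHom.id ℂ K) (fixedIncl δ)
    rw [NonUnitalStarAlgHom.comp_id] at h
    have hn := nondegenerate_homTensor (nondegenerate_emb (X := K)) hι
    rw [h] at hn
    rw [extTensor, h]
    exact mulExt_injective (tmap_injective Function.injective_id fixedIncl_injective) hn
  refine hinj ?_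
  rw [extTensor_mulTensor nondegenerate_emb hι, mulExt_one nondegenerate_emb, mulExt_emb hι,
    extTensor_extTensor nondegenerate_emb hι ε.nondegenerate nondegenerate_emb, mulExt_emb_comp,
    mulExt_comp_emb hι]
  rw [← hα b, extTensor_extTensor ε.nondegenerate nondegenerate_emb nondegenerate_emb hι,
    mulExt_emb_comp, mulExt_comp_emb ε.nondegenerate] at hb
  exact hb

theorem isContinuousAction (E : Averaging Δ δ) (hΔ : IsBisimplifiableHopf Δ) {ε : Mor A ℂ}
    (hε : IsCounit Δ ε)
    (hα : ∀ b, extTensor (emb A) ((emb A).comp (fixedIncl δ)) (α.hom b) = Δ.hom b) :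
    IsContinuousAction Δ ε α := by
  have hι := E.nondegenerate_fixedIncl
  have hJ := nondegenerate_homTensor (nondegenerate_emb (X := A)) hι
  have hinj : Function.Injective (extTensor (emb A) ((emb A).comp (fixedIncl δ))) := by
    rw [extTensor, homTensor_emb_fixedIncl]
    exact mulExt_injective tensorIncl_injective (homTensor_emb_fixedIncl (δ := δ) ▸ hJ)
  refine ⟨fun b => ?_, fun a b => ?_, fun b => ?_⟩
  -- Both sides are compared in `M(A ⊗ (A ⊗ A))`, where they become the two sides of coassociativity
  -- at `b`.
  · have hinj' : Function.Injective
        (extTensor (emb A) (homTensor (emb A) ((emb A).comp (fixedIncl δ)))) := by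
      have h := homTensor_emb_comp (NonUnitalStarAlgHom.id ℂ A) (tensorIncl δ)
      rw [NonUnitalStarAlgHom.comp_id] at h
      have hn := nondegenerate_homTensor (nondegenerate_emb (X := A)) hJ
      rw [homTensor_emb_fixedIncl, h] at hn
      rw [extTensor, homTensor_emb_fixedIncl, h]
      exact mulExt_injective (tmap_injective Function.injective_id tensorIncl_injective) hn
    refine hinj' ?_
    have hl : extTensor (homTensor (emb A) (emb A)) ((emb A).comp (fixedIncl δ))
        (extTensor Δ.hom (emb (fixedPoints δ)) (α.hom b)) =
          extTensor Δ.hom (emb A) (Δ.hom b) := by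
      rw [← hα b, homTensor_emb_emb, extTensor_extTensor nondegenerate_emb hι Δ.nondegenerate
        nondegenerate_emb, extTensor_extTensor Δ.nondegenerate nondegenerate_emb nondegenerate_emb
        hι, mulExt_emb_comp, mulExt_emb_comp, mulExt_comp_emb hι, mulExt_comp_emb Δ.nondegenerate]
    have hr : extTensor (emb A) (homTensor (emb A) ((emb A).comp (fixedIncl δ)))
        (extTensor (emb A) α.hom (α.hom b)) = extTensor (emb A) Δ.hom (Δ.hom b) := by
      have hαΔ : (mulExt (homTensor (emb A) ((emb A).comp (fixedIncl δ)))).comp α.hom =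
          Δ.hom.comp (fixedIncl δ) := DFunLike.ext _ _ hα
      rw [← hα b, extTensor_extTensor nondegenerate_emb hJ nondegenerate_emb α.nondegenerate,
        extTensor_extTensor nondegenerate_emb Δ.nondegenerate nondegenerate_emb hι,
        mulExt_emb_comp, mulExt_comp_emb_comp Δ.nondegenerate, hαΔ]
    rw [hr, ← extAssoc_extTensor nondegenerate_emb nondegenerate_emb hι, hl, hΔ.coassoc]
  · obtain ⟨z, hz⟩ := E.exists_left hΔ a b
    refine ⟨z, hinj ?_⟩
    rw [extTensor_emb nondegenerate_emb hι, homTensor_emb_fixedIncl, map_mul,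
      extTensor_mulTensor nondegenerate_emb hι, mulExt_emb_self, mulExt_one hι, hα]
    exact hz
  · exact E.counit_action hα (hε.left b)

end Averaging

end Quotient

end

end PodlesQuotient

open PodlesQuotient in
theorem theorem5p1 {A : Type u} [NonUnitalCStarAlgebra A] {C : Type v} [CStarAlgebra C]
    (Δ : Mor A (A ⊗ₘ A)) (hΔ : IsBisimplifiableHopf Δ)
    (ε : Mor A ℂ) (hε : IsCounit Δ ε)
    (ΔC : Mor C (C ⊗ₘ C)) (hΔC : IsCompactQuantumGroup ΔC)
    (π : A →⋆ₙₐ[ℂ] C) (hπ : Function.Surjective π)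
    (hπΔ : ∀ a : A, extTensor ((emb C).comp π) ((emb C).comp π) (Δ.hom a) = ΔC.hom (π a)) :
    ∃ (B : NonUnitalStarSubalgebra ℂ A) (_ : IsClosed (B : Set A)),
      (B : Set A) =
        {x : A | extTensor (emb A) ((emb C).comp π) (Δ.hom x) = mulTensor (emb A x) 1} ∧
      Nondegenerate ((emb A).comp (NonUnitalStarSubalgebraClass.subtype B)) ∧
      ∃ α : Mor B (A ⊗ₘ B),
        (∀ b : B, extTensor (emb A) ((emb A).comp (NonUnitalStarSubalgebraClass.subtype B))
          (α.hom b) = Δ.hom (b : A)) ∧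
        IsContinuousAction Δ ε α := by
  obtain ⟨δ, hδ⟩ := exists_right_coaction hΔ hπ
  obtain ⟨E⟩ : Nonempty (Averaging Δ δ) := by
    cases subsingleton_or_nontrivial C
    · exact nonempty_averaging_of_subsingleton
    · exact nonempty_averaging hΔ hΔC hπ hπΔ hδ
  obtain ⟨α, hα⟩ := E.exists_action_hom hΔ
  have hα' := E.extTensor_action (α := ⟨α, E.nondegenerate_action hΔ hα⟩) hα
  refine ⟨fixedPoints δ, isClosed_fixedPoints δ, Set.ext fun x => ?_, E.nondegenerate_fixedIncl,
    ⟨α, E.nondegenerate_action hΔ hα⟩, hα', E.isContinuousAction hΔ hε hα'⟩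
  change δ x = tmul x 1 ↔
    ((extTensor (emb A) ((emb C).comp π)).comp Δ.hom) x = mulTensor (emb A x) 1
  rw [← hδ, ← emb_tmul_one]
  exact emb_injective.eq_iff.symm
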